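/- Let $p>1$ and $q>p-1$, and put $\beta_q=\frac{p}{q+1-p}>0$ and $\lambda_{q,p}=\beta_q(q\beta_q-2)$. Let $S$ be an angular sector of the unit circle $S^1$, that is, an open arc with opening angle in $(0,2\pi)$, and let $'$ denote the derivative with respect to the angle $\sigma$. Solutions below are continuous on $\overline S$ and $C^1$ in $S$, and the expression under the outer derivative is differentiable in $S$. Consider in $S$ the equation $$-\Big(\big(\beta_q^2\omega^2+\omega'^2\big)^{\frac p2-1}\omega'\Big)'-|\omega|^{q-1}\omega=\lambda_{q,p}\big(\beta_q^2\omega^2+\omega'^2\big)^{\frac p2-1}\omega .\qquad (1)$$ There is exactly one $\beta>0$, denoted $\beta_S$, for which the spherical $p$-harmonic spectral problem $$-\Big(\big(\beta^2\phi^2+\phi'^2\big)^{\frac p2-1}\phi'\Big)'=\beta\big(\beta(p-1)+p-2\big)\big(\beta^2\phi^2+\phi'^2\big)^{\frac p2-1}\phi\quad\text{in }S,$$ with $\phi=0$ at the two end points of $S$, has a solution $\phi$ that is positive in $S$. Then equation (1) has a solution that is positive in $S$ and vanishes at the two end points of $S$ if and only if $\beta_q<\beta_S$, and there is at most one such solution.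 In particular, if $p<2$ and $q\ge\frac{2(p-1)}{2-p}$, then such a solution exists for every sector $S$. -/

import Mathlib

/-- An angular sector of the unit circle `S¹`: an open arc with opening angle in `(0, 2π)`. Its
`frontier` in the circle consists of the two end points `exp (i a)` and `exp (i b)`. -/
def IsSector (S : Set Circle) : Prop :=
  ∃ a b : ℝ, a < b ∧ b < a + 2 * Real.pi ∧ S = Circle.exp '' Set.Ioo a b

/-- Covariant derivative on `S¹` along the unit tangent field. As the circle is one-dimensional,
this is both the gradient `∇'` of a function and the divergence `∇'·` of a tangent vector field,
tangent fields being identified with functions through the unit tangent field. -/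
noncomputable def angularDeriv (f : Circle → ℝ) (z : Circle) : ℝ :=
  deriv (fun t : ℝ => f (z * Circle.exp t)) 0

/-- Differentiability at a point of the circle, in the arc-length coordinate. -/
def AngularDifferentiableAt (f : Circle → ℝ) (z : Circle) : Prop :=
  DifferentiableAt ℝ (fun t : ℝ => f (z * Circle.exp t)) 0

/-- `f` is of class `C¹` near `z`, in the arc-length coordinate. -/
def AngularC1At (f : Circle → ℝ) (z : Circle) : Prop :=
  ContDiffAt ℝ 1 (fun t : ℝ => f (z * Circle.exp t)) 0

/-- The weight `(β² ω² + |∇' ω|²) ^ (p / 2 - 1)`. -/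
noncomputable def weight (p β : ℝ) (ω : Circle → ℝ) (z : Circle) : ℝ :=
  (β ^ 2 * ω z ^ 2 + angularDeriv ω z ^ 2) ^ (p / 2 - 1)

/-- The tangent field `(β² ω² + |∇' ω|²) ^ (p / 2 - 1) ∇' ω`. -/
noncomputable def flux (p β : ℝ) (ω : Circle → ℝ) (z : Circle) : ℝ :=
  weight p β ω z * angularDeriv ω z

/-- `ω` is positive and `C¹` in `S`, continuous on the closure of `S`, and vanishes on the boundary
of `S`. Only the values of `ω` on the closure of `S` matter. -/
structure IsPositiveVanishing (S : Set Circle) (ω : Circle → ℝ) : Prop where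
  continuousOn : ContinuousOn ω (closure S)
  pos : ∀ z ∈ S, 0 < ω z
  c1 : ∀ z ∈ S, AngularC1At ω z
  vanish : ∀ z ∈ frontier S, ω z = 0

/-- `β_q = p / (q + 1 - p)`. -/
noncomputable def betaQ (p q : ℝ) : ℝ := p / (q + 1 - p)

/-- `λ_{q,p} = β_q (q β_q - N)` with `N = 2`. -/
noncomputable def lambdaQ (p q : ℝ) : ℝ := betaQ p q * (q * betaQ p q - 2)

/-- `ω` is a positive solution in `S`, vanishing on the boundary of `S`, of
`-∇'·((β_q² ω² + |∇'ω|²)^(p/2-1) ∇'ω) - |ω|^(q-1) ω = λ_{q,p} (β_q² ω² + |∇'ω|²)^(p/2-1) ω`. -/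
structure IsPositiveSolution (p q : ℝ) (S : Set Circle) (ω : Circle → ℝ) : Prop where
  positiveVanishing : IsPositiveVanishing S ω
  flux_diff : ∀ z ∈ S, AngularDifferentiableAt (flux p (betaQ p q) ω) z
  equation : ∀ z ∈ S,
    -angularDeriv (flux p (betaQ p q) ω) z - |ω z| ^ (q - 1) * ω z
      = lambdaQ p q * (weight p (betaQ p q) ω z * ω z)

/-- `φ` is a positive solution of the spherical `p`-harmonic spectral equation in `S` with exponent
`β`, that is with `λ = β (β (p - 1) + p - N)` for `N = 2`, vanishing on the boundary of `S`. -/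
structure IsSpectralSolution (p β : ℝ) (S : Set Circle) (φ : Circle → ℝ) : Prop where
  positiveVanishing : IsPositiveVanishing S φ
  flux_diff : ∀ z ∈ S, AngularDifferentiableAt (flux p β φ) z
  equation : ∀ z ∈ S,
    -angularDeriv (flux p β φ) z = β * (β * (p - 1) + p - 2) * (weight p β φ z * φ z)

/-- `β = β_S`: a positive exponent for which the spherical `p`-harmonic spectral equation has a
positive solution in `S` vanishing on the boundary of `S`. -/
def IsSpectralExponent (p : ℝ) (S : Set Circle) (β : ℝ) : Prop :=
  0 < β ∧ ∃ φ : Circle → ℝ, IsSpectralSolution p β S φ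

/-! Pull the sector back to an interval $(a,b)$ and put $s=q+1-p$. Since $\beta_q s=p$, the constant
$\lambda_{q,p}$ has the spectral form $\beta(\beta(p-1)+p-2)$ at $\beta=\beta_q$. Both equations
thus belong to one family, with a coefficient $\kappa$ in front of $u^{p-1+s}$: $\kappa=0$ is the
spectral problem, $\kappa=1$ is equation (1). For a positive solution put $\ell=\log u$ and
$\cot\psi=u'/(\beta u)$. Then $\ell'=\beta\cot\psi$ and $\psi'=D/(\beta\varphi)$, where
$\varphi=(p-1)\cos^2\psi+\sin^2\psi$ and
$D=(p-1)\beta^2+(p-2)\beta\sin^2\psi+\kappa\beta^{2-p}e^{s\ell}\sin^p\psi$. Vanishing at the end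
points forces $\psi$ to go from $0$ to $\pi$.

If $\kappa=0$, the angle equation is autonomous, so $b-a$ is the travel time `opening p β`. This is
strictly decreasing on the admissible exponents and takes every positive value, so there is exactly
one $\beta_S$ (`Orbit.spectral`, `opening_lt_opening`, `exists_opening_eq`).

If $\kappa=1$, the extra term accelerates the angle, so $b-a$ is less than the opening of $\beta_q$
when $\beta_q$ is admissible (`Orbit.lt_opening`). This excludes $\beta_q\ge\beta_S$.

Existence for $\beta_q<\beta_S$ is a shooting argument in polar coordinates $u=e^r\sin\psi$,
$u'=\beta e^r\cos\psi$. There $r$ is a function of $x=\sin\psi$ alone and solves a scalar equation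
on $[0,1]$, regular at the boundary, for every initial value (`exists_polarSolution`). The travel
time depends continuously on $r(0)$, exceeds $b-a$ for some very negative value and is below $b-a$
for some large one (`continuous_polarTime`, `exists_polarTime_gt`, `exists_polarTime_lt`).

For uniqueness, reflection puts the only critical point at the midpoint, and before it $D>0$, so the
first half can be parametrised by the angle. Between two solutions the one with larger $\ell$ turns
faster; monotonicity of the equation in $\ell$ preserves the order, so the two could not both need
the time $(b-a)/2$ (`Orbit.eqOn_half`).

Finally, admissibility gives $\beta_S>(2-p)/(p-1)$ in every sector, and $q\ge 2(p-1)/(2-p)$ with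
$p<2$ says $\beta_q\le(2-p)/(p-1)$. -/

namespace SectorODE
open Set Filter Topology Real

/-- `u` is a positive solution on the interval `(a, b)`, vanishing at `a` and `b`, of
`-((β² u² + u'²)^(p/2-1) u')' - κ |u|^(p-2+s) u = λ (β² u² + u'²)^(p/2-1) u`, where
`λ = β (β (p - 1) + p - 2)`. -/
structure IntervalSolution (p β s κ a b : ℝ) (u : ℝ → ℝ) : Prop where
  cont : ContinuousOn u (Icc a b)
  left : u a = 0
  right : u b = 0
  pos : ∀ t ∈ Ioo a b, 0 < u t
  c1 : ∀ t ∈ Ioo a b, ContDiffAt ℝ 1 u t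
  flux_diff : ∀ t ∈ Ioo a b, DifferentiableAt ℝ
    (fun t => (β ^ 2 * u t ^ 2 + deriv u t ^ 2) ^ (p / 2 - 1) * deriv u t) t
  eqn : ∀ t ∈ Ioo a b,
    -deriv (fun t => (β ^ 2 * u t ^ 2 + deriv u t ^ 2) ^ (p / 2 - 1) * deriv u t) t
      - κ * (|u t| ^ (p - 2 + s) * u t)
      = β * (β * (p - 1) + p - 2) * ((β ^ 2 * u t ^ 2 + deriv u t ^ 2) ^ (p / 2 - 1) * u t)

/-! ### Transfer between the circle and an interval -/

theorem angularDeriv_exp (f : Circle → ℝ) (t : ℝ) :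
    angularDeriv f (Circle.exp t) = deriv (fun x => f (Circle.exp x)) t := by
  unfold angularDeriv
  simp_rw [← Circle.exp_add]
  have := deriv_comp_const_add (f := fun x => f (Circle.exp x)) t 0
  simpa using this

theorem contDiffAt_comp_const_add {n : WithTop ℕ∞} (g : ℝ → ℝ) (t : ℝ) :
    ContDiffAt ℝ n (fun x => g (t + x)) 0 ↔ ContDiffAt ℝ n g t := by
  constructor
  · intro h
    have h2 : ContDiffAt ℝ n (fun x : ℝ => x - t) t := by fun_prop
    have h3 : ContDiffAt ℝ n (fun x => g (t + x)) ((fun x : ℝ => x - t) t) := by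
      simpa using h
    have := ContDiffAt.comp t (f := fun x : ℝ => x - t) h3 h2
    simpa [Function.comp_def] using this
  · intro h
    have h2 : ContDiffAt ℝ n (fun x : ℝ => t + x) 0 := by fun_prop
    have h3 : ContDiffAt ℝ n g ((fun x : ℝ => t + x) 0) := by
      simpa using h
    exact ContDiffAt.comp (0 : ℝ) (f := fun x : ℝ => t + x) h3 h2

theorem differentiableAt_comp_add_zero (g : ℝ → ℝ) (t : ℝ) :
    DifferentiableAt ℝ (fun x => g (t + x)) 0 ↔ DifferentiableAt ℝ g t := by
  constructor
  · intro h
    have h3 : DifferentiableAt ℝ (fun x => g (t + x)) ((fun x : ℝ => x - t) t) := by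
      simpa using h
    have := DifferentiableAt.comp t (f := fun x : ℝ => x - t) h3 (by fun_prop)
    simpa [Function.comp_def] using this
  · intro h
    have h3 : DifferentiableAt ℝ g ((fun x : ℝ => t + x) 0) := by
      simpa using h
    exact DifferentiableAt.comp (0 : ℝ) (f := fun x : ℝ => t + x) h3 (by fun_prop)

theorem angularDifferentiableAt_exp (f : Circle → ℝ) (t : ℝ) :
    AngularDifferentiableAt f (Circle.exp t) ↔
      DifferentiableAt ℝ (fun x => f (Circle.exp x)) t := by
  unfold AngularDifferentiableAt
  simp_rw [← Circle.exp_add]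
  exact differentiableAt_comp_add_zero (fun x => f (Circle.exp x)) t

theorem angularC1At_exp (f : Circle → ℝ) (t : ℝ) :
    AngularC1At f (Circle.exp t) ↔ ContDiffAt ℝ 1 (fun x => f (Circle.exp x)) t := by
  unfold AngularC1At
  simp_rw [← Circle.exp_add]
  exact contDiffAt_comp_const_add (fun x => f (Circle.exp x)) t

/-- The strict bound on the opening angle separates the two end points too, hence the closed
interval. The frontier computation and the lift of profiles to the circle rely on this. -/
theorem injOn_circleExp {a b : ℝ} (hb : b < a + 2 * π) : InjOn Circle.exp (Icc a b) := by
  intro x hx y hy hxy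
  obtain ⟨m, hm⟩ := Circle.exp_eq_exp.mp hxy
  have hpi := Real.pi_pos
  have h1 : (m : ℝ) < 1 := by
    by_contra! h
    nlinarith [hx.1, hx.2, hy.1, hy.2]
  have h2 : (-1 : ℝ) < m := by
    by_contra! h
    nlinarith [hx.1, hx.2, hy.1, hy.2]
  have h1' : m < 1 := by exact_mod_cast h1
  have h2' : -1 < m := by exact_mod_cast h2
  have : m = 0 := by omega
  subst this
  simpa using hm

theorem closure_circleExp_Ioo {a b : ℝ} (hab : a < b) :
    closure (Circle.exp '' Ioo a b) = Circle.exp '' Icc a b := by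
  apply Subset.antisymm
  · exact closure_minimal (image_mono Ioo_subset_Icc_self)
      (isCompact_Icc.image Circle.exp.continuous).isClosed
  · rw [← closure_Ioo hab.ne]
    exact image_closure_subset_closure_image Circle.exp.continuous

theorem frontier_circleExp_Ioo {a b : ℝ} (hab : a < b) (hb : b < a + 2 * π) :
    frontier (Circle.exp '' Ioo a b) = {Circle.exp a, Circle.exp b} := by
  have ho : IsOpen (Circle.exp '' Ioo a b) := isLocalHomeomorph_circleExp.isOpenMap _ isOpen_Ioo
  rw [frontier, ho.interior_eq, closure_circleExp_Ioo hab,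
    ← (injOn_circleExp hb).image_sdiff_subset Ioo_subset_Icc_self, Icc_sdiff_Ioo_same hab.le,
    image_pair]

/-- A continuous map from a compact set to a Hausdorff space is closed, so its image carries the
quotient topology. -/
theorem continuousOn_image_of_comp {X Y Z : Type*} [TopologicalSpace X] [TopologicalSpace Y]
    [T2Space Y] [TopologicalSpace Z] {f : X → Y} (hf : Continuous f) {K : Set X} (hK : IsCompact K)
    {g : Y → Z} (h : ContinuousOn (fun x => g (f x)) K) : ContinuousOn g (f '' K) := by
  rw [continuousOn_iff_isClosed] at h ⊢
  intro t ht
  obtain ⟨v, hv, hvt⟩ := h t ht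
  refine ⟨f '' (v ∩ K), ((hK.inter_left hv).image hf).isClosed, ?_⟩
  rw [← hvt]
  ext y
  constructor
  · rintro ⟨hy, x, hx, rfl⟩
    exact ⟨⟨x, ⟨hy, hx⟩, rfl⟩, x, hx, rfl⟩
  · rintro ⟨⟨x, ⟨hx1, hx2⟩, rfl⟩, -⟩
    exact ⟨hx1, x, hx2, rfl⟩

theorem isPositiveVanishing_iff {a b : ℝ} (hab : a < b) (hb : b < a + 2 * π) (ω : Circle → ℝ) :
    IsPositiveVanishing (Circle.exp '' Ioo a b) ω ↔
      ContinuousOn (fun t => ω (Circle.exp t)) (Icc a b) ∧ ω (Circle.exp a) = 0 ∧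
      ω (Circle.exp b) = 0 ∧ (∀ t ∈ Ioo a b, 0 < ω (Circle.exp t)) ∧
      ∀ t ∈ Ioo a b, ContDiffAt ℝ 1 (fun x => ω (Circle.exp x)) t := by
  constructor
  · rintro ⟨h1, h2, h3, h4⟩
    rw [closure_circleExp_Ioo hab] at h1
    rw [frontier_circleExp_Ioo hab hb] at h4
    refine ⟨h1.comp Circle.exp.continuous.continuousOn (mapsTo_image _ _), h4 _ (by simp),
      h4 _ (by simp), fun t ht => h2 _ (mem_image_of_mem _ ht), fun t ht => ?_⟩
    rw [← angularC1At_exp]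
    exact h3 _ (mem_image_of_mem _ ht)
  · rintro ⟨h1, h2, h3, h4, h5⟩
    refine ⟨?_, ?_, ?_, ?_⟩
    · rw [closure_circleExp_Ioo hab]
      exact continuousOn_image_of_comp Circle.exp.continuous isCompact_Icc h1
    · rintro _ ⟨t, ht, rfl⟩
      exact h4 t ht
    · rintro _ ⟨t, ht, rfl⟩
      exact (angularC1At_exp _ _).2 (h5 t ht)
    · rw [frontier_circleExp_Ioo hab hb]
      rintro z (rfl | rfl)
      · exact h2
      · exact h3

theorem flux_exp (p β : ℝ) (ω : Circle → ℝ) (t : ℝ) :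
    flux p β ω (Circle.exp t) = (β ^ 2 * ω (Circle.exp t) ^ 2 +
      deriv (fun x => ω (Circle.exp x)) t ^ 2) ^ (p / 2 - 1) *
        deriv (fun x => ω (Circle.exp x)) t := by
  simp [flux, weight, angularDeriv_exp]

/-- The choice $s=q+1-p$ makes $p-2+s=q-1$, and $\beta_q s=p$ rewrites $\lambda_{q,p}$ in the
spectral form. -/
theorem isPositiveSolution_iff {p q : ℝ} (hq : p - 1 < q) {a b : ℝ} (hab : a < b)
    (hb : b < a + 2 * π) (ω : Circle → ℝ) :
    IsPositiveSolution p q (Circle.exp '' Ioo a b) ω ↔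
      IntervalSolution p (betaQ p q) (q + 1 - p) 1 a b (fun t => ω (Circle.exp t)) := by
  have hl : lambdaQ p q = betaQ p q * (betaQ p q * (p - 1) + p - 2) := by
    have : q + 1 - p ≠ 0 := by linarith
    unfold lambdaQ betaQ
    field_simp
    ring
  have hf : ∀ t, flux p (betaQ p q) ω (Circle.exp t) = _ := flux_exp p (betaQ p q) ω
  have hw : ∀ t, weight p (betaQ p q) ω (Circle.exp t) = (betaQ p q ^ 2 * ω (Circle.exp t) ^ 2 +
      deriv (fun x => ω (Circle.exp x)) t ^ 2) ^ (p / 2 - 1) := by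
    intro t
    simp [weight, angularDeriv_exp]
  have he : p - 2 + (q + 1 - p) = q - 1 := by ring
  constructor
  · rintro ⟨h1, h2, h3⟩
    obtain ⟨c1, c2, c3, c4, c5⟩ := (isPositiveVanishing_iff hab hb ω).1 h1
    refine ⟨c1, c2, c3, c4, c5, fun t ht => ?_, fun t ht => ?_⟩
    · have := (angularDifferentiableAt_exp _ _).1 (h2 _ (mem_image_of_mem _ ht))
      simpa only [hf] using this
    · have := h3 _ (mem_image_of_mem _ ht)
      rw [angularDeriv_exp, hl, hw] at this
      simp only [hf] at this
      rw [he, one_mul]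
      exact this
  · rintro ⟨c1, c2, c3, c4, c5, h2, h3⟩
    refine ⟨(isPositiveVanishing_iff hab hb ω).2 ⟨c1, c2, c3, c4, c5⟩, ?_, ?_⟩
    · rintro _ ⟨t, ht, rfl⟩
      rw [angularDifferentiableAt_exp]
      simpa only [hf] using h2 t ht
    · rintro _ ⟨t, ht, rfl⟩
      have := h3 t ht
      rw [angularDeriv_exp, hl, hw]
      simp only [hf]
      rw [he, one_mul] at this
      exact this

/-- With $\kappa=0$ the power term is absent, which is why $s$ may be arbitrary. -/
theorem isSpectralSolution_iff {p β : ℝ} (s : ℝ) {a b : ℝ} (hab : a < b)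
    (hb : b < a + 2 * π) (ω : Circle → ℝ) :
    IsSpectralSolution p β (Circle.exp '' Ioo a b) ω ↔
      IntervalSolution p β s 0 a b (fun t => ω (Circle.exp t)) := by
  have hf : ∀ t, flux p β ω (Circle.exp t) = _ := flux_exp p β ω
  have hw : ∀ t, weight p β ω (Circle.exp t) = (β ^ 2 * ω (Circle.exp t) ^ 2 +
      deriv (fun x => ω (Circle.exp x)) t ^ 2) ^ (p / 2 - 1) := by
    intro t
    simp [weight, angularDeriv_exp]
  constructor
  · rintro ⟨h1, h2, h3⟩
    obtain ⟨c1, c2, c3, c4, c5⟩ := (isPositiveVanishing_iff hab hb ω).1 h1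
    refine ⟨c1, c2, c3, c4, c5, fun t ht => ?_, fun t ht => ?_⟩
    · have := (angularDifferentiableAt_exp _ _).1 (h2 _ (mem_image_of_mem _ ht))
      simpa only [hf] using this
    · have := h3 _ (mem_image_of_mem _ ht)
      rw [angularDeriv_exp, hw] at this
      simp only [hf] at this
      rw [zero_mul, sub_zero]
      exact this
  · rintro ⟨c1, c2, c3, c4, c5, h2, h3⟩
    refine ⟨(isPositiveVanishing_iff hab hb ω).2 ⟨c1, c2, c3, c4, c5⟩, ?_, ?_⟩
    · rintro _ ⟨t, ht, rfl⟩
      rw [angularDifferentiableAt_exp]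
      simpa only [hf] using h2 t ht
    · rintro _ ⟨t, ht, rfl⟩
      have := h3 t ht
      rw [angularDeriv_exp, hw]
      simp only [hf]
      rw [zero_mul, sub_zero] at this
      exact this

theorem IntervalSolution.congr {p β s κ a b : ℝ} {u v : ℝ → ℝ} (hab : a < b)
    (hu : IntervalSolution p β s κ a b u) (h : EqOn v u (Icc a b)) :
    IntervalSolution p β s κ a b v := by
  have hev : ∀ t ∈ Ioo a b, v =ᶠ[𝓝 t] u := fun t ht =>
    Filter.eventuallyEq_of_mem (Icc_mem_nhds ht.1 ht.2) h
  have hfl : ∀ t ∈ Ioo a b,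
      (fun t => (β ^ 2 * v t ^ 2 + deriv v t ^ 2) ^ (p / 2 - 1) * deriv v t) =ᶠ[𝓝 t]
      (fun t => (β ^ 2 * u t ^ 2 + deriv u t ^ 2) ^ (p / 2 - 1) * deriv u t) := fun t ht => by
    filter_upwards [hev t ht, (hev t ht).deriv] with x h1 h2
    rw [h1, h2]
  refine ⟨hu.cont.congr h, (h (left_mem_Icc.2 hab.le)).trans hu.left,
    (h (right_mem_Icc.2 hab.le)).trans hu.right, fun t ht => ?_, fun t ht => ?_, fun t ht => ?_,
    fun t ht => ?_⟩
  · rw [h (Ioo_subset_Icc_self ht)]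
    exact hu.pos t ht
  · exact (hu.c1 t ht).congr_of_eventuallyEq (hev t ht)
  · exact (hu.flux_diff t ht).congr_of_eventuallyEq (hfl t ht)
  · rw [(hfl t ht).deriv_eq, (hev t ht).deriv_eq, h (Ioo_subset_Icc_self ht)]
    exact hu.eqn t ht

theorem exists_circle_lift {a b : ℝ} (hb : b < a + 2 * π) (u : ℝ → ℝ) :
    ∃ ω : Circle → ℝ, EqOn (fun t => ω (Circle.exp t)) u (Icc a b) := by
  refine ⟨fun z => u (Function.invFunOn Circle.exp (Icc a b) z), fun t ht => ?_⟩
  simp only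
  rw [(injOn_circleExp hb).leftInvOn_invFunOn ht]

end SectorODE

/-! ### Phase plane: logarithm and angle of a positive solution -/

namespace SectorODE
open Set Filter Topology Real

/-- `(p - 1) cos² + sin²` as a function of the sine. -/
def phi (p x : ℝ) : ℝ := (p - 1) * (1 - x ^ 2) + x ^ 2

theorem phi_pos {p x : ℝ} (hp : 1 < p) (hx : x ^ 2 ≤ 1) : 0 < phi p x := by
  unfold phi
  rcases eq_or_lt_of_le hx with h | h
  · rw [h]; norm_num
  · nlinarith [sq_nonneg x, mul_pos (sub_pos.2 hp) (sub_pos.2 h)]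

/-- The angular speed, up to the factor `β φ`, of the phase plane system in the coordinates
`ℓ = log u` and `ψ`, where `cot ψ = u' / (β u)`. -/
noncomputable def speed (p β s κ ℓ ψ : ℝ) : ℝ :=
  (p - 1) * β ^ 2 + (p - 2) * β * sin ψ ^ 2 + κ * (β ^ (2 - p) * exp (s * ℓ) * sin ψ ^ p)

/-- A trajectory of the phase plane system along which `u = exp ℓ` vanishes at both ends. -/
structure Orbit (p β s κ a b : ℝ) (l ψ : ℝ → ℝ) : Prop where
  mem : ∀ t ∈ Ioo a b, ψ t ∈ Ioo 0 π
  hasDerivAt_log : ∀ t ∈ Ioo a b, HasDerivAt l (β * (cos (ψ t) / sin (ψ t))) t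
  hasDerivAt_angle : ∀ t ∈ Ioo a b,
    HasDerivAt ψ (speed p β s κ (l t) (ψ t) / (β * phi p (sin (ψ t)))) t
  left : Tendsto l (𝓝[>] a) atBot
  right : Tendsto l (𝓝[<] b) atBot

/-- Compose with a local inverse of $f$. This recovers differentiability of a quantity from that of
a nondegenerate function of it. -/
theorem hasDerivAt_of_hasDerivAt_comp {f y : ℝ → ℝ} {f' d t : ℝ} (hf : HasStrictDerivAt f f' (y t))
    (hf' : f' ≠ 0) (hy : ContinuousAt y t) (h : HasDerivAt (fun x => f (y x)) d t) :
    HasDerivAt y (f'⁻¹ * d) t := by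
  have h1 := (hf.to_localInverse hf').hasDerivAt
  have h2 := HasDerivAt.comp t (h := fun x => f (y x)) h1 h
  refine h2.congr_of_eventuallyEq ?_
  have := hy.eventually (hf.hasStrictFDerivAt_equiv hf').eventually_left_inverse
  filter_upwards [this] with x hx
  exact hx.symm

theorem hasStrictDerivAt_flux {p β y : ℝ} (hβ : 0 < β) :
    HasStrictDerivAt (fun y => (β ^ 2 + y ^ 2) ^ (p / 2 - 1) * y)
      ((β ^ 2 + y ^ 2) ^ (p / 2 - 1) * (β ^ 2 + (p - 1) * y ^ 2) / (β ^ 2 + y ^ 2)) y := by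
  have hA : 0 < β ^ 2 + y ^ 2 := by positivity
  have h1 : HasStrictDerivAt (fun y : ℝ => β ^ 2 + y ^ 2) (2 * y) y := by
    simpa using (hasStrictDerivAt_pow 2 y).const_add (β ^ 2)
  have h2 := ((Real.hasStrictDerivAt_rpow_const (p := p / 2 - 1) (Or.inl hA.ne')).comp y h1).mul
    (hasStrictDerivAt_id y)
  refine (h2.congr_deriv ?_ : HasStrictDerivAt _ _ _)
  simp only [Function.comp_def]
  rw [rpow_sub_one hA.ne' (p / 2 - 1)]
  simp only [id]
  field_simp
  ring

/-- The equation makes only the flux differentiable, not $u'$. Dividing the flux by $u^{p-1}$ gives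
$(\beta^2+y^2)^{p/2-1}y$ with $y=u'/u$, whose derivative in $y$ is positive because $p>1$ and
$\beta>0$. Hence $y$ is differentiable, also where $u'=0$. -/
theorem IntervalSolution.hasDerivAt_logDeriv {p β s κ a b : ℝ} {u : ℝ → ℝ} (hp : 1 < p) (hβ : 0 < β)
    (hu : IntervalSolution p β s κ a b u) {t : ℝ} (ht : t ∈ Ioo a b) :
    HasDerivAt (fun t => deriv u t / u t)
      (-((β ^ 2 + (deriv u t / u t) ^ 2) / (β ^ 2 + (p - 1) * (deriv u t / u t) ^ 2)) *
        (κ * exp (s * log (u t)) / (β ^ 2 + (deriv u t / u t) ^ 2) ^ (p / 2 - 1)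
          + β * (β * (p - 1) + p - 2) + (p - 1) * (deriv u t / u t) ^ 2)) t := by
  have hpos := hu.pos t ht
  have hev : ∀ᶠ x in 𝓝 t, x ∈ Ioo a b := Ioo_mem_nhds ht.1 ht.2
  have hdu : HasDerivAt u (deriv u t) t := ((hu.c1 t ht).differentiableAt (by norm_num)).hasDerivAt
  have hcont : ContinuousAt (fun t => deriv u t / u t) t := by
    have h1 : ContinuousAt (deriv u) t := by
      obtain ⟨v, hv, hcv⟩ := (hu.c1 t ht).contDiffOn (m := 1) le_rfl (by simp)
      obtain ⟨w, hw, hwo, htw⟩ := mem_nhds_iff.1 (by simpa using hv)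
      have := (hcv.mono hw).continuousOn_deriv_of_isOpen hwo le_rfl
      exact this.continuousAt (hwo.mem_nhds htw)
    exact h1.div hdu.continuousAt hpos.ne'
  set y : ℝ → ℝ := fun t => deriv u t / u t with hy
  have hfl : ∀ x ∈ Ioo a b, (β ^ 2 * u x ^ 2 + deriv u x ^ 2) ^ (p / 2 - 1)
      = (β ^ 2 + y x ^ 2) ^ (p / 2 - 1) * u x ^ (p - 2) := by
    intro x hx
    have hux := hu.pos x hx
    have : β ^ 2 * u x ^ 2 + deriv u x ^ 2 = (β ^ 2 + y x ^ 2) * u x ^ 2 := by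
      simp only [hy]; field_simp
    rw [this, mul_rpow (by positivity) (by positivity), ← rpow_natCast (u x), ← rpow_mul hux.le]
    congr 2
    push_cast; ring
  have hA : 0 < β ^ 2 + y t ^ 2 := by positivity
  have hf : 0 < β ^ 2 + (p - 1) * y t ^ 2 := by
    have := sub_pos.2 hp
    positivity
  have hw : 0 < (β ^ 2 + y t ^ 2) ^ (p / 2 - 1) := rpow_pos_of_pos hA _
  have hcomp : ∀ x ∈ Ioo a b, (β ^ 2 + y x ^ 2) ^ (p / 2 - 1) * y x =
      (β ^ 2 * u x ^ 2 + deriv u x ^ 2) ^ (p / 2 - 1) * deriv u x * u x ^ (1 - p) := by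
    intro x hx
    have hux := hu.pos x hx
    have e : u x ^ (1 - p) = (u x ^ (p - 2))⁻¹ * (u x)⁻¹ := by
      rw [← rpow_neg hux.le, ← rpow_neg_one (u x), ← rpow_add hux]
      congr 1; ring
    have := rpow_pos_of_pos hux (p - 2)
    rw [hfl x hx, e]
    simp only [hy]
    field_simp
  have hd := (hu.flux_diff t ht).hasDerivAt.mul (hdu.rpow_const (p := 1 - p) (Or.inl hpos.ne'))
  have hd2 := hd.congr_of_eventuallyEq (f₁ := fun x => (β ^ 2 + y x ^ 2) ^ (p / 2 - 1) * y x)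
    (hev.mono hcomp)
  have key := hasDerivAt_of_hasDerivAt_comp (hasStrictDerivAt_flux (p := p) (y := y t) hβ)
    (by positivity) hcont hd2
  refine key.congr_deriv ?_
  have heq : deriv (fun t => (β ^ 2 * u t ^ 2 + deriv u t ^ 2) ^ (p / 2 - 1) * deriv u t) t
      = -κ * (|u t| ^ (p - 2 + s) * u t) - β * (β * (p - 1) + p - 2) *
        ((β ^ 2 * u t ^ 2 + deriv u t ^ 2) ^ (p / 2 - 1) * u t) := by
    linarith [hu.eqn t ht]
  have hyu : deriv u t = y t * u t := by simp only [hy]; field_simp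
  have e1 : u t ^ (1 - p) = (u t ^ (p - 2))⁻¹ * (u t)⁻¹ := by
    rw [← rpow_neg hpos.le, ← rpow_neg_one (u t), ← rpow_add hpos]
    congr 1; ring
  have e2 : u t ^ (1 - p - 1) = (u t ^ (p - 2))⁻¹ * (u t)⁻¹ * (u t)⁻¹ := by
    rw [← rpow_neg hpos.le, ← rpow_neg_one (u t), ← rpow_add hpos, ← rpow_add hpos]
    congr 1; ring
  have e3 : u t ^ (p - 2 + s) = u t ^ (p - 2) * exp (s * log (u t)) := by
    rw [rpow_add hpos, rpow_def_of_pos hpos s, mul_comm s]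
  rw [heq, hfl t ht, abs_of_pos hpos, e1, e2, e3, hyu]
  have hup := rpow_pos_of_pos hpos (p - 2)
  have hde : y t * u t / u t = y t := by field_simp
  rw [hde]
  generalize u t ^ (p - 2) = U at *
  generalize (β ^ 2 + y t ^ 2) ^ (p / 2 - 1) = W at *
  field_simp
  ring

theorem IntervalSolution.orbit {p β s κ a b : ℝ} {u : ℝ → ℝ} (hp : 1 < p) (hβ : 0 < β) (hab : a < b)
    (hu : IntervalSolution p β s κ a b u) :
    Orbit p β s κ a b (fun t => log (u t)) (fun t => π / 2 - arctan (deriv u t / u t / β)) := by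
  -- The angle $\pi/2-\arctan(y/\beta)$ is the one in $(0,\pi)$ with cotangent $y/\beta$; unlike
  -- $\arctan(\beta/y)$ it is smooth through $y=0$.
  have hcs : ∀ y : ℝ, sin (π / 2 - arctan (y / β)) = β / √(β ^ 2 + y ^ 2) ∧
      cos (π / 2 - arctan (y / β)) = y / √(β ^ 2 + y ^ 2) := by
    intro y
    have h1 : √(1 + (y / β) ^ 2) = √(β ^ 2 + y ^ 2) / β := by
      rw [show 1 + (y / β) ^ 2 = (β ^ 2 + y ^ 2) / β ^ 2 by field_simp,
        sqrt_div' _ (by positivity), sqrt_sq hβ.le]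
    have h2 : 0 < √(β ^ 2 + y ^ 2) := by positivity
    rw [sin_pi_div_two_sub, cos_pi_div_two_sub, cos_arctan, sin_arctan, h1]
    constructor
    · field_simp
    · field_simp
  refine ⟨fun t ht => ?_, fun t ht => ?_, fun t ht => ?_, ?_, ?_⟩
  · have h1 := neg_pi_div_two_lt_arctan (deriv u t / u t / β)
    have h2 := arctan_lt_pi_div_two (deriv u t / u t / β)
    constructor <;> linarith
  · have hdu : HasDerivAt u (deriv u t) t :=
      ((hu.c1 t ht).differentiableAt (by norm_num)).hasDerivAt
    have := hdu.log (hu.pos t ht).ne'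
    refine this.congr_deriv ?_
    rw [(hcs _).1, (hcs _).2]
    have h2 : 0 < √(β ^ 2 + (deriv u t / u t) ^ 2) := by positivity
    field_simp
  · have h1 := ((hu.hasDerivAt_logDeriv hp hβ ht).div_const β).arctan.const_sub (π / 2)
    refine h1.congr_deriv ?_
    rw [speed, (hcs _).1]
    generalize deriv u t / u t = y
    have hA : 0 < β ^ 2 + y ^ 2 := by positivity
    have hf : 0 < β ^ 2 + (p - 1) * y ^ 2 := by
      have := sub_pos.2 hp
      positivity
    have e1 : (β / √(β ^ 2 + y ^ 2)) ^ 2 = β ^ 2 / (β ^ 2 + y ^ 2) := by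
      rw [div_pow, sq_sqrt hA.le]
    have e2 : β ^ (2 - p) * exp (s * log (u t)) * (β / √(β ^ 2 + y ^ 2)) ^ p
        = β ^ 2 * exp (s * log (u t)) / ((β ^ 2 + y ^ 2) ^ (p / 2 - 1) * (β ^ 2 + y ^ 2)) := by
      have h3 : (√(β ^ 2 + y ^ 2)) ^ p = (β ^ 2 + y ^ 2) ^ (p / 2 - 1) * (β ^ 2 + y ^ 2) := by
        rw [sqrt_eq_rpow, ← rpow_mul hA.le, ← rpow_add_one hA.ne']
        congr 1; ring
      have h4 : β ^ (2 - p) = β ^ 2 / β ^ p := by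
        rw [rpow_sub hβ]; norm_num
      have h5 := rpow_pos_of_pos hβ p
      rw [div_rpow hβ.le (sqrt_nonneg _), h3, h4]
      have h6 : 0 < (β ^ 2 + y ^ 2) ^ (p / 2 - 1) := by positivity
      field_simp
    have e3 : phi p (β / √(β ^ 2 + y ^ 2)) = (β ^ 2 + (p - 1) * y ^ 2) / (β ^ 2 + y ^ 2) := by
      rw [phi, e1]; field_simp; ring
    rw [e1, e2, e3]
    have h6 : 0 < (β ^ 2 + y ^ 2) ^ (p / 2 - 1) := by positivity
    generalize (β ^ 2 + y ^ 2) ^ (p / 2 - 1) = W at *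
    have h7 : 1 + (y / β) ^ 2 = (β ^ 2 + y ^ 2) / β ^ 2 := by field_simp
    rw [h7]
    field_simp
    ring
  · refine tendsto_log_nhdsGT_zero.comp (tendsto_nhdsWithin_iff.2 ⟨?_, ?_⟩)
    · have := (hu.cont a (left_mem_Icc.2 hab.le)).mono_left
        (nhdsWithin_mono a Ioo_subset_Icc_self)
      rw [hu.left, nhdsWithin_Ioo_eq_nhdsGT hab] at this
      exact this
    · filter_upwards [Ioo_mem_nhdsGT hab] with t ht using hu.pos t ht
  · refine tendsto_log_nhdsGT_zero.comp (tendsto_nhdsWithin_iff.2 ⟨?_, ?_⟩)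
    · have := (hu.cont b (right_mem_Icc.2 hab.le)).mono_left
        (nhdsWithin_mono b Ioo_subset_Icc_self)
      rw [hu.right, nhdsWithin_Ioo_eq_nhdsLT hab] at this
      exact this
    · filter_upwards [Ioo_mem_nhdsLT hab] with t ht using hu.pos t ht

end SectorODE

/-! ### Calculus on open intervals, boundary angles and uniqueness in the phase plane -/

namespace SectorODE
open Set Filter Topology Real

theorem antitoneOn_Ioo_of_hasDerivAt {f f' : ℝ → ℝ} {a b : ℝ}
    (hd : ∀ x ∈ Ioo a b, HasDerivAt f (f' x) x) (h0 : ∀ x ∈ Ioo a b, f' x ≤ 0) :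
    AntitoneOn f (Ioo a b) :=
  antitoneOn_of_hasDerivWithinAt_nonpos (convex_Ioo a b)
    (fun x hx => (hd x hx).continuousAt.continuousWithinAt)
    (by rw [interior_Ioo]; exact fun x hx => (hd x hx).hasDerivWithinAt)
    (by rw [interior_Ioo]; exact h0)

theorem monotoneOn_Ioo_of_hasDerivAt {f f' : ℝ → ℝ} {a b : ℝ}
    (hd : ∀ x ∈ Ioo a b, HasDerivAt f (f' x) x) (h0 : ∀ x ∈ Ioo a b, 0 ≤ f' x) :
    MonotoneOn f (Ioo a b) :=
  monotoneOn_of_hasDerivWithinAt_nonneg (convex_Ioo a b)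
    (fun x hx => (hd x hx).continuousAt.continuousWithinAt)
    (by rw [interior_Ioo]; exact fun x hx => (hd x hx).hasDerivWithinAt)
    (by rw [interior_Ioo]; exact h0)

theorem strictMonoOn_Ioo_of_hasDerivAt {f f' : ℝ → ℝ} {a b : ℝ}
    (hd : ∀ x ∈ Ioo a b, HasDerivAt f (f' x) x) (h0 : ∀ x ∈ Ioo a b, 0 < f' x) :
    StrictMonoOn f (Ioo a b) :=
  strictMonoOn_of_hasDerivWithinAt_pos (convex_Ioo a b)
    (fun x hx => (hd x hx).continuousAt.continuousWithinAt)
    (by rw [interior_Ioo]; exact fun x hx => (hd x hx).hasDerivWithinAt)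
    (by rw [interior_Ioo]; exact h0)

theorem MonotoneOn.le_of_tendsto_right {f : ℝ → ℝ} {a b d x : ℝ} (hf : MonotoneOn f (Ioo a b))
    (hb : Tendsto f (𝓝[<] b) (𝓝 d)) (hx : x ∈ Ioo a b) : f x ≤ d := by
  refine ge_of_tendsto hb ?_
  filter_upwards [Ioo_mem_nhdsLT hx.2] with y hy
  exact hf hx ⟨hx.1.trans hy.1, hy.2⟩ hy.1.le

theorem MonotoneOn.ge_of_tendsto_left {f : ℝ → ℝ} {a b c x : ℝ} (hf : MonotoneOn f (Ioo a b))
    (ha : Tendsto f (𝓝[>] a) (𝓝 c)) (hx : x ∈ Ioo a b) : c ≤ f x := by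
  refine le_of_tendsto ha ?_
  filter_upwards [Ioo_mem_nhdsGT hx.1] with y hy
  exact hf ⟨hy.1, hy.2.trans hx.2⟩ hx hy.2.le

/-- A differentiable function with positive derivative on an interval has a differentiable inverse
on the interval between its boundary values. -/
theorem exists_inverse {f f' : ℝ → ℝ} {a b c d : ℝ}
    (hd : ∀ x ∈ Ioo a b, HasDerivAt f (f' x) x) (h0 : ∀ x ∈ Ioo a b, 0 < f' x)
    (hab : a < b) (ha : Tendsto f (𝓝[>] a) (𝓝 c)) (hb : Tendsto f (𝓝[<] b) (𝓝 d)) :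
    ∃ g : ℝ → ℝ, (∀ y ∈ Ioo c d, g y ∈ Ioo a b ∧ f (g y) = y ∧ HasDerivAt g (f' (g y))⁻¹ y) ∧
      (∀ x ∈ Ioo a b, f x ∈ Ioo c d ∧ g (f x) = x) ∧
      Tendsto g (𝓝[>] c) (𝓝 a) ∧ Tendsto g (𝓝[<] d) (𝓝 b) := by
  have hs := strictMonoOn_Ioo_of_hasDerivAt hd h0
  have hmap : ∀ x ∈ Ioo a b, f x ∈ Ioo c d := by
    intro x hx
    constructor
    · obtain ⟨y, hy⟩ := exists_between hx.1
      have hy' : y ∈ Ioo a b := ⟨hy.1, hy.2.trans hx.2⟩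
      exact (MonotoneOn.ge_of_tendsto_left hs.monotoneOn ha hy').trans_lt (hs hy' hx hy.2)
    · obtain ⟨y, hy⟩ := exists_between hx.2
      have hy' : y ∈ Ioo a b := ⟨hx.1.trans hy.1, hy.2⟩
      exact (hs hx hy' hy.1).trans_le (MonotoneOn.le_of_tendsto_right hs.monotoneOn hb hy')
  have hsurj : ∀ y ∈ Ioo c d, ∃ x ∈ Ioo a b, f x = y := by
    intro y hy
    obtain ⟨x1, hx1, h1⟩ := ((ha.eventually (eventually_lt_nhds hy.1)).and
      (Ioo_mem_nhdsGT hab)).exists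
    obtain ⟨x2, hx2, h2⟩ := ((hb.eventually (eventually_gt_nhds hy.2)).and
      (Ioo_mem_nhdsLT hab)).exists
    have hcont : ContinuousOn f (Ioo a b) := fun x hx => (hd x hx).continuousAt.continuousWithinAt
    exact isPreconnected_Ioo.intermediate_value h1 h2 hcont ⟨hx1.le, hx2.le⟩
  choose! g hg1 hg2 using hsurj
  have hleft : ∀ x ∈ Ioo a b, g (f x) = x := fun x hx =>
    hs.injOn (hg1 _ (hmap x hx)) hx (hg2 _ (hmap x hx))
  have hgs : StrictMonoOn g (Ioo c d) := by
    intro y1 h1 y2 h2 h12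
    by_contra! h
    have := hs.monotoneOn (hg1 _ h2) (hg1 _ h1) h
    rw [hg2 _ h1, hg2 _ h2] at this
    linarith
  refine ⟨g, fun y hy => ⟨hg1 y hy, hg2 y hy, ?_⟩, fun x hx => ⟨hmap x hx, hleft x hx⟩, ?_, ?_⟩
  -- Continuity of $f'$ is not assumed: the inverse is continuous because it is strictly monotone
  -- with an open interval as image, and differentiability follows from that.
  · have himg : g '' Ioo c d = Ioo a b := by
      apply Subset.antisymm
      · rintro _ ⟨y, hy, rfl⟩
        exact hg1 y hy
      · intro x hx
        exact ⟨f x, hmap x hx, hleft x hx⟩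
    have hc : ContinuousAt g y := hgs.continuousAt_of_image_mem_nhds (Ioo_mem_nhds hy.1 hy.2)
      (by rw [himg]; exact Ioo_mem_nhds (hg1 y hy).1 (hg1 y hy).2)
    refine HasDerivAt.of_local_left_inverse hc (hd _ (hg1 y hy)) (h0 _ (hg1 y hy)).ne' ?_
    filter_upwards [Ioo_mem_nhds hy.1 hy.2] with z hz using hg2 z hz
  · rw [tendsto_order]
    have hcd : c < d := by
      obtain ⟨x, hx⟩ := exists_between hab
      exact (hmap x hx).1.trans (hmap x hx).2
    constructor
    · intro a' ha'
      filter_upwards [Ioo_mem_nhdsGT hcd] with y hy using ha'.trans (hg1 y hy).1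
    · intro a' ha'
      obtain ⟨x, hx⟩ := exists_between (lt_min ha' hab)
      have hx' : x ∈ Ioo a b := ⟨hx.1, hx.2.trans_le (min_le_right _ _)⟩
      filter_upwards [Ioo_mem_nhdsGT (hmap x hx').1] with y hy
      have hy' : y ∈ Ioo c d := ⟨hy.1, hy.2.trans (hmap x hx').2⟩
      have := hgs hy' (hmap x hx') hy.2
      rw [hleft x hx'] at this
      exact this.trans (hx.2.trans_le (min_le_left _ _))
  · rw [tendsto_order]
    have hcd : c < d := by
      obtain ⟨x, hx⟩ := exists_between hab
      exact (hmap x hx).1.trans (hmap x hx).2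
    constructor
    · intro b' hb'
      obtain ⟨x, hx⟩ := exists_between (max_lt hb' hab)
      have hx' : x ∈ Ioo a b := ⟨(le_max_right _ _).trans_lt hx.1, hx.2⟩
      filter_upwards [Ioo_mem_nhdsLT (hmap x hx').2] with y hy
      have hy' : y ∈ Ioo c d := ⟨(hmap x hx').1.trans hy.1, hy.2⟩
      have := hgs (hmap x hx') hy' hy.1
      rw [hleft x hx'] at this
      exact ((le_max_left _ _).trans_lt hx.1).trans this
    · intro b' hb'
      filter_upwards [Ioo_mem_nhdsLT hcd] with y hy using (hg1 y hy).2.trans hb'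

theorem tendsto_const_sub_nhdsGT (c a : ℝ) :
    Tendsto (fun t => c - t) (𝓝[>] a) (𝓝[<] (c - a)) := by
  refine tendsto_nhdsWithin_iff.2 ⟨?_, ?_⟩
  · exact ((continuous_const.sub continuous_id).tendsto a).mono_left nhdsWithin_le_nhds
  · filter_upwards [self_mem_nhdsWithin] with t ht
    simp only [mem_Ioi, mem_Iio] at *
    linarith

theorem tendsto_const_sub_nhdsLT (c a : ℝ) :
    Tendsto (fun t => c - t) (𝓝[<] a) (𝓝[>] (c - a)) := by
  refine tendsto_nhdsWithin_iff.2 ⟨?_, ?_⟩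
  · exact ((continuous_const.sub continuous_id).tendsto a).mono_left nhdsWithin_le_nhds
  · filter_upwards [self_mem_nhdsWithin] with t ht
    simp only [mem_Ioi, mem_Iio] at *
    linarith

namespace Orbit
variable {p β s κ a b : ℝ} {l ψ : ℝ → ℝ}

/-- The system is reversible: reversing time changes the sign of $u'$ and hence sends $\psi$ to
$\pi-\psi$. Facts about the left end thereby become facts about the right end. -/
theorem reflect (h : Orbit p β s κ a b l ψ) (c : ℝ) :
    Orbit p β s κ (c - b) (c - a) (fun t => l (c - t)) (fun t => π - ψ (c - t)) := by
  have hm : ∀ t ∈ Ioo (c - b) (c - a), c - t ∈ Ioo a b := fun t ht =>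
    ⟨by linarith [ht.2], by linarith [ht.1]⟩
  have hd : ∀ t, HasDerivAt (fun t => c - t) (-1) t := fun t => (hasDerivAt_id t).const_sub c
  refine ⟨fun t ht => ?_, fun t ht => ?_, fun t ht => ?_, ?_, ?_⟩
  · have := h.mem _ (hm t ht)
    exact ⟨by linarith [this.2], by linarith [this.1]⟩
  · have := (h.hasDerivAt_log _ (hm t ht)).comp t (hd t)
    refine this.congr_deriv ?_
    rw [sin_pi_sub, cos_pi_sub]
    ring
  · have := ((h.hasDerivAt_angle _ (hm t ht)).comp t (hd t)).const_sub π
    refine this.congr_deriv ?_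
    rw [speed, speed, sin_pi_sub]
    ring
  · have := tendsto_const_sub_nhdsGT c (c - b)
    rw [sub_sub_cancel] at this
    exact h.right.comp this
  · have := tendsto_const_sub_nhdsLT c (c - a)
    rw [sub_sub_cancel] at this
    exact h.left.comp this

theorem tendsto_angle_left (h : Orbit p β s κ a b l ψ) (hp : 1 < p) (hβ : 0 < β) (hκ : 0 ≤ κ)
    (hab : a < b) : Tendsto ψ (𝓝[>] a) (𝓝 0) := by
  have hcont : ContinuousAt (fun x => (p - 1) * β ^ 2 + (p - 2) * β * sin x ^ 2) 0 := by fun_prop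
  have h0 : 0 < (p - 1) * β ^ 2 + (p - 2) * β * sin 0 ^ 2 := by
    have := sub_pos.2 hp
    rw [sin_zero]; simp only [ne_eq, OfNat.ofNat_ne_zero, not_false_eq_true, zero_pow, mul_zero,
      add_zero]; positivity
  obtain ⟨ε₀, hε₀, hball⟩ := Metric.eventually_nhds_iff.1 (hcont.eventually (eventually_gt_nhds h0))
  rw [tendsto_order]
  constructor
  · intro x hx
    filter_upwards [Ioo_mem_nhdsGT hab] with t ht using hx.trans (h.mem t ht).1
  intro ε' hε'
  obtain ⟨ε, hε1, hε2⟩ := exists_between (lt_min hε' (lt_min hε₀ (half_pos pi_pos)))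
  have hεε' : ε < ε' := hε2.trans_le (min_le_left _ _)
  have hεε₀ : ε < ε₀ := hε2.trans_le ((min_le_right _ _).trans (min_le_left _ _))
  have hεπ : ε < π / 2 := hε2.trans_le ((min_le_right _ _).trans (min_le_right _ _))
  have hsε : 0 < sin ε := sin_pos_of_pos_of_lt_pi hε1 (by linarith [pi_pos])
  have hcε : 0 < cos ε := cos_pos_of_mem_Ioo ⟨by linarith [pi_pos], hεπ⟩
  -- If $\psi\ge\varepsilon$ throughout, then $\ell'\le\beta\cot\varepsilon$, so $\ell$ would be
  -- bounded below near $a$, against $\ell\to-\infty$.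
  obtain ⟨t0, ht0, hlt⟩ : ∃ t ∈ Ioo a b, ψ t < ε := by
    by_contra! hcon
    have hanti : AntitoneOn (fun t => l t - β * (cos ε / sin ε) * t) (Ioo a b) := by
      apply antitoneOn_Ioo_of_hasDerivAt
        (f' := fun t => β * (cos (ψ t) / sin (ψ t)) - β * (cos ε / sin ε) * 1)
      · intro t ht
        exact (h.hasDerivAt_log t ht).sub ((hasDerivAt_id t).const_mul _)
      · intro t ht
        have hm := h.mem t ht
        have hsψ : 0 < sin (ψ t) := sin_pos_of_pos_of_lt_pi hm.1 hm.2
        have h1 : 0 ≤ sin (ψ t - ε) := sin_nonneg_of_nonneg_of_le_pi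
          (by linarith [hcon t ht]) (by linarith [hm.2])
        rw [sin_sub] at h1
        have h2 : cos (ψ t) / sin (ψ t) ≤ cos ε / sin ε := by
          rw [div_le_div_iff₀ hsψ hsε]; linarith
        have := mul_le_mul_of_nonneg_left h2 hβ.le
        linarith
    obtain ⟨t1, ht1⟩ := exists_between hab
    have hev := h.left.eventually (eventually_lt_atBot (l t1 - β * (cos ε / sin ε) * (t1 - a)))
    obtain ⟨t, ht, htm⟩ := (hev.and (Ioo_mem_nhdsGT ht1.1)).exists
    have := hanti ⟨htm.1, htm.2.trans ht1.2⟩ ht1 htm.2.le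
    simp only at this
    have h3 : 0 ≤ β * (cos ε / sin ε) * (t - a) := by
      have := sub_nonneg.2 htm.1.le
      positivity
    nlinarith
  filter_upwards [Ioo_mem_nhdsGT ht0.1] with t ht
  refine lt_of_lt_of_le (b := ε) ?_ hεε'.le
  by_contra! hge
  have hsub : ∀ x ∈ Icc t t0, x ∈ Ioo a b := fun x hx =>
    ⟨ht.1.trans_le hx.1, hx.2.trans_lt ht0.2⟩
  -- The level $\varepsilon$ is crossed only upwards, since the speed there is positive for small
  -- $\varepsilon$. An angle at least $\varepsilon$ at time $t$ would stay so up to $t_0$.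
  have := image_le_of_deriv_right_lt_deriv_boundary (f := fun x => -ψ x)
    (f' := fun x => -(speed p β s κ (l x) (ψ x) / (β * phi p (sin (ψ x)))))
    (B := fun _ => -ε) (B' := fun _ => 0) (a := t) (b := t0)
    (fun x hx => (h.hasDerivAt_angle x (hsub x hx)).neg.continuousAt.continuousWithinAt)
    (fun x hx => (h.hasDerivAt_angle x (hsub x (Ico_subset_Icc_self hx))).neg.hasDerivWithinAt)
    (by simpa using hge) (fun x => hasDerivAt_const _ _) ?_ (right_mem_Icc.2 ht.2.le)
  · linarith
  · intro x hx hxe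
    have hxe : ψ x = ε := by linarith
    rw [hxe]
    have h1 := hball (y := ε) (by rw [Real.dist_eq, sub_zero, abs_of_pos hε1]; exact hεε₀)
    have h2 := phi_pos hp (sin_sq_le_one ε)
    have h3 : 0 < speed p β s κ (l x) ε := by
      have : 0 ≤ κ * (β ^ (2 - p) * exp (s * l x) * sin ε ^ p) := by positivity
      unfold speed
      linarith
    have : 0 < speed p β s κ (l x) ε / (β * phi p (sin ε)) := by positivity
    linarith

theorem tendsto_angle_right (h : Orbit p β s κ a b l ψ) (hp : 1 < p) (hβ : 0 < β) (hκ : 0 ≤ κ)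
    (hab : a < b) : Tendsto ψ (𝓝[<] b) (𝓝 π) := by
  have h1 := (h.reflect 0).tendsto_angle_left hp hβ hκ (by linarith)
  have h2 := (h1.comp (by simpa using tendsto_const_sub_nhdsLT 0 b)).const_sub π
  simpa [Function.comp_def] using h2

end Orbit

/-- The vector field is $C^1$ on the strip $0<\psi<\pi$, hence Lipschitz on the compact union of the
two traces over a closed subinterval. -/
theorem plane_unique {p β s κ c d t₀ : ℝ} {l₁ ψ₁ l₂ ψ₂ : ℝ → ℝ} (hp : 1 < p) (hβ : 0 < β)
    (h₁ : ∀ t ∈ Ioo c d, ψ₁ t ∈ Ioo 0 π ∧ HasDerivAt l₁ (β * (cos (ψ₁ t) / sin (ψ₁ t))) t ∧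
      HasDerivAt ψ₁ (speed p β s κ (l₁ t) (ψ₁ t) / (β * phi p (sin (ψ₁ t)))) t)
    (h₂ : ∀ t ∈ Ioo c d, ψ₂ t ∈ Ioo 0 π ∧ HasDerivAt l₂ (β * (cos (ψ₂ t) / sin (ψ₂ t))) t ∧
      HasDerivAt ψ₂ (speed p β s κ (l₂ t) (ψ₂ t) / (β * phi p (sin (ψ₂ t)))) t)
    (ht₀ : t₀ ∈ Ioo c d) (hl : l₁ t₀ = l₂ t₀) (hψ : ψ₁ t₀ = ψ₂ t₀) :
    ∀ t ∈ Ioo c d, l₁ t = l₂ t ∧ ψ₁ t = ψ₂ t := by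
  intro t ht
  obtain ⟨c', hc1, hc2⟩ := exists_between (lt_min ht.1 ht₀.1)
  obtain ⟨d', hd1, hd2⟩ := exists_between (max_lt ht.2 ht₀.2)
  have hsub : Icc c' d' ⊆ Ioo c d := fun x hx => ⟨hc1.trans_le hx.1, hx.2.trans_lt hd2⟩
  set v : ℝ × ℝ → ℝ × ℝ := fun x => (β * (cos x.2 / sin x.2),
    speed p β s κ x.1 x.2 / (β * phi p (sin x.2))) with hv
  have hvc : ∀ x : ℝ × ℝ, x.2 ∈ Ioo 0 π → ContDiffAt ℝ 1 v x := by
    intro x hx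
    have hs : sin x.2 ≠ 0 := (sin_pos_of_pos_of_lt_pi hx.1 hx.2).ne'
    have hφ : β * phi p (sin x.2) ≠ 0 := (mul_pos hβ (phi_pos hp (sin_sq_le_one _))).ne'
    have h1 : ContDiffAt ℝ 1 (fun x : ℝ × ℝ => sin x.2) x := by fun_prop
    refine ContDiffAt.prodMk ?_ ?_
    · refine contDiffAt_const.mul (ContDiffAt.div ?_ h1 hs)
      fun_prop
    · refine ContDiffAt.div ?_ ?_ hφ
      · unfold speed
        have := h1.rpow_const_of_ne (p := p) hs
        fun_prop
      · unfold phi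
        fun_prop
  set F : ℝ → ℝ × ℝ := fun t => (l₁ t, ψ₁ t) with hF
  set G : ℝ → ℝ × ℝ := fun t => (l₂ t, ψ₂ t) with hG
  have hFd : ∀ t ∈ Ioo c d, HasDerivAt F (v (F t)) t := fun t ht =>
    (h₁ t ht).2.1.prodMk (h₁ t ht).2.2
  have hGd : ∀ t ∈ Ioo c d, HasDerivAt G (v (G t)) t := fun t ht =>
    (h₂ t ht).2.1.prodMk (h₂ t ht).2.2
  have hFc : ContinuousOn F (Icc c' d') := fun t ht =>
    (hFd t (hsub ht)).continuousAt.continuousWithinAt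
  have hGc : ContinuousOn G (Icc c' d') := fun t ht =>
    (hGd t (hsub ht)).continuousAt.continuousWithinAt
  set K := F '' Icc c' d' ∪ G '' Icc c' d' with hK
  have hKc : IsCompact K := (isCompact_Icc.image_of_continuousOn hFc).union
    (isCompact_Icc.image_of_continuousOn hGc)
  have hloc : LocallyLipschitzOn K v := by
    intro x hx
    have hx2 : x.2 ∈ Ioo 0 π := by
      rcases hx with ⟨t, ht, rfl⟩ | ⟨t, ht, rfl⟩
      · exact (h₁ t (hsub ht)).1
      · exact (h₂ t (hsub ht)).1
    obtain ⟨C, w, hw, hL⟩ := (hvc x hx2).exists_lipschitzOnWith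
    exact ⟨C, w, mem_nhdsWithin_of_mem_nhds hw, hL⟩
  obtain ⟨C, hC⟩ := hloc.exists_lipschitzOnWith_of_compact hKc
  have := ODE_solution_unique_of_mem_Icc (v := fun _ => v) (s := fun _ => K) (K := C)
    (f := F) (g := G) (a := c') (b := d') (t₀ := t₀) (fun _ _ => hC)
    ⟨hc2.trans_le (min_le_right _ _), (le_max_right _ _).trans_lt hd1⟩ hFc
    (fun x hx => hFd x (hsub (Ioo_subset_Icc_self hx)))
    (fun x hx => Or.inl ⟨x, Ioo_subset_Icc_self hx, rfl⟩) hGc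
    (fun x hx => hGd x (hsub (Ioo_subset_Icc_self hx)))
    (fun x hx => Or.inr ⟨x, Ioo_subset_Icc_self hx, rfl⟩) (by simp [F, G, hl, hψ])
  have h3 := this (x := t) ⟨(hc2.trans_le (min_le_left _ _)).le, ((le_max_left _ _).trans_lt hd1).le⟩
  exact Prod.mk.injEq _ _ _ _ ▸ h3

end SectorODE

/-! ### The opening angle as a function of the exponent, and the spectral problem -/

namespace SectorODE
open Set Filter Topology Real MeasureTheory

/-- The time density of the spectral problem with exponent `β`, in the angular variable. -/
noncomputable def timeDensity (p β ψ : ℝ) : ℝ :=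
  phi p (sin ψ) / ((p - 1) * β + (p - 2) * sin ψ ^ 2)

/-- The opening angle for which `β` is the spectral exponent. -/
noncomputable def opening (p β : ℝ) : ℝ := ∫ ψ in (0 : ℝ)..π, timeDensity p β ψ

/-- The exponents `β` with `β > 0` and `β (p - 1) + p - 2 > 0`. -/
def Admissible (p β : ℝ) : Prop := 0 < β ∧ 0 < (p - 1) * β + (p - 2)

theorem Admissible.mono {p β β' : ℝ} (h : Admissible p β) (hp : 1 < p) (hβ : β ≤ β') :
    Admissible p β' :=
  ⟨h.1.trans_le hβ, by nlinarith [h.2]⟩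

/-- The expression is affine in $x^2$, and admissibility is positivity at $x^2=0$ and $x^2=1$. -/
theorem Admissible.den_pos {p β x : ℝ} (h : Admissible p β) (hp : 1 < p) (h1 : x ^ 2 ≤ 1) :
    0 < (p - 1) * β + (p - 2) * x ^ 2 := by
  have h2 : 0 < (p - 1) * β := mul_pos (sub_pos.2 hp) h.1
  rcases eq_or_lt_of_le h1 with h3 | h3
  · rw [h3]; linarith [h.2]
  · nlinarith [mul_pos h2 (sub_pos.2 h3), mul_nonneg h.2.le (sq_nonneg x)]

theorem Admissible.timeDensity_pos {p β : ℝ} (h : Admissible p β) (hp : 1 < p) (ψ : ℝ) :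
    0 < timeDensity p β ψ :=
  div_pos (phi_pos hp (sin_sq_le_one ψ)) (h.den_pos hp (sin_sq_le_one ψ))

theorem Admissible.continuous_timeDensity {p β : ℝ} (h : Admissible p β) (hp : 1 < p) :
    Continuous (timeDensity p β) := by
  unfold timeDensity phi
  exact Continuous.div (by fun_prop) (by fun_prop)
    (fun ψ => (h.den_pos hp (sin_sq_le_one ψ)).ne')

theorem opening_lt_opening {p β β' : ℝ} (hp : 1 < p) (h : Admissible p β) (hβ : β < β') :
    opening p β' < opening p β := by
  have h' := h.mono hp hβ.le
  have key : ∀ ψ, timeDensity p β' ψ < timeDensity p β ψ := fun ψ => by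
    have h1 := h.den_pos hp (sin_sq_le_one ψ)
    refine div_lt_div_of_pos_left (phi_pos hp (sin_sq_le_one ψ)) h1 ?_
    nlinarith
  exact intervalIntegral.integral_lt_integral_of_continuousOn_of_le_of_exists_lt pi_pos
    (h'.continuous_timeDensity hp).continuousOn (h.continuous_timeDensity hp).continuousOn
    (fun ψ _ => (key ψ).le) ⟨0, ⟨le_rfl, pi_pos.le⟩, key 0⟩

theorem continuousOn_opening {p β₁ : ℝ} (hp : 1 < p) (h : Admissible p β₁) :
    ContinuousOn (opening p) (Ici β₁) := by
  -- Clamping the exponent at $\beta_1$ makes the integrand continuous for all real parameters.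
  have : Continuous (fun β => ∫ ψ in (0 : ℝ)..π, timeDensity p (max β β₁) ψ) := by
    refine intervalIntegral.continuous_parametric_intervalIntegral_of_continuous' ?_ 0 π
    unfold timeDensity phi Function.uncurry
    refine Continuous.div (by fun_prop) (by fun_prop) ?_
    rintro ⟨β, ψ⟩
    exact ((h.mono hp (le_max_right _ _)).den_pos hp (sin_sq_le_one ψ)).ne'
  refine this.continuousOn.congr fun β hβ => ?_
  simp only [opening, max_eq_left (mem_Ici.1 hβ)]

theorem phi_ge {p x : ℝ} (hx : x ^ 2 ≤ 1) : min 1 (p - 1) ≤ phi p x := by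
  unfold phi
  nlinarith [min_le_left 1 (p - 1), min_le_right 1 (p - 1), sq_nonneg x]

theorem phi_le {p x : ℝ} (hp : 1 < p) (hx : x ^ 2 ≤ 1) : phi p x ≤ p := by
  unfold phi
  nlinarith [sq_nonneg x]

/-- Near the lower limit of admissibility the denominator almost vanishes: at $\psi=0$ if $p\ge2$
(with $\beta\to0$), at $\psi=\pi/2$ if $p<2$ (with $\beta\to(2-p)/(p-1)$). Exceeding the limit by
$\delta^2$ keeps it at most $C\delta^2$ on an interval of length $\delta$, which contributes at
least $m/(C\delta)$ to the integral. -/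
theorem exists_opening_gt {p : ℝ} (hp : 1 < p) (M : ℝ) :
    ∃ β, Admissible p β ∧ M < opening p β := by
  set C : ℝ := (p - 1) + |p - 2| with hC
  have hp1 := sub_pos.2 hp
  have hC0 : 0 < C := by positivity
  set m : ℝ := min 1 (p - 1) with hm
  have hm0 : 0 < m := lt_min one_pos hp1
  obtain ⟨δ, hδ0, hδ1, hδM⟩ : ∃ δ : ℝ, 0 < δ ∧ δ ≤ 1 ∧ M * (C * δ) < m := by
    refine ⟨min 1 (m / (2 * C * (|M| + 1))), by positivity, min_le_left _ _, ?_⟩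
    have h1 : min 1 (m / (2 * C * (|M| + 1))) ≤ m / (2 * C * (|M| + 1)) := min_le_right _ _
    have h2 : M * (C * min 1 (m / (2 * C * (|M| + 1)))) ≤
        (|M| + 1) * (C * (m / (2 * C * (|M| + 1)))) := by
      refine mul_le_mul (by linarith [le_abs_self M]) (mul_le_mul_of_nonneg_left h1 hC0.le)
        (by positivity) (by positivity)
    have h3 : (|M| + 1) * (C * (m / (2 * C * (|M| + 1)))) = m / 2 := by
      have : |M| + 1 ≠ 0 := by positivity
      field_simp
    linarith
  have main : ∀ β c : ℝ, Admissible p β → 0 ≤ c → c + δ ≤ π →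
      (∀ ψ ∈ Icc c (c + δ), (p - 1) * β + (p - 2) * sin ψ ^ 2 ≤ C * δ ^ 2) →
      M < opening p β := by
    intro β c hβ hc hcπ hden
    have hcont := hβ.continuous_timeDensity hp
    have h1 : ∫ ψ in c..(c + δ), timeDensity p β ψ ≤ opening p β := by
      refine intervalIntegral.integral_mono_interval hc (by linarith) hcπ ?_
        (hcont.intervalIntegrable _ _)
      exact Eventually.of_forall fun ψ => (hβ.timeDensity_pos hp ψ).le
    have h2 : ∫ ψ in c..(c + δ), (m / (C * δ ^ 2)) ≤ ∫ ψ in c..(c + δ), timeDensity p β ψ := by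
      refine intervalIntegral.integral_mono_on (by linarith) (by simp)
        (hcont.intervalIntegrable _ _) fun ψ hψ => ?_
      exact div_le_div₀ (phi_pos hp (sin_sq_le_one ψ)).le (phi_ge (sin_sq_le_one ψ))
        (hβ.den_pos hp (sin_sq_le_one ψ)) (hden ψ hψ)
    rw [intervalIntegral.integral_const, smul_eq_mul] at h2
    have h3 : M < (c + δ - c) * (m / (C * δ ^ 2)) := by
      rw [show (c + δ - c) * (m / (C * δ ^ 2)) = m / (C * δ) by field_simp; ring,
        lt_div_iff₀ (by positivity)]
      exact hδM
    linarith
  rcases le_or_gt 2 p with h2 | h2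
  · refine ⟨δ ^ 2, ⟨by positivity, by nlinarith [mul_pos hp1 (pow_pos hδ0 2)]⟩, ?_⟩
    refine main _ 0 ⟨by positivity, by nlinarith [mul_pos hp1 (pow_pos hδ0 2)]⟩ le_rfl
      (by linarith [pi_gt_three]) fun ψ hψ => ?_
    have h0 : 0 ≤ sin ψ := sin_nonneg_of_nonneg_of_le_pi hψ.1 (by linarith [hψ.2, pi_gt_three])
    have h3 : sin ψ ≤ δ := (sin_le hψ.1).trans (by linarith [hψ.2])
    have h4 : sin ψ ^ 2 ≤ δ ^ 2 := pow_le_pow_left₀ h0 h3 2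
    rw [hC, abs_of_nonneg (by linarith)]
    nlinarith
  · have hadm : Admissible p ((2 - p) / (p - 1) + δ ^ 2) := by
      refine ⟨by have : 0 < 2 - p := by linarith
                 positivity, ?_⟩
      have : (p - 1) * ((2 - p) / (p - 1) + δ ^ 2) = 2 - p + (p - 1) * δ ^ 2 := by
        field_simp
      rw [this]
      have : 0 < (p - 1) * δ ^ 2 := by positivity
      linarith
    refine ⟨_, hadm, main _ (π / 2) hadm (by positivity) (by linarith [pi_gt_three])
      fun ψ hψ => ?_⟩
    have e : (p - 1) * ((2 - p) / (p - 1) + δ ^ 2) = 2 - p + (p - 1) * δ ^ 2 := by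
      field_simp
    have h3 : cos ψ ^ 2 ≤ δ ^ 2 := by
      have e2 : cos ψ = -sin (ψ - π / 2) := by rw [sin_sub_pi_div_two]; ring
      have h0 : 0 ≤ sin (ψ - π / 2) := sin_nonneg_of_nonneg_of_le_pi (by linarith [hψ.1])
        (by linarith [hψ.2, pi_gt_three])
      have h3 : sin (ψ - π / 2) ≤ δ := (sin_le (by linarith [hψ.1])).trans (by linarith [hψ.2])
      rw [e2, neg_sq]
      exact pow_le_pow_left₀ h0 h3 2
    have h5 : sin ψ ^ 2 = 1 - cos ψ ^ 2 := by linarith [sin_sq_add_cos_sq ψ]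
    rw [e, hC, abs_of_neg (by linarith), h5]
    nlinarith

theorem exists_opening_lt {p ε β₁ : ℝ} (hp : 1 < p) (hε : 0 < ε) :
    ∃ β, Admissible p β ∧ β₁ ≤ β ∧ opening p β < ε := by
  have hp1 := sub_pos.2 hp
  -- With this $K$ the uniform bound $p/(K-|p-2|)$ on the density integrates to $\varepsilon/2$.
  set K : ℝ := |p - 2| + 2 * p * π / ε with hK
  have hKp : 0 < K - |p - 2| := by rw [hK, add_sub_cancel_left]; have := pi_pos; positivity
  set β := max (K / (p - 1)) β₁ with hβ
  have h1 : K ≤ (p - 1) * β := by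
    have := le_max_left (K / (p - 1)) β₁
    rw [div_le_iff₀ hp1] at this
    linarith
  have habs := neg_abs_le (p - 2)
  have hadm : Admissible p β := by
    refine ⟨?_, by linarith⟩
    have : 0 < (p - 1) * β := by linarith [abs_nonneg (p - 2)]
    exact pos_of_mul_pos_right this hp1.le
  refine ⟨β, hadm, le_max_right _ _, ?_⟩
  have h2 : opening p β ≤ ∫ ψ in (0 : ℝ)..π, p / (K - |p - 2|) := by
    refine intervalIntegral.integral_mono_on pi_pos.le
      ((hadm.continuous_timeDensity hp).intervalIntegrable _ _) (by simp) fun ψ _ => ?_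
    refine div_le_div₀ (by linarith) (phi_le hp (sin_sq_le_one ψ)) hKp ?_
    have h3 : -|p - 2| ≤ (p - 2) * sin ψ ^ 2 := by
      nlinarith [sin_sq_le_one ψ, sq_nonneg (sin ψ), abs_nonneg (p - 2)]
    linarith
  rw [intervalIntegral.integral_const, smul_eq_mul] at h2
  have h3 : (π - 0) * (p / (K - |p - 2|)) = ε / 2 := by
    rw [hK, add_sub_cancel_left, sub_zero]
    have := pi_pos
    field_simp
  linarith

theorem exists_opening_eq {p L : ℝ} (hp : 1 < p) (hL : 0 < L) :
    ∃ β, Admissible p β ∧ opening p β = L := by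
  obtain ⟨β₁, h1, hL1⟩ := exists_opening_gt hp L
  obtain ⟨β₂, h2, h12, hL2⟩ := exists_opening_lt (β₁ := β₁) hp hL
  have hc : ContinuousOn (opening p) (Icc β₁ β₂) :=
    (continuousOn_opening hp h1).mono Icc_subset_Ici_self
  obtain ⟨β, hβ, hβL⟩ := intermediate_value_Icc' h12 hc ⟨hL2.le, hL1.le⟩
  exact ⟨β, h1.mono hp hβ.1, hβL⟩

namespace Orbit
variable {p β s κ a b : ℝ} {l ψ : ℝ → ℝ}

/-- The function compares the actual time with the time at which the spectral flow of exponent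
$\beta'$ reaches the same angle. The sign of its derivative tells which flow is faster. -/
theorem hasDerivAt_time (h : Orbit p β s κ a b l ψ) (hp : 1 < p) {β' : ℝ}
    (hβ' : Admissible p β') {t : ℝ} (ht : t ∈ Ioo a b) :
    HasDerivAt (fun t => t - ∫ x in (0 : ℝ)..ψ t, timeDensity p β' x)
      (1 - speed p β s κ (l t) (ψ t) / (β * ((p - 1) * β' + (p - 2) * sin (ψ t) ^ 2))) t := by
  have hc := hβ'.continuous_timeDensity hp
  have h1 := (hc.integral_hasStrictDerivAt 0 (ψ t)).hasDerivAt.comp t (h.hasDerivAt_angle t ht)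
  refine ((hasDerivAt_id t).sub h1).congr_deriv ?_
  have h2 := phi_pos hp (sin_sq_le_one (ψ t))
  have h3 := hβ'.den_pos hp (sin_sq_le_one (ψ t))
  rw [timeDensity]
  congr 1
  by_cases hβ : β = 0
  · simp [hβ]
  field_simp

theorem tendsto_time_left (h : Orbit p β s κ a b l ψ) (hp : 1 < p) (hβ : 0 < β) (hκ : 0 ≤ κ)
    (hab : a < b) {β' : ℝ} (hβ' : Admissible p β') :
    Tendsto (fun t => t - ∫ x in (0 : ℝ)..ψ t, timeDensity p β' x) (𝓝[>] a) (𝓝 a) := by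
  have hc := hβ'.continuous_timeDensity hp
  have h1 : Continuous (fun y => ∫ x in (0 : ℝ)..y, timeDensity p β' x) :=
    intervalIntegral.continuous_primitive (fun _ _ => hc.intervalIntegrable _ _) 0
  have h2 := (h1.tendsto 0).comp (h.tendsto_angle_left hp hβ hκ hab)
  have h3 : Tendsto (fun t : ℝ => t) (𝓝[>] a) (𝓝 a) := tendsto_id.mono_left nhdsWithin_le_nhds
  simpa [Function.comp_def] using h3.sub h2

theorem tendsto_time_right (h : Orbit p β s κ a b l ψ) (hp : 1 < p) (hβ : 0 < β) (hκ : 0 ≤ κ)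
    (hab : a < b) {β' : ℝ} (hβ' : Admissible p β') :
    Tendsto (fun t => t - ∫ x in (0 : ℝ)..ψ t, timeDensity p β' x) (𝓝[<] b)
      (𝓝 (b - opening p β')) := by
  have hc := hβ'.continuous_timeDensity hp
  have h1 : Continuous (fun y => ∫ x in (0 : ℝ)..y, timeDensity p β' x) :=
    intervalIntegral.continuous_primitive (fun _ _ => hc.intervalIntegrable _ _) 0
  have h2 := (h1.tendsto π).comp (h.tendsto_angle_right hp hβ hκ hab)
  have h3 : Tendsto (fun t : ℝ => t) (𝓝[<] b) (𝓝 b) := tendsto_id.mono_left nhdsWithin_le_nhds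
  exact h3.sub h2

theorem opening_le (h : Orbit p β s κ a b l ψ) (hp : 1 < p) (hβ : 0 < β) (hκ : 0 ≤ κ)
    (hab : a < b) {β' : ℝ} (hβ' : Admissible p β')
    (hle : ∀ t ∈ Ioo a b, speed p β s κ (l t) (ψ t) ≤
      β * ((p - 1) * β' + (p - 2) * sin (ψ t) ^ 2)) : opening p β' ≤ b - a := by
  have hm := monotoneOn_Ioo_of_hasDerivAt (fun t ht => h.hasDerivAt_time hp hβ' ht)
    (fun t ht => by
      have := mul_pos hβ (hβ'.den_pos hp (sin_sq_le_one (ψ t)))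
      rw [sub_nonneg, div_le_one this]
      exact hle t ht)
  obtain ⟨t, ht⟩ := exists_between hab
  have h1 := MonotoneOn.ge_of_tendsto_left hm (h.tendsto_time_left hp hβ hκ hab hβ') ht
  have h2 := MonotoneOn.le_of_tendsto_right hm (h.tendsto_time_right hp hβ hκ hab hβ') ht
  linarith

theorem lt_opening (h : Orbit p β s κ a b l ψ) (hp : 1 < p) (hκ : 0 < κ)
    (hab : a < b) (hβ : Admissible p β) : b - a < opening p β := by
  have hm := strictMonoOn_Ioo_of_hasDerivAt (fun t ht => (h.hasDerivAt_time hp hβ ht).neg)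
    (fun t ht => by
      have := mul_pos hβ.1 (hβ.den_pos hp (sin_sq_le_one (ψ t)))
      rw [neg_sub, sub_pos, one_lt_div this]
      have hs := sin_pos_of_pos_of_lt_pi (h.mem t ht).1 (h.mem t ht).2
      have hβ0 := hβ.1
      have : 0 < κ * (β ^ (2 - p) * exp (s * l t) * sin (ψ t) ^ p) := by positivity
      unfold speed
      linarith)
  obtain ⟨t, ht⟩ := exists_between hab
  obtain ⟨t', ht'⟩ := exists_between ht.2
  have ht'2 : t' ∈ Ioo a b := ⟨ht.1.trans ht'.1, ht'.2⟩
  have h1 := MonotoneOn.ge_of_tendsto_left hm.monotoneOn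
    (h.tendsto_time_left hp hβ.1 hκ.le hab hβ).neg ht
  have h2 := MonotoneOn.le_of_tendsto_right hm.monotoneOn
    (h.tendsto_time_right hp hβ.1 hκ.le hab hβ).neg ht'2
  have h3 := hm ht ht'2 ht'.1
  linarith

/-- For $\kappa=0$ the speed depends on the angle alone and the comparison with $\beta'=\beta$ is an
equality. A nonadmissible $\beta$ lies below all admissible ones, so its orbit would last at least
as long as arbitrarily large openings. -/
theorem spectral (h : Orbit p β s 0 a b l ψ) (hp : 1 < p) (hβ : 0 < β) (hab : a < b) :
    Admissible p β ∧ opening p β = b - a := by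
  have hsp : ∀ t, speed p β s 0 (l t) (ψ t) = β * ((p - 1) * β + (p - 2) * sin (ψ t) ^ 2) := by
    intro t; unfold speed; ring
  have hp1 := sub_pos.2 hp
  have hadm : Admissible p β := by
    refine ⟨hβ, ?_⟩
    by_contra! hcon
    obtain ⟨β', hβ', hgt⟩ := exists_opening_gt hp (b - a)
    have hlt : β ≤ β' := by nlinarith [hβ'.2]
    have := h.opening_le hp hβ le_rfl hab hβ' fun t _ => by
      rw [hsp]
      refine mul_le_mul_of_nonneg_left ?_ hβ.le
      nlinarith
    linarith
  refine ⟨hadm, le_antisymm (h.opening_le hp hβ le_rfl hab hadm fun t _ => (hsp t).le) ?_⟩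
  have hm := antitoneOn_Ioo_of_hasDerivAt (fun t ht => h.hasDerivAt_time hp hadm ht)
    (fun t ht => by
      have := mul_pos hβ (hadm.den_pos hp (sin_sq_le_one (ψ t)))
      rw [hsp, div_self this.ne', sub_self])
  obtain ⟨t, ht⟩ := exists_between hab
  have h1 := MonotoneOn.ge_of_tendsto_left hm.neg
    (h.tendsto_time_left hp hβ le_rfl hab hadm).neg ht
  have h2 := MonotoneOn.le_of_tendsto_right hm.neg
    (h.tendsto_time_right hp hβ le_rfl hab hadm).neg ht
  linarith

end Orbit
end SectorODE

/-! ### Symmetry and uniqueness of the positive solution -/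

namespace SectorODE
open Set Filter Topology Real MeasureTheory

theorem speed_lt_speed {p β s κ l₁ l₂ x : ℝ} (hβ : 0 < β) (hs : 0 < s) (hκ : 0 < κ)
    (hx : x ∈ Ioo 0 π) (hl : l₁ < l₂) : speed p β s κ l₁ x < speed p β s κ l₂ x := by
  have h1 := sin_pos_of_pos_of_lt_pi hx.1 hx.2
  have h2 : exp (s * l₁) < exp (s * l₂) := exp_lt_exp.2 (by nlinarith)
  have h3 : 0 < β ^ (2 - p) := by positivity
  have h4 : 0 < sin x ^ p := by positivity
  unfold speed
  gcongr

namespace Orbit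
variable {p β s κ a b : ℝ} {l ψ : ℝ → ℝ}

/-- Reflection at a critical time $t_0$ gives an orbit with the same data at $t_0$, hence the same
orbit. If $t_0$ came before the midpoint, the angle would tend to $\pi$ at the interior point
$2t_0-a$. -/
theorem critical_ge (h : Orbit p β s κ a b l ψ) (hp : 1 < p) (hβ : 0 < β) (hκ : 0 ≤ κ)
    {t₀ : ℝ} (ht₀ : t₀ ∈ Ioo a b) (hψ : ψ t₀ = π / 2) : (a + b) / 2 ≤ t₀ := by
  by_contra! hlt
  have hab := ht₀.1.trans ht₀.2
  have hr := h.reflect (2 * t₀)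
  have hag := plane_unique (c := a) (d := 2 * t₀ - a) (t₀ := t₀) hp hβ
    (fun t ht => by
      have : t ∈ Ioo a b := ⟨ht.1, by linarith [ht.2]⟩
      exact ⟨h.mem t this, h.hasDerivAt_log t this, h.hasDerivAt_angle t this⟩)
    (fun t ht => by
      have : t ∈ Ioo (2 * t₀ - b) (2 * t₀ - a) := ⟨by linarith [ht.1], ht.2⟩
      exact ⟨hr.mem t this, hr.hasDerivAt_log t this, hr.hasDerivAt_angle t this⟩)
    ⟨ht₀.1, by linarith [ht₀.1]⟩ (by congr 1; ring)
    (by rw [show 2 * t₀ - t₀ = t₀ by ring, hψ]; ring)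
  have hmem : 2 * t₀ - a ∈ Ioo a b := ⟨by linarith [ht₀.1], by linarith⟩
  have h1 : Tendsto ψ (𝓝[<] (2 * t₀ - a)) (𝓝 π) := by
    refine (hr.tendsto_angle_right hp hβ hκ (by linarith)).congr' ?_
    filter_upwards [Ioo_mem_nhdsLT hmem.1] with t ht using (hag t ht).2.symm
  have h2 : Tendsto ψ (𝓝[<] (2 * t₀ - a)) (𝓝 (ψ (2 * t₀ - a))) :=
    ((h.hasDerivAt_angle _ hmem).continuousAt.tendsto).mono_left nhdsWithin_le_nhds
  have := tendsto_nhds_unique h1 h2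
  linarith [(h.mem _ hmem).2]

theorem critical_eq (h : Orbit p β s κ a b l ψ) (hp : 1 < p) (hβ : 0 < β) (hκ : 0 ≤ κ)
    {t₀ : ℝ} (ht₀ : t₀ ∈ Ioo a b) (hψ : ψ t₀ = π / 2) : t₀ = (a + b) / 2 := by
  have h1 := h.critical_ge hp hβ hκ ht₀ hψ
  have h2 := (h.reflect 0).critical_ge hp hβ hκ (t₀ := -t₀)
    ⟨by linarith [ht₀.2], by linarith [ht₀.1]⟩ (by simp only [zero_sub, neg_neg]; rw [hψ]; ring)
  linarith

theorem exists_angle_eq (h : Orbit p β s κ a b l ψ) (hp : 1 < p) (hβ : 0 < β) (hκ : 0 ≤ κ)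
    {t₁ : ℝ} (ht₁ : t₁ ∈ Ioo a b) (hψ : π / 2 ≤ ψ t₁) : ∃ t ∈ Ioc a t₁, ψ t = π / 2 := by
  have hab := ht₁.1.trans ht₁.2
  have hlim := h.tendsto_angle_left hp hβ hκ hab
  obtain ⟨t, h1, h2⟩ := ((hlim.eventually (eventually_lt_nhds (half_pos pi_pos))).and
    (Ioo_mem_nhdsGT ht₁.1)).exists
  have hc : ContinuousOn ψ (Icc t t₁) := fun x hx =>
    (h.hasDerivAt_angle x ⟨h2.1.trans_le hx.1, hx.2.trans_lt ht₁.2⟩).continuousAt.continuousWithinAt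
  obtain ⟨x, hx, hxe⟩ := intermediate_value_Icc h2.2.le hc ⟨h1.le, hψ⟩
  exact ⟨x, ⟨h2.1.trans_le hx.1, hx.2⟩, hxe⟩

theorem angle_mid (h : Orbit p β s κ a b l ψ) (hp : 1 < p) (hβ : 0 < β) (hκ : 0 ≤ κ)
    (hab : a < b) : ψ ((a + b) / 2) = π / 2 := by
  have hlim := h.tendsto_angle_right hp hβ hκ hab
  obtain ⟨t, h1, h2⟩ := ((hlim.eventually (eventually_gt_nhds (half_lt_self pi_pos))).and
    (Ioo_mem_nhdsLT hab)).exists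
  obtain ⟨x, hx, hxe⟩ := h.exists_angle_eq hp hβ hκ h2 h1.le
  rw [← h.critical_eq hp hβ hκ ⟨hx.1, hx.2.trans_lt h2.2⟩ hxe, hxe]

theorem angle_lt (h : Orbit p β s κ a b l ψ) (hp : 1 < p) (hβ : 0 < β) (hκ : 0 ≤ κ)
    {t : ℝ} (ht : t ∈ Ioo a ((a + b) / 2)) : ψ t < π / 2 := by
  by_contra! hge
  have htb : t < b := by linarith [ht.1, ht.2]
  obtain ⟨x, hx, hxe⟩ := h.exists_angle_eq hp hβ hκ ⟨ht.1, htb⟩ hge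
  have := h.critical_eq hp hβ hκ ⟨hx.1, hx.2.trans_lt htb⟩ hxe
  linarith [hx.2, ht.2]

/-- Where the speed vanishes $\psi$ is stationary, so only the change of $\ell$ contributes; this
leaves a term with the sign of $\cos\psi$. -/
theorem hasDerivAt_speed (h : Orbit p β s κ a b l ψ) {t : ℝ} (ht : t ∈ Ioo a b)
    (h0 : speed p β s κ (l t) (ψ t) = 0) :
    HasDerivAt (fun t => speed p β s κ (l t) (ψ t))
      (κ * (β ^ (2 - p) * (exp (s * l t) * (s * (β * (cos (ψ t) / sin (ψ t))))) * sin (ψ t) ^ p))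
      t := by
  have hs := sin_pos_of_pos_of_lt_pi (h.mem t ht).1 (h.mem t ht).2
  have h1 := h.hasDerivAt_angle t ht
  rw [h0, zero_div] at h1
  have h2 := h1.sin
  have h3 := ((h.hasDerivAt_log t ht).const_mul s).exp
  have h4 := ((((h3.const_mul (β ^ (2 - p))).mul
    (h2.rpow_const (p := p) (Or.inl hs.ne'))).const_mul κ).const_add
      ((p - 1) * β ^ 2)).add ((h2.pow 2).const_mul ((p - 2) * β))
  refine (h4.congr_deriv ?_).congr_of_eventuallyEq (Eventually.of_forall fun x => ?_)
  · ring
  · simp only [speed, Pi.add_apply, Pi.pow_apply, Pi.mul_apply]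
    ring

/-- The speed is positive near $a$, where $\psi\to0$. Before the midpoint $\cos\psi>0$, so any zero
of the speed has positive derivative, and a function that starts positive cannot reach zero that
way. -/
theorem speed_pos (h : Orbit p β s κ a b l ψ) (hp : 1 < p) (hβ : 0 < β) (hs : 0 < s) (hκ : 0 < κ)
    {t : ℝ} (ht : t ∈ Ioo a ((a + b) / 2)) : 0 < speed p β s κ (l t) (ψ t) := by
  have hab : a < b := by linarith [ht.1, ht.2]
  have hsub : ∀ x ∈ Ioo a ((a + b) / 2), x ∈ Ioo a b := fun x hx =>
    ⟨hx.1, by linarith [hx.2]⟩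
  have hder : ∀ x ∈ Ioo a ((a + b) / 2), speed p β s κ (l x) (ψ x) = 0 →
      ∃ d, 0 < d ∧ HasDerivAt (fun t => speed p β s κ (l t) (ψ t)) d x := by
    intro x hx h0
    refine ⟨_, ?_, h.hasDerivAt_speed (hsub x hx) h0⟩
    have hm := h.mem x (hsub x hx)
    have h1 := sin_pos_of_pos_of_lt_pi hm.1 hm.2
    have h2 : 0 < cos (ψ x) := cos_pos_of_mem_Ioo ⟨by linarith [hm.1, pi_pos],
      h.angle_lt hp hβ hκ.le hx⟩
    positivity
  have hdiff : ∀ x ∈ Ioo a b, DifferentiableAt ℝ (fun t => speed p β s κ (l t) (ψ t)) x := by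
    intro x hx
    have h1 := (h.hasDerivAt_angle x hx).differentiableAt
    have h2 := (h.hasDerivAt_log x hx).differentiableAt
    have hm := h.mem x hx
    have h3 := sin_pos_of_pos_of_lt_pi hm.1 hm.2
    have h4 : DifferentiableAt ℝ (fun t => sin (ψ t) ^ p) x :=
      (h1.sin).rpow_const (Or.inl h3.ne')
    unfold speed
    fun_prop
  have hev : ∀ᶠ x in 𝓝[>] a, 0 < speed p β s κ (l x) (ψ x) := by
    have hcont : ContinuousAt (fun x => (p - 1) * β ^ 2 + (p - 2) * β * sin x ^ 2) 0 := by fun_prop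
    have h0 : 0 < (p - 1) * β ^ 2 + (p - 2) * β * sin 0 ^ 2 := by
      have := sub_pos.2 hp
      rw [sin_zero]; simp only [ne_eq, OfNat.ofNat_ne_zero, not_false_eq_true, zero_pow, mul_zero,
        add_zero]; positivity
    have h1 := (hcont.tendsto.comp (h.tendsto_angle_left hp hβ hκ.le hab)).eventually
      (eventually_gt_nhds h0)
    filter_upwards [h1, Ioo_mem_nhdsGT hab] with x hx hxm
    have h3 := sin_pos_of_pos_of_lt_pi (h.mem x hxm).1 (h.mem x hxm).2
    have : 0 < κ * (β ^ (2 - p) * exp (s * l x) * sin (ψ x) ^ p) := by positivity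
    simp only [Function.comp_apply] at hx
    unfold speed
    linarith
  obtain ⟨t0, h0, ht0⟩ := (hev.and (Ioo_mem_nhdsGT ht.1)).exists
  obtain ⟨t1, ht1⟩ := exists_between ht.2
  have hIcc : ∀ x ∈ Icc t0 t1, x ∈ Ioo a ((a + b) / 2) := fun x hx =>
    ⟨ht0.1.trans_le hx.1, hx.2.trans_lt ht1.2⟩
  have hnn := image_le_of_deriv_right_lt_deriv_boundary
    (f := fun x => -speed p β s κ (l x) (ψ x))
    (f' := fun x => -deriv (fun x => speed p β s κ (l x) (ψ x)) x)
    (B := fun _ => 0) (B' := fun _ => 0) (a := t0) (b := t1)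
    (fun x hx => (hdiff x (hsub x (hIcc x hx))).neg.continuousAt.continuousWithinAt)
    (fun x hx => (hdiff x (hsub x (hIcc x
      (Ico_subset_Icc_self hx)))).hasDerivAt.neg.hasDerivWithinAt)
    (by linarith) (fun x => hasDerivAt_const _ _) (fun x hx hx0 => by
      obtain ⟨d, hd0, hd⟩ := hder x (hIcc x (Ico_subset_Icc_self hx)) (neg_eq_zero.1 hx0)
      rw [hd.deriv]
      linarith)
  have htm : t ∈ Icc t0 t1 := ⟨ht0.2.le, ht1.1.le⟩
  have hge : 0 ≤ speed p β s κ (l t) (ψ t) := by linarith [hnn htm]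
  -- The fence gives only nonnegativity; a zero would be a local minimum with nonzero derivative.
  refine lt_of_le_of_ne hge fun hne => ?_
  obtain ⟨d, hd0, hd⟩ := hder t ht hne.symm
  have hmin : IsLocalMin (fun x => speed p β s κ (l x) (ψ x)) t := by
    filter_upwards [Ioo_mem_nhds ht0.2 ht1.1] with x hx
    rw [← hne]
    linarith [hnn (Ioo_subset_Icc_self hx)]
  exact hd0.ne' (hmin.hasDerivAt_eq_zero hd)

/-- The first half of an orbit, parametrised by the angle. -/
theorem exists_angle_parametrisation (h : Orbit p β s κ a b l ψ) (hp : 1 < p) (hβ : 0 < β)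
    (hs : 0 < s) (hκ : 0 < κ) (hab : a < b) :
    ∃ g : ℝ → ℝ, (∀ x ∈ Ioo 0 (π / 2), g x ∈ Ioo a ((a + b) / 2) ∧
        0 < speed p β s κ (l (g x)) x ∧
        HasDerivAt g (β * phi p (sin x) / speed p β s κ (l (g x)) x) x ∧
        HasDerivAt (fun x => l (g x)) (β * (cos x / sin x) *
          (β * phi p (sin x) / speed p β s κ (l (g x)) x)) x) ∧
      (∀ t ∈ Ioo a ((a + b) / 2), ψ t ∈ Ioo 0 (π / 2) ∧ g (ψ t) = t) ∧
      Tendsto g (𝓝[>] 0) (𝓝 a) ∧ Tendsto g (𝓝[<] (π / 2)) (𝓝 ((a + b) / 2)) := by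
  have hsub : ∀ x ∈ Ioo a ((a + b) / 2), x ∈ Ioo a b := fun x hx =>
    ⟨hx.1, by linarith [hx.2]⟩
  have hmid : (a + b) / 2 ∈ Ioo a b := ⟨by linarith, by linarith⟩
  have hlim : Tendsto ψ (𝓝[<] ((a + b) / 2)) (𝓝 (π / 2)) := by
    have := (h.hasDerivAt_angle _ hmid).continuousAt.tendsto
    rw [h.angle_mid hp hβ hκ.le hab] at this
    exact this.mono_left nhdsWithin_le_nhds
  obtain ⟨g, hg1, hg2, hg3, hg4⟩ := exists_inverse
    (fun t ht => h.hasDerivAt_angle t (hsub t ht))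
    (fun t ht => div_pos (h.speed_pos hp hβ hs hκ ht)
      (mul_pos hβ (phi_pos hp (sin_sq_le_one (ψ t))))) hmid.1
    (h.tendsto_angle_left hp hβ hκ.le hab) hlim
  refine ⟨g, fun x hx => ?_, hg2, hg3, hg4⟩
  obtain ⟨h1, h2, h3⟩ := hg1 x hx
  have hpos := h.speed_pos hp hβ hs hκ h1
  rw [h2] at h3 hpos
  rw [inv_div] at h3
  refine ⟨h1, hpos, h3, ?_⟩
  have h4 := (h.hasDerivAt_log _ (hsub _ h1)).comp x h3
  rw [h2] at h4
  exact h4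

end Orbit

/-- With the angle as variable, $d\ell/dx$ is $\beta\cot x$ times the time density, and the density
decreases as $\ell$ grows. Two solutions therefore approach each other on $(0,\pi/2)$. -/
theorem antitoneOn_sq_sub {p β s κ : ℝ} {l₁ l₂ : ℝ → ℝ} {D : ℝ → ℝ → ℝ}
    (hβ : 0 < β) (hp : 1 < p) (hD : D = fun l x => speed p β s κ l x) (hs : 0 < s) (hκ : 0 < κ)
    (h₁ : ∀ x ∈ Ioo 0 (π / 2), 0 < D (l₁ x) x ∧ HasDerivAt l₁ (β * (cos x / sin x) *
      (β * phi p (sin x) / D (l₁ x) x)) x)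
    (h₂ : ∀ x ∈ Ioo 0 (π / 2), 0 < D (l₂ x) x ∧ HasDerivAt l₂ (β * (cos x / sin x) *
      (β * phi p (sin x) / D (l₂ x) x)) x) :
    AntitoneOn (fun x => (l₁ x - l₂ x) ^ 2) (Ioo 0 (π / 2)) := by
  subst hD
  refine antitoneOn_Ioo_of_hasDerivAt (fun x hx => ((h₁ x hx).2.sub (h₂ x hx).2).pow 2) ?_
  intro x hx
  have hsin : 0 < sin x := sin_pos_of_pos_of_lt_pi hx.1 (by linarith [hx.2, pi_pos])
  have hcos : 0 < cos x := cos_pos_of_mem_Ioo ⟨by linarith [hx.1, pi_pos], hx.2⟩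
  have hφ := phi_pos hp (sin_sq_le_one x)
  have hx' : x ∈ Ioo 0 π := ⟨hx.1, by linarith [hx.2, pi_pos]⟩
  simp only [Nat.cast_ofNat, Nat.add_one_sub_one, pow_one, Pi.sub_apply]
  rcases lt_trichotomy (l₁ x) (l₂ x) with h | h | h
  · have h3 := speed_lt_speed (p := p) hβ hs hκ hx' h
    have h4 : β * phi p (sin x) / speed p β s κ (l₂ x) x ≤
        β * phi p (sin x) / speed p β s κ (l₁ x) x :=
      div_le_div_of_nonneg_left (by positivity) (h₁ x hx).1 h3.le
    have h5 := mul_le_mul_of_nonneg_left h4 (by positivity : 0 ≤ β * (cos x / sin x))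
    nlinarith
  · rw [h]; simp
  · have h3 := speed_lt_speed (p := p) hβ hs hκ hx' h
    have h4 : β * phi p (sin x) / speed p β s κ (l₁ x) x ≤
        β * phi p (sin x) / speed p β s κ (l₂ x) x :=
      div_le_div_of_nonneg_left (by positivity) (h₂ x hx).1 h3.le
    have h5 := mul_le_mul_of_nonneg_left h4 (by positivity : 0 ≤ β * (cos x / sin x))
    nlinarith

/-- Before $x_0$ the square is at least $f(x_0)^2>0$, so $f$ keeps its sign; after $x_0$ a zero of
$f$ persists, so $f$ cannot become negative. -/
theorem le_of_antitone_sq {f : ℝ → ℝ} {c d : ℝ} (hf : ContinuousOn f (Ioo c d))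
    (hw : AntitoneOn (fun x => f x ^ 2) (Ioo c d)) {x₀ : ℝ} (hx₀ : x₀ ∈ Ioo c d) (h0 : 0 < f x₀) :
    (∀ x ∈ Ioo c x₀, 0 < f x) ∧ ∀ x ∈ Ioo c d, 0 ≤ f x := by
  have hzero : ∀ x ∈ Ioo c d, f x < 0 → ∃ z ∈ Ioo c d, f z = 0 ∧ min x x₀ ≤ z ∧ z ≤ max x x₀ := by
    intro x hx hneg
    have hsub : uIcc x x₀ ⊆ Ioo c d := (ordConnected_Ioo.uIcc_subset hx hx₀)
    obtain ⟨z, hz, hz0⟩ := intermediate_value_uIcc (hf.mono hsub)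
      (show (0 : ℝ) ∈ uIcc (f x) (f x₀) from by
        rw [uIcc_of_le (by linarith)]; exact ⟨hneg.le, h0.le⟩)
    exact ⟨z, hsub hz, hz0, hz.1, hz.2⟩
  have hleft : ∀ x ∈ Ioo c d, x ≤ x₀ → f x ≠ 0 := by
    intro x hx hxx hfx
    have := hw hx hx₀ hxx
    simp only [hfx] at this
    nlinarith
  have hlt : ∀ x ∈ Ioo c x₀, 0 < f x := by
    intro x hx
    have hx' : x ∈ Ioo c d := ⟨hx.1, hx.2.trans hx₀.2⟩
    rcases lt_trichotomy (f x) 0 with h | h | h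
    · obtain ⟨z, hz, hz0, -, hz2⟩ := hzero x hx' h
      rw [max_eq_right hx.2.le] at hz2
      exact absurd hz0 (hleft z hz hz2)
    · exact absurd h (hleft x hx' hx.2.le)
    · exact h
  refine ⟨hlt, fun x hx => ?_⟩
  by_contra! h
  obtain ⟨z, hz, hz0, -, hz2⟩ := hzero x hx h
  rcases le_total x x₀ with h1 | h1
  · rw [max_eq_right h1] at hz2
    exact absurd hz0 (hleft z hz hz2)
  · rw [max_eq_left h1] at hz2
    have := hw hz hx hz2
    simp only [hz0] at this
    nlinarith

theorem eq_of_monotoneOn_of_tendsto {f : ℝ → ℝ} {c d y : ℝ} (hf : MonotoneOn f (Ioo c d))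
    (h1 : Tendsto f (𝓝[>] c) (𝓝 y)) (h2 : Tendsto f (𝓝[<] d) (𝓝 y)) {x : ℝ} (hx : x ∈ Ioo c d) :
    f x = y :=
  le_antisymm (MonotoneOn.le_of_tendsto_right hf h2 hx) (MonotoneOn.ge_of_tendsto_left hf h1 hx)

namespace Orbit
variable {p β s κ a b : ℝ} {l₁ ψ₁ l₂ ψ₂ : ℝ → ℝ}

/-- If $\ell_1>\ell_2$ at some angle, then $\ell_1>\ell_2$ at all smaller angles and
$\ell_1\ge\ell_2$ at all others up to $\pi/2$. The first orbit would need strictly less time from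
$0$ to $\pi/2$, yet both take $(b-a)/2$. -/
theorem eqOn_half (h₁ : Orbit p β s κ a b l₁ ψ₁) (h₂ : Orbit p β s κ a b l₂ ψ₂) (hp : 1 < p)
    (hβ : 0 < β) (hs : 0 < s) (hκ : 0 < κ) : EqOn l₁ l₂ (Ioo a ((a + b) / 2)) := by
  intro t ht
  have hab : a < b := by linarith [ht.1, ht.2]
  obtain ⟨g₁, hg₁, hi₁, hl₁, hr₁⟩ := h₁.exists_angle_parametrisation hp hβ hs hκ hab
  obtain ⟨g₂, hg₂, hi₂, hl₂, hr₂⟩ := h₂.exists_angle_parametrisation hp hβ hs hκ hab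
  have hpi : (0 : ℝ) < π / 2 := half_pos pi_pos
  have key : ∀ (l l' g g' : ℝ → ℝ)
      (_ : ∀ x ∈ Ioo 0 (π / 2), 0 < speed p β s κ (l (g x)) x ∧
        HasDerivAt g (β * phi p (sin x) / speed p β s κ (l (g x)) x) x ∧
        HasDerivAt (fun x => l (g x)) (β * (cos x / sin x) *
          (β * phi p (sin x) / speed p β s κ (l (g x)) x)) x)
      (_ : ∀ x ∈ Ioo 0 (π / 2), 0 < speed p β s κ (l' (g' x)) x ∧
        HasDerivAt g' (β * phi p (sin x) / speed p β s κ (l' (g' x)) x) x ∧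
        HasDerivAt (fun x => l' (g' x)) (β * (cos x / sin x) *
          (β * phi p (sin x) / speed p β s κ (l' (g' x)) x)) x)
      (_ : Tendsto (fun x => g' x - g x) (𝓝[>] 0) (𝓝 0))
      (_ : Tendsto (fun x => g' x - g x) (𝓝[<] (π / 2)) (𝓝 0)),
      ∀ x ∈ Ioo 0 (π / 2), l (g x) ≤ l' (g' x) := by
    intro l l' g g' hd hd' ht0 ht1 x₀ hx₀
    by_contra! hlt
    have hw := antitoneOn_sq_sub (D := fun l x => speed p β s κ l x) hβ hp rfl hs hκ
      (fun x hx => ⟨(hd x hx).1, (hd x hx).2.2⟩) (fun x hx => ⟨(hd' x hx).1, (hd' x hx).2.2⟩)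
    have hc : ContinuousOn (fun x => l (g x) - l' (g' x)) (Ioo 0 (π / 2)) := fun x hx =>
      ((hd x hx).2.2.continuousAt.sub (hd' x hx).2.2.continuousAt).continuousWithinAt
    obtain ⟨hpos, hnn⟩ := le_of_antitone_sq hc hw hx₀ (sub_pos.2 hlt)
    have hφ : ∀ x, 0 < β * phi p (sin x) := fun x => mul_pos hβ (phi_pos hp (sin_sq_le_one x))
    have hmem : ∀ x ∈ Ioo 0 (π / 2), x ∈ Ioo 0 π := fun x hx => ⟨hx.1, by linarith [hx.2]⟩
    have hm : MonotoneOn (fun x => g' x - g x) (Ioo 0 (π / 2)) := by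
      refine monotoneOn_Ioo_of_hasDerivAt (fun x hx => (hd' x hx).2.1.sub (hd x hx).2.1) ?_
      intro x hx
      rw [sub_nonneg]
      refine div_le_div_of_nonneg_left (hφ x).le (hd' x hx).1 ?_
      rcases (sub_nonneg.1 (hnn x hx)).eq_or_lt with h | h
      · rw [h]
      · exact (speed_lt_speed hβ hs hκ (hmem x hx) h).le
    have hsub : ∀ x ∈ Ioo 0 x₀, x ∈ Ioo 0 (π / 2) := fun x hx => ⟨hx.1, hx.2.trans hx₀.2⟩
    have hsm : StrictMonoOn (fun x => g' x - g x) (Ioo 0 x₀) := by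
      refine strictMonoOn_Ioo_of_hasDerivAt
        (fun x hx => (hd' x (hsub x hx)).2.1.sub (hd x (hsub x hx)).2.1) ?_
      intro x hx
      rw [sub_pos]
      exact div_lt_div_of_pos_left (hφ x) (hd' x (hsub x hx)).1
        (speed_lt_speed hβ hs hκ (hmem x (hsub x hx)) (sub_pos.1 (hpos x hx)))
    -- A monotone time difference with limit $0$ at both ends vanishes identically, which
    -- contradicts strict growth between $x_0/3$ and $x_0/2$.
    have e1 := eq_of_monotoneOn_of_tendsto hm ht0 ht1 (x := x₀ / 3)
      ⟨by linarith [hx₀.1], by linarith [hx₀.1, hx₀.2]⟩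
    have e2 := eq_of_monotoneOn_of_tendsto hm ht0 ht1 (x := x₀ / 2)
      ⟨by linarith [hx₀.1], by linarith [hx₀.1, hx₀.2]⟩
    have := hsm (a := x₀ / 3) (b := x₀ / 2) ⟨by linarith [hx₀.1], by linarith [hx₀.1]⟩
      ⟨by linarith [hx₀.1], by linarith [hx₀.1]⟩ (by linarith [hx₀.1])
    simp only at e1 e2 this
    linarith
  have hd₁ := fun x hx => (hg₁ x hx).2
  have hd₂ := fun x hx => (hg₂ x hx).2
  have heq : ∀ x ∈ Ioo 0 (π / 2), l₁ (g₁ x) = l₂ (g₂ x) := fun x hx => le_antisymm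
    (key l₁ l₂ g₁ g₂ hd₁ hd₂ (by simpa using hl₂.sub hl₁) (by simpa using hr₂.sub hr₁) x hx)
    (key l₂ l₁ g₂ g₁ hd₂ hd₁ (by simpa using hl₁.sub hl₂) (by simpa using hr₁.sub hr₂) x hx)
  have hm : MonotoneOn (fun x => g₂ x - g₁ x) (Ioo 0 (π / 2)) := by
    refine monotoneOn_Ioo_of_hasDerivAt (fun x hx => (hd₂ x hx).2.1.sub (hd₁ x hx).2.1) ?_
    intro x hx
    rw [heq x hx, sub_self]
  obtain ⟨hx, hgx⟩ := hi₁ t ht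
  have e := eq_of_monotoneOn_of_tendsto hm (by simpa using hl₂.sub hl₁) (by simpa using hr₂.sub hr₁)
    hx
  have e2 := heq _ hx
  rw [hgx] at e2 e
  rw [e2]
  congr 1
  linarith

theorem eqOn (h₁ : Orbit p β s κ a b l₁ ψ₁) (h₂ : Orbit p β s κ a b l₂ ψ₂) (hp : 1 < p)
    (hβ : 0 < β) (hs : 0 < s) (hκ : 0 < κ) : EqOn l₁ l₂ (Ioo a b) := by
  have hleft := h₁.eqOn_half h₂ hp hβ hs hκ
  have hright : EqOn l₁ l₂ (Ioo ((a + b) / 2) b) := by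
    intro t ht
    have := (h₁.reflect 0).eqOn_half (h₂.reflect 0) hp hβ hs hκ (x := -t)
      ⟨by linarith [ht.2], by linarith [ht.1]⟩
    simpa using this
  intro t ht
  rcases lt_trichotomy t ((a + b) / 2) with h | h | h
  · exact hleft ⟨ht.1, h⟩
  · have e1 : Tendsto l₁ (𝓝[<] t) (𝓝 (l₁ t)) :=
      ((h₁.hasDerivAt_log t ht).continuousAt.tendsto).mono_left nhdsWithin_le_nhds
    have e2 : Tendsto l₂ (𝓝[<] t) (𝓝 (l₂ t)) :=
      ((h₂.hasDerivAt_log t ht).continuousAt.tendsto).mono_left nhdsWithin_le_nhds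
    refine tendsto_nhds_unique e1 (e2.congr' ?_)
    filter_upwards [Ioo_mem_nhdsLT ht.1] with x hx
    exact (hleft ⟨hx.1, hx.2.trans_eq h⟩).symm
  · exact hright ⟨h, ht.2⟩

end Orbit

theorem IntervalSolution.eqOn {p β s κ a b : ℝ} {u₁ u₂ : ℝ → ℝ} (hp : 1 < p) (hβ : 0 < β)
    (hs : 0 < s) (hκ : 0 < κ) (hab : a < b) (h₁ : IntervalSolution p β s κ a b u₁)
    (h₂ : IntervalSolution p β s κ a b u₂) : EqOn u₁ u₂ (Icc a b) := by
  intro t ht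
  rcases eq_endpoints_or_mem_Ioo_of_mem_Icc ht with rfl | rfl | ht
  · rw [h₁.left, h₂.left]
  · rw [h₁.right, h₂.right]
  · have := (h₁.orbit hp hβ hab).eqOn (h₂.orbit hp hβ hab) hp hβ hs hκ ht
    exact log_injOn_pos (h₁.pos t ht) (h₂.pos t ht) this

end SectorODE

/-! ### From a radius function on [0, 1] to a solution on the interval -/

namespace SectorODE
open Set Filter Topology Real MeasureTheory

/-- The angular speed, up to the factor `β φ`, in polar coordinates `u = exp r * x`,
`u' = β * exp r * cos ψ`, where `x = sin ψ`. -/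
noncomputable def polarSpeed (p β s κ x r : ℝ) : ℝ :=
  (p - 1) * β ^ 2 + (p - 2) * β * x ^ 2 + κ * (β ^ (2 - p) * exp (s * r) * x ^ (p + s))

/-- The derivative of `r` with respect to `x = sin ψ` along a trajectory, in polar coordinates. -/
noncomputable def polarField (p β s κ x r : ℝ) : ℝ :=
  ((2 - p) * β * (1 + β) * x - κ * (β ^ (2 - p) * exp (s * r) * x ^ (p + s - 1))) /
    polarSpeed p β s κ x r

theorem continuousOn_polarSpeed {p β s κ : ℝ} {r : ℝ → ℝ} {t : Set ℝ} (hps : 0 ≤ p + s)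
    (hr : ContinuousOn r t) : ContinuousOn (fun x => polarSpeed p β s κ x (r x)) t := by
  have h1 : ContinuousOn (fun x : ℝ => x ^ (p + s)) t :=
    (Real.continuous_rpow_const hps).continuousOn
  unfold polarSpeed
  fun_prop

theorem continuousOn_Icc_of_tendsto {f : ℝ → ℝ} {a b : ℝ} (hab : a < b)
    (hf : ContinuousOn f (Ioo a b)) (ha : Tendsto f (𝓝[>] a) (𝓝 (f a)))
    (hb : Tendsto f (𝓝[<] b) (𝓝 (f b))) : ContinuousOn f (Icc a b) := by
  intro t ht
  rcases eq_endpoints_or_mem_Ioo_of_mem_Icc ht with rfl | rfl | ht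
  · rw [continuousWithinAt_Icc_iff_Ici hab, ← continuousWithinAt_Ioi_iff_Ici]
    exact ha
  · rw [continuousWithinAt_Icc_iff_Iic hab, ← continuousWithinAt_Iio_iff_Iic]
    exact hb
  · exact (hf.continuousAt (Ioo_mem_nhds ht.1 ht.2)).continuousWithinAt

/-- Since $r$ depends only on $\sin\psi$, one function on $[0,1]$ serves both halves of the
trajectory. Integrating the time density and inverting gives $\Psi(t)$, and
$u=e^{r(\sin\Psi)}\sin\Psi$ solves the equation; the integral condition fits the length. -/
theorem exists_intervalSolution {p β s κ a b : ℝ} {r : ℝ → ℝ} (hp : 1 < p) (hβ : 0 < β) (hs : 0 < s)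
    (hab : a < b)
    (hr : ∀ x ∈ Icc (0 : ℝ) 1, HasDerivWithinAt r (polarField p β s κ x (r x)) (Icc 0 1) x)
    (hD : ∀ x ∈ Icc (0 : ℝ) 1, 0 < polarSpeed p β s κ x (r x))
    (hint : ∫ ψ in (0 : ℝ)..π, β * phi p (sin ψ) / polarSpeed p β s κ (sin ψ) (r (sin ψ)) = b - a) :
    ∃ u : ℝ → ℝ, IntervalSolution p β s κ a b u := by
  have hrc : ContinuousOn r (Icc 0 1) := fun x hx => (hr x hx).continuousWithinAt
  -- The absolute value keeps the argument in $[0,1]$, so the density is continuous and positive on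
  -- the whole line.
  set G : ℝ → ℝ := fun ψ => β * phi p |sin ψ| / polarSpeed p β s κ |sin ψ| (r |sin ψ|) with hG
  have habs : ∀ ψ, |sin ψ| ∈ Icc (0 : ℝ) 1 := fun ψ => ⟨abs_nonneg _, abs_sin_le_one ψ⟩
  have hGc : Continuous G := by
    have h1 : ContinuousOn (fun x => β * phi p x / polarSpeed p β s κ x (r x)) (Icc 0 1) := by
      refine ContinuousOn.div ?_ (continuousOn_polarSpeed (by linarith) hrc)
        fun x hx => (hD x hx).ne'
      unfold phi
      fun_prop
    exact h1.comp_continuous (continuous_sin.abs) habs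
  have hGpos : ∀ ψ, 0 < G ψ := fun ψ => by
    refine div_pos (mul_pos hβ (phi_pos hp ?_)) (hD _ (habs ψ))
    rw [sq_abs]; exact sin_sq_le_one ψ
  have hsinpos : ∀ ψ ∈ Ioo 0 π, 0 < sin ψ := fun ψ hψ => sin_pos_of_pos_of_lt_pi hψ.1 hψ.2
  have hGsin : ∀ ψ ∈ Icc 0 π, G ψ = β * phi p (sin ψ) / polarSpeed p β s κ (sin ψ) (r (sin ψ)) := by
    intro ψ hψ
    simp only [hG, abs_of_nonneg (sin_nonneg_of_nonneg_of_le_pi hψ.1 hψ.2)]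
  have hint' : ∫ ψ in (0 : ℝ)..π, G ψ = b - a := by
    rw [← hint]
    refine intervalIntegral.integral_congr fun ψ hψ => ?_
    rw [uIcc_of_le pi_pos.le] at hψ
    exact hGsin ψ hψ
  have hτ : ∀ ψ, HasDerivAt (fun y => a + ∫ x in (0 : ℝ)..y, G x) (G ψ) ψ := fun ψ =>
    (hGc.integral_hasStrictDerivAt 0 ψ).hasDerivAt.const_add a
  have hτc : Continuous (fun y => a + ∫ x in (0 : ℝ)..y, G x) :=
    continuous_iff_continuousAt.2 fun ψ => (hτ ψ).continuousAt
  obtain ⟨Ψ, hΨ, -, hΨa, hΨb⟩ := exists_inverse (a := 0) (b := π) (c := a) (d := b)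
    (fun ψ _ => hτ ψ) (fun ψ _ => hGpos ψ) pi_pos
    (by
      have := (hτc.tendsto 0).mono_left (nhdsWithin_le_nhds (s := Ioi 0))
      simpa using this)
    (by
      have := (hτc.tendsto π).mono_left (nhdsWithin_le_nhds (s := Iio π))
      simp only [hint'] at this
      simpa using this)
  have hmem : ∀ t ∈ Ioo a b, Ψ t ∈ Ioo 0 π := fun t ht => (hΨ t ht).1
  have hxm : ∀ t ∈ Ioo a b, sin (Ψ t) ∈ Icc (0 : ℝ) 1 := fun t ht =>
    ⟨(hsinpos _ (hmem t ht)).le, sin_le_one _⟩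
  have hΨd : ∀ t ∈ Ioo a b, HasDerivAt Ψ (polarSpeed p β s κ (sin (Ψ t)) (r (sin (Ψ t))) /
      (β * phi p (sin (Ψ t)))) t := by
    intro t ht
    have := (hΨ t ht).2.2
    rwa [hGsin _ (Ioo_subset_Icc_self (hmem t ht)), inv_div] at this
  set ρ : ℝ → ℝ := fun t => r (sin (Ψ t)) with hρ
  have hρd : ∀ t ∈ Ioo a b, HasDerivAt ρ (polarField p β s κ (sin (Ψ t)) (ρ t) *
      (cos (Ψ t) * (polarSpeed p β s κ (sin (Ψ t)) (ρ t) / (β * phi p (sin (Ψ t)))))) t := by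
    intro t ht
    have h1 := (hΨd t ht).sin
    -- At the midpoint $\sin\Psi=1$, where $r$ has only a one-sided derivative; this suffices
    -- because $\sin\Psi$ never leaves $[0,1]$.
    refine HasDerivWithinAt.comp_hasDerivAt t (hr _ (hxm t ht)) h1 ?_
    filter_upwards [Ioo_mem_nhds ht.1 ht.2] with x hx using hxm x hx
  set v : ℝ → ℝ := fun t => exp (ρ t) * sin (Ψ t) with hv
  have hfield : ∀ x ∈ Icc (0 : ℝ) 1, polarField p β s κ x (r x) * polarSpeed p β s κ x (r x) =
      (2 - p) * β * (1 + β) * x - κ * (β ^ (2 - p) * exp (s * r x) * x ^ (p + s - 1)) := by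
    intro x hx
    rw [polarField, div_mul_cancel₀ _ (hD x hx).ne']
  have hφ : ∀ x, 0 < phi p (sin x) := fun x => phi_pos hp (sin_sq_le_one x)
  have hsplit : ∀ t ∈ Ioo a b, sin (Ψ t) ^ (p + s) = sin (Ψ t) ^ (p + s - 1) * sin (Ψ t) := by
    intro t ht
    rw [← rpow_add_one (hsinpos _ (hmem t ht)).ne', sub_add_cancel]
  have hvd : ∀ t ∈ Ioo a b, HasDerivAt v (β * exp (ρ t) * cos (Ψ t)) t := by
    intro t ht
    refine ((hρd t ht).exp.mul (hΨd t ht).sin).congr_deriv ?_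
    have h1 := hfield _ (hxm t ht)
    have h2 := hφ (Ψ t)
    have h3 : polarField p β s κ (sin (Ψ t)) (ρ t) * (cos (Ψ t) *
        (polarSpeed p β s κ (sin (Ψ t)) (ρ t) / (β * phi p (sin (Ψ t))))) =
        ((2 - p) * β * (1 + β) * sin (Ψ t) - κ * (β ^ (2 - p) * exp (s * ρ t) *
          sin (Ψ t) ^ (p + s - 1))) * cos (Ψ t) / (β * phi p (sin (Ψ t))) := by
      rw [← h1]; ring
    rw [h3]
    have h4 : polarSpeed p β s κ (sin (Ψ t)) (r (sin (Ψ t))) = (p - 1) * β ^ 2 +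
        (p - 2) * β * sin (Ψ t) ^ 2 + κ * (β ^ (2 - p) * exp (s * ρ t) *
          (sin (Ψ t) ^ (p + s - 1) * sin (Ψ t))) := by
      rw [polarSpeed, hsplit t ht]
    rw [h4]
    have h5 : phi p (sin (Ψ t)) = (p - 1) * (1 - sin (Ψ t) ^ 2) + sin (Ψ t) ^ 2 := rfl
    field_simp
    rw [h5]
    ring
  have hvpos : ∀ t ∈ Ioo a b, 0 < v t := fun t ht => mul_pos (exp_pos _) (hsinpos _ (hmem t ht))
  obtain ⟨M, hM⟩ := isCompact_Icc.bddAbove_image hrc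
  have hvle : ∀ t ∈ Ioo a b, v t ≤ exp M * sin (Ψ t) := fun t ht =>
    mul_le_mul_of_nonneg_right (exp_le_exp.2 (hM (mem_image_of_mem _ (hxm t ht))))
      (hsinpos _ (hmem t ht)).le
  have hva : Tendsto v (𝓝[>] a) (𝓝 0) := by
    have h1 : Tendsto (fun t => exp M * sin (Ψ t)) (𝓝[>] a) (𝓝 0) := by
      simpa using ((continuous_sin.tendsto 0).comp hΨa).const_mul (exp M)
    refine tendsto_of_tendsto_of_tendsto_of_le_of_le' tendsto_const_nhds h1 ?_ ?_
    · filter_upwards [Ioo_mem_nhdsGT hab] with t ht using (hvpos t ht).le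
    · filter_upwards [Ioo_mem_nhdsGT hab] with t ht using hvle t ht
  have hvb : Tendsto v (𝓝[<] b) (𝓝 0) := by
    have h1 : Tendsto (fun t => exp M * sin (Ψ t)) (𝓝[<] b) (𝓝 0) := by
      simpa using ((continuous_sin.tendsto π).comp hΨb).const_mul (exp M)
    refine tendsto_of_tendsto_of_tendsto_of_le_of_le' tendsto_const_nhds h1 ?_ ?_
    · filter_upwards [Ioo_mem_nhdsLT hab] with t ht using (hvpos t ht).le
    · filter_upwards [Ioo_mem_nhdsLT hab] with t ht using hvle t ht
  classical
  -- The inverse $\Psi$ is uncontrolled at $a$ and $b$; the indicator sets the values there to $0$,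
  -- the limits of $v$.
  set u : ℝ → ℝ := (Ioo a b).indicator v with hu
  have huv : EqOn u v (Ioo a b) := fun t ht => indicator_of_mem ht v
  have hua : u a = 0 := indicator_of_notMem (by simp) v
  have hub : u b = 0 := indicator_of_notMem (by simp) v
  have hud : ∀ t ∈ Ioo a b, HasDerivAt u (β * exp (ρ t) * cos (Ψ t)) t := fun t ht =>
    (hvd t ht).congr_of_eventuallyEq (eventuallyEq_of_mem (Ioo_mem_nhds ht.1 ht.2) huv)
  have hflux : ∀ t ∈ Ioo a b, (β ^ 2 * u t ^ 2 + deriv u t ^ 2) ^ (p / 2 - 1) =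
      β ^ (p - 2) * exp ((p - 2) * ρ t) := by
    intro t ht
    have e : β ^ 2 * u t ^ 2 + deriv u t ^ 2 = (β * exp (ρ t)) ^ 2 := by
      rw [(hud t ht).deriv, huv ht]
      simp only [hv]
      linear_combination (β * exp (ρ t)) ^ 2 * sin_sq_add_cos_sq (Ψ t)
    have hpos : 0 < β * exp (ρ t) := by positivity
    rw [e, ← rpow_natCast, ← rpow_mul hpos.le, mul_rpow hβ.le (exp_pos _).le, ← exp_mul]
    have : ((2 : ℕ) : ℝ) * (p / 2 - 1) = p - 2 := by push_cast; ring
    rw [this, mul_comm (ρ t)]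
  have hexp : ∀ t, exp ((p - 2) * ρ t) * exp (ρ t) = exp ((p - 1) * ρ t) := fun t => by
    rw [← exp_add]; congr 1; ring
  have hFeq : ∀ t ∈ Ioo a b, (β ^ 2 * u t ^ 2 + deriv u t ^ 2) ^ (p / 2 - 1) * deriv u t =
      β ^ (p - 2) * β * (exp ((p - 1) * ρ t) * cos (Ψ t)) := by
    intro t ht
    rw [hflux t ht, (hud t ht).deriv, ← hexp]
    ring
  have hFd : ∀ t ∈ Ioo a b, HasDerivAt
      (fun t => (β ^ 2 * u t ^ 2 + deriv u t ^ 2) ^ (p / 2 - 1) * deriv u t)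
      (β ^ (p - 2) * β * (exp ((p - 1) * ρ t) * ((p - 1) *
        (polarField p β s κ (sin (Ψ t)) (ρ t) * (cos (Ψ t) *
          (polarSpeed p β s κ (sin (Ψ t)) (ρ t) / (β * phi p (sin (Ψ t))))))) * cos (Ψ t) +
        exp ((p - 1) * ρ t) * (-sin (Ψ t) * (polarSpeed p β s κ (sin (Ψ t)) (r (sin (Ψ t))) /
          (β * phi p (sin (Ψ t))))))) t := by
    intro t ht
    refine ((((hρd t ht).const_mul (p - 1)).exp.mul (hΨd t ht).cos).const_mul
      (β ^ (p - 2) * β)).congr_of_eventuallyEq ?_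
    exact eventuallyEq_of_mem (Ioo_mem_nhds ht.1 ht.2) hFeq
  refine ⟨u, ⟨?_, hua, hub, fun t ht => ?_, fun t ht => ?_, fun t ht => ?_, fun t ht => ?_⟩⟩
  · refine continuousOn_Icc_of_tendsto hab
      (fun t ht => (hud t ht).continuousAt.continuousWithinAt) ?_ ?_
    · rw [hua]
      refine hva.congr' ?_
      filter_upwards [Ioo_mem_nhdsGT hab] with t ht using (huv ht).symm
    · rw [hub]
      refine hvb.congr' ?_
      filter_upwards [Ioo_mem_nhdsLT hab] with t ht using (huv ht).symm
  · rw [huv ht]; exact hvpos t ht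
  · have hdo : ContDiffOn ℝ 1 u (Ioo a b) := by
      rw [show (1 : WithTop ℕ∞) = 0 + 1 from rfl, contDiffOn_succ_iff_deriv_of_isOpen isOpen_Ioo]
      refine ⟨fun t ht => (hud t ht).differentiableAt.differentiableWithinAt, by simp, ?_⟩
      rw [contDiffOn_zero]
      have : ContinuousOn (fun t => β * exp (ρ t) * cos (Ψ t)) (Ioo a b) := fun t ht =>
        (((hρd t ht).continuousAt.rexp.const_mul β).mul
          (continuous_cos.continuousAt.comp (hΨd t ht).continuousAt)).continuousWithinAt
      exact this.congr fun t ht => (hud t ht).deriv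
    exact hdo.contDiffAt (Ioo_mem_nhds ht.1 ht.2)
  · exact (hFd t ht).differentiableAt
  · rw [(hFd t ht).deriv, hflux t ht, huv ht, abs_of_pos (hvpos t ht)]
    have hx := hsinpos _ (hmem t ht)
    have h1 := hfield _ (hxm t ht)
    have h2 := hφ (Ψ t)
    have h3 : polarField p β s κ (sin (Ψ t)) (ρ t) * (cos (Ψ t) *
        (polarSpeed p β s κ (sin (Ψ t)) (ρ t) / (β * phi p (sin (Ψ t))))) =
        ((2 - p) * β * (1 + β) * sin (Ψ t) - κ * (β ^ (2 - p) * exp (s * ρ t) *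
          sin (Ψ t) ^ (p + s - 1))) * cos (Ψ t) / (β * phi p (sin (Ψ t))) := by
      rw [← h1]; ring
    have h4 : polarSpeed p β s κ (sin (Ψ t)) (r (sin (Ψ t))) = (p - 1) * β ^ 2 +
        (p - 2) * β * sin (Ψ t) ^ 2 + κ * (β ^ (2 - p) * exp (s * ρ t) *
          (sin (Ψ t) ^ (p + s - 1) * sin (Ψ t))) := by
      rw [polarSpeed, hsplit t ht]
    have h5 : phi p (sin (Ψ t)) = (p - 1) * (1 - sin (Ψ t) ^ 2) + sin (Ψ t) ^ 2 := rfl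
    have h6 : v t ^ (p - 2 + s) * v t = exp ((p - 1) * ρ t) * exp (s * ρ t) *
        sin (Ψ t) ^ (p + s - 1) := by
      rw [← rpow_add_one (hvpos t ht).ne']
      simp only [hv]
      rw [mul_rpow (exp_pos _).le hx.le, ← exp_mul, ← exp_add]
      congr 2 <;> ring
    have h7 : β ^ (2 - p) = (β ^ (p - 2))⁻¹ := by
      rw [← rpow_neg hβ.le]; congr 1; ring
    have h8 : β ^ (p - 2) * exp ((p - 2) * ρ t) * v t =
        β ^ (p - 2) * exp ((p - 1) * ρ t) * sin (Ψ t) := by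
      rw [← hexp]; simp only [hv]; ring
    have h9 : 0 < β ^ (p - 2) := rpow_pos_of_pos hβ _
    rw [h3, h4, h6, h7, h8]
    have h10 : cos (Ψ t) ^ 2 = 1 - sin (Ψ t) ^ 2 := by linarith [sin_sq_add_cos_sq (Ψ t)]
    rw [h5] at h2 ⊢
    generalize β ^ (p - 2) = B at *
    generalize exp ((p - 1) * ρ t) = P at *
    generalize exp (s * ρ t) = E at *
    generalize sin (Ψ t) ^ (p + s - 1) = X at *
    have h11 : ∀ A : ℝ, A * cos (Ψ t) / (β * ((p - 1) * (1 - sin (Ψ t) ^ 2) + sin (Ψ t) ^ 2)) *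
        cos (Ψ t) = A * (1 - sin (Ψ t) ^ 2) /
          (β * ((p - 1) * (1 - sin (Ψ t) ^ 2) + sin (Ψ t) ^ 2)) := by
      intro A; rw [← h10]; ring
    rw [mul_assoc P, mul_assoc (p - 1), h11]
    field_simp
    ring

end SectorODE

/-! ### Solving the radial equation on [0, 1] -/

namespace SectorODE
open Set Filter Topology Real MeasureTheory
open scoped NNReal

/-- For $\kappa=0$ the field does not involve $r$, and its primitive is an explicit logarithm of the
denominator. -/
theorem exists_spectral_intervalSolution {p β s a b : ℝ} (hp : 1 < p) (hs : 0 < s)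
    (hab : a < b) (hβ : Admissible p β) (hL : opening p β = b - a) :
    ∃ u : ℝ → ℝ, IntervalSolution p β s 0 a b u := by
  have hsp : ∀ x r, polarSpeed p β s 0 x r = β * ((p - 1) * β + (p - 2) * x ^ 2) := by
    intro x r; unfold polarSpeed; ring
  have hsq : ∀ x ∈ Icc (0 : ℝ) 1, x ^ 2 ≤ 1 := fun x hx => pow_le_one₀ hx.1 hx.2
  refine exists_intervalSolution
    (r := fun x => -((1 + β) / 2) * log (β * ((p - 1) * β + (p - 2) * x ^ 2)))
    hp hβ.1 hs hab (fun x hx => ?_) (fun x hx => ?_) ?_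
  · have hd := hβ.den_pos hp (hsq x hx)
    have h1 : HasDerivAt (fun x : ℝ => β * ((p - 1) * β + (p - 2) * x ^ 2))
        (β * ((p - 2) * (2 * x))) x := by
      simpa using (((hasDerivAt_pow 2 x).const_mul (p - 2)).const_add ((p - 1) * β)).const_mul β
    refine (((h1.log (mul_pos hβ.1 hd).ne').const_mul _).congr_deriv ?_).hasDerivWithinAt
    rw [polarField, hsp]
    have := hβ.1
    field_simp
    ring
  · rw [hsp]
    exact mul_pos hβ.1 (hβ.den_pos hp (hsq x hx))
  · rw [← hL, opening]
    refine intervalIntegral.integral_congr fun ψ _ => ?_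
    simp only [hsp, timeDensity]
    exact mul_div_mul_left _ _ hβ.1.ne'

theorem exists_solution_of_lipschitz_of_bounded {f : ℝ → ℝ → ℝ} {L K : ℝ≥0}
    (hlip : ∀ x ∈ Icc (0 : ℝ) 1, LipschitzWith K (f x))
    (hcont : ∀ y, ContinuousOn (fun x => f x y) (Icc 0 1))
    (hb : ∀ x ∈ Icc (0 : ℝ) 1, ∀ y, |f x y| ≤ L) (y₀ : ℝ) :
    ∃ r : ℝ → ℝ, r 0 = y₀ ∧ ∀ x ∈ Icc (0 : ℝ) 1, HasDerivWithinAt r (f x (r x)) (Icc 0 1) x := by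
  have : IsPicardLindelof f (tmin := 0) (tmax := 1) ⟨0, by simp⟩ y₀ L 0 L K :=
    { lipschitzOnWith := fun t ht => (hlip t ht).lipschitzOnWith
      continuousOn := fun x _ => hcont x
      norm_le := fun t ht x _ => hb t ht x
      mul_max_le := by simp }
  exact this.exists_eq_forall_mem_Icc_hasDerivWithinAt₀

theorem abs_exp_sub_exp_le {y y' K : ℝ} (h : y ≤ K) (h' : y' ≤ K) :
    |exp y - exp y'| ≤ exp K * |y - y'| := by
  wlog hle : y' ≤ y generalizing y y'
  · rw [abs_sub_comm, abs_sub_comm y]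
    exact this h' h (le_of_not_ge hle)
  rw [abs_of_nonneg (sub_nonneg.2 (exp_le_exp.2 hle)), abs_of_nonneg (sub_nonneg.2 hle)]
  have h1 := add_one_le_exp (y' - y)
  have h2 : exp y' = exp y * exp (y' - y) := by rw [← exp_add]; congr 1; ring
  have h3 := exp_le_exp.2 h
  rw [h2]
  nlinarith [exp_pos y, mul_le_mul_of_nonneg_right h3 (sub_nonneg.2 hle)]

theorem abs_div_sub_div_le {A A' B B' ε M : ℝ} (hε : 0 < ε) (hB : ε ≤ B) (hB' : ε ≤ B')
    (hA' : |A'| ≤ M) : |A / B - A' / B'| ≤ |A - A'| / ε + M * |B - B'| / ε ^ 2 := by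
  have hB0 := hε.trans_le hB
  have hB0' := hε.trans_le hB'
  have hM : 0 ≤ M := (abs_nonneg _).trans hA'
  have e : A / B - A' / B' = (A - A') / B + A' * (B' - B) / (B * B') := by
    field_simp; ring
  rw [e]
  refine (abs_add_le _ _).trans (add_le_add ?_ ?_)
  · rw [abs_div, abs_of_pos hB0]
    exact div_le_div_of_nonneg_left (abs_nonneg _) hε hB
  · rw [abs_div, abs_mul, abs_of_pos (mul_pos hB0 hB0'), abs_sub_comm B' B]
    refine div_le_div₀ (by positivity) (mul_le_mul_of_nonneg_right hA' (abs_nonneg _))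
      (by positivity) ?_
    rw [sq]
    exact mul_le_mul hB hB' hε.le hB0.le

theorem antitoneOn_Icc_of_hasDerivAt {f f' : ℝ → ℝ} {a b : ℝ} (hc : ContinuousOn f (Icc a b))
    (hd : ∀ x ∈ Ioo a b, HasDerivAt f (f' x) x) (h0 : ∀ x ∈ Ioo a b, f' x ≤ 0) :
    AntitoneOn f (Icc a b) :=
  antitoneOn_of_hasDerivWithinAt_nonpos (convex_Icc a b) hc
    (by rw [interior_Icc]; exact fun x hx => (hd x hx).hasDerivWithinAt)
    (by rw [interior_Icc]; exact h0)

theorem monotoneOn_Icc_of_hasDerivAt {f f' : ℝ → ℝ} {a b : ℝ} (hc : ContinuousOn f (Icc a b))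
    (hd : ∀ x ∈ Ioo a b, HasDerivAt f (f' x) x) (h0 : ∀ x ∈ Ioo a b, 0 ≤ f' x) :
    MonotoneOn f (Icc a b) :=
  monotoneOn_of_hasDerivWithinAt_nonneg (convex_Icc a b) hc
    (by rw [interior_Icc]; exact fun x hx => (hd x hx).hasDerivWithinAt)
    (by rw [interior_Icc]; exact h0)

/-- Capping $r$ at $R$ in the exponential and the denominator from below at $\varepsilon$ makes the
field bounded and globally Lipschitz in $r$, so Picard–Lindelöf covers all of $[0,1]$. -/
theorem exists_truncated_solution {c s q R ε : ℝ} {A d : ℝ → ℝ} (hc : 0 < c) (hs : 0 < s)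
    (hq : 0 < q) (hε : 0 < ε) (hA : Continuous A) (hd : Continuous d) (r₀ : ℝ) :
    ∃ r : ℝ → ℝ, r 0 = r₀ ∧ ∀ x ∈ Icc (0 : ℝ) 1, HasDerivWithinAt r
      ((A x - c * exp (s * min (r x) R) * x ^ q) /
        max (d x + c * exp (s * min (r x) R) * x ^ (q + 1)) ε) (Icc 0 1) x := by
  obtain ⟨A₀, hA₀⟩ := isCompact_Icc.exists_bound_of_continuousOn
    (hA.continuousOn (s := Icc (0 : ℝ) 1))
  have hA₀' : 0 ≤ A₀ := (norm_nonneg _).trans (hA₀ 0 (by simp))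
  set E := exp (s * R) with hE
  have hEpos : 0 < E := exp_pos _
  have hexp : ∀ y, exp (s * min y R) ≤ E := fun y =>
    exp_le_exp.2 (mul_le_mul_of_nonneg_left (min_le_right _ _) hs.le)
  have hnum : ∀ x ∈ Icc (0 : ℝ) 1, ∀ y, |A x - c * exp (s * min y R) * x ^ q| ≤ A₀ + c * E := by
    intro x hx y
    have hX : x ^ q ≤ 1 := rpow_le_one hx.1 hx.2 hq.le
    have hX0 : 0 ≤ x ^ q := rpow_nonneg hx.1 q
    refine (abs_sub _ _).trans (add_le_add (hA₀ x hx) ?_)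
    rw [abs_of_nonneg (by positivity)]
    have := mul_le_mul_of_nonneg_left (hexp y) hc.le
    exact (mul_le_of_le_one_right (by positivity) hX).trans this
  set M : ℝ := A₀ + c * E with hM
  have hM0 : 0 ≤ M := by positivity
  have hlip : ∀ y y', |exp (s * min y R) - exp (s * min y' R)| ≤ E * s * |y - y'| := by
    intro y y'
    refine (abs_exp_sub_exp_le (mul_le_mul_of_nonneg_left (min_le_right y R) hs.le)
      (mul_le_mul_of_nonneg_left (min_le_right y' R) hs.le)).trans ?_
    rw [← mul_sub, abs_mul, abs_of_pos hs, mul_assoc]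
    have := abs_min_sub_min_le_max y R y' R
    rw [sub_self, abs_zero, max_eq_left (abs_nonneg _)] at this
    gcongr
  refine exists_solution_of_lipschitz_of_bounded
    (f := fun x y => (A x - c * exp (s * min y R) * x ^ q) /
        max (d x + c * exp (s * min y R) * x ^ (q + 1)) ε)
    (L := ⟨M / ε, by positivity⟩)
    (K := ⟨(c / ε + M * c / ε ^ 2) * (E * s), by positivity⟩) ?_ ?_ ?_ r₀
  · intro x hx
    refine LipschitzWith.of_dist_le_mul fun y y' => ?_
    rw [Real.dist_eq, Real.dist_eq]
    have hX : x ^ q ≤ 1 := rpow_le_one hx.1 hx.2 hq.le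
    have hX0 : 0 ≤ x ^ q := rpow_nonneg hx.1 q
    have hY : x ^ (q + 1) ≤ 1 := rpow_le_one hx.1 hx.2 (by linarith)
    have hY0 : 0 ≤ x ^ (q + 1) := rpow_nonneg hx.1 _
    refine (abs_div_sub_div_le hε (le_max_right _ _) (le_max_right _ _) (hnum x hx y')).trans ?_
    set e := exp (s * min y R)
    set e' := exp (s * min y' R)
    have h1 : |A x - c * e * x ^ q - (A x - c * e' * x ^ q)| ≤ c * |e - e'| := by
      rw [show A x - c * e * x ^ q - (A x - c * e' * x ^ q) = -(c * x ^ q * (e - e')) by ring,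
        abs_neg, abs_mul, abs_of_nonneg (by positivity)]
      exact mul_le_mul_of_nonneg_right (mul_le_of_le_one_right hc.le hX) (abs_nonneg _)
    have h2 : |max (d x + c * e * x ^ (q + 1)) ε - max (d x + c * e' * x ^ (q + 1)) ε| ≤
        c * |e - e'| := by
      have := abs_max_sub_max_le_max (d x + c * e * x ^ (q + 1)) ε (d x + c * e' * x ^ (q + 1)) ε
      rw [sub_self, abs_zero] at this
      refine this.trans (max_le ?_ (by positivity))
      rw [show d x + c * e * x ^ (q + 1) - (d x + c * e' * x ^ (q + 1)) =
        c * x ^ (q + 1) * (e - e') by ring, abs_mul, abs_of_nonneg (by positivity)]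
      exact mul_le_mul_of_nonneg_right (mul_le_of_le_one_right hc.le hY) (abs_nonneg _)
    have h3 := hlip y y'
    change _ ≤ (c / ε + M * c / ε ^ 2) * (E * s) * |y - y'|
    calc _ ≤ c * |e - e'| / ε + M * (c * |e - e'|) / ε ^ 2 := by gcongr
      _ = (c / ε + M * c / ε ^ 2) * |e - e'| := by ring
      _ ≤ (c / ε + M * c / ε ^ 2) * (E * s * |y - y'|) := by gcongr
      _ = _ := by ring
  · intro y
    have h1 : Continuous (fun x : ℝ => x ^ q) := Real.continuous_rpow_const hq.le
    have h2 : Continuous (fun x : ℝ => x ^ (q + 1)) := Real.continuous_rpow_const (by linarith)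
    refine Continuous.continuousOn (Continuous.div (by fun_prop) (by fun_prop) fun x => ?_)
    exact (hε.trans_le (le_max_right _ _)).ne'
  · intro x hx y
    change _ ≤ M / ε
    have hB : ε ≤ max (d x + c * exp (s * min y R) * x ^ (q + 1)) ε := le_max_right _ _
    rw [abs_div, abs_of_pos (hε.trans_le hB)]
    exact div_le_div₀ hM0 (hnum x hx y) hε hB

/-- Solutions on `[0, 1]` of the equation for `r` in polar coordinates, starting at `r₀`. -/
structure PolarSolution (p β s r₀ : ℝ) (r : ℝ → ℝ) : Prop where
  init : r 0 = r₀
  deriv : ∀ x ∈ Icc (0 : ℝ) 1, HasDerivWithinAt r (polarField p β s 1 x (r x)) (Icc 0 1) x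
  pos : ∀ x ∈ Icc (0 : ℝ) 1, 0 < polarSpeed p β s 1 x (r x)

theorem exists_initial_interval {p β : ℝ} (hp : 1 < p) (hβ : 0 < β) :
    ∃ x₁ : ℝ, 0 < x₁ ∧ x₁ ≤ 1 ∧ ∀ x, 0 ≤ x → x ≤ x₁ →
      (p - 1) * β ^ 2 / 2 ≤ (p - 1) * β ^ 2 + (p - 2) * β * x ^ 2 := by
  have hp1 := sub_pos.2 hp
  set δ := (p - 1) * β ^ 2 / 2 with hδ
  have hδ0 : 0 < δ := by positivity
  refine ⟨min 1 (δ / (|p - 2| * β + 1)), by positivity, min_le_left _ _, fun x h0 hx => ?_⟩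
  have h1 : x ≤ 1 := hx.trans (min_le_left _ _)
  have h2 := hx.trans (min_le_right _ _)
  rw [le_div_iff₀ (by positivity)] at h2
  have h3 : x ^ 2 ≤ x := by nlinarith
  have h4 : -(|p - 2| * β * x ^ 2) ≤ (p - 2) * β * x ^ 2 := by
    have := mul_le_mul_of_nonneg_right (neg_abs_le (p - 2)) (by positivity : 0 ≤ β * x ^ 2)
    linarith
  have h5 : |p - 2| * β * x ^ 2 ≤ |p - 2| * β * x :=
    mul_le_mul_of_nonneg_left h3 (by positivity)
  have h6 : (p - 1) * β ^ 2 = 2 * δ := by rw [hδ]; ring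
  linarith

/-- The truncations turn out inactive. The cap is, by the slope bound $|\alpha|/\varepsilon$. For
the denominator $D=d+Z$ the danger is that $d$ may become negative when $\beta$ is not admissible.
But $r+\log x$ increases, so $Z$ stays above a positive $Z_1$ on $[x_1,1]$, and its growth rate
becomes of order $1/\varepsilon$ when $D$ is as small as $\varepsilon$. This outweighs the bounded
decrease of $d$. -/
theorem exists_polarSolution {p β s : ℝ} (hp : 1 < p) (hβ : 0 < β) (hs : 0 < s) (r₀ : ℝ) :
    ∃ r, PolarSolution p β s r₀ r := by
  have hp1 := sub_pos.2 hp
  obtain ⟨x₁, hx0, hx1, hdx⟩ := exists_initial_interval hp hβ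
  set δ := (p - 1) * β ^ 2 / 2 with hδ
  have hδ0 : 0 < δ := by positivity
  set c := β ^ (2 - p) with hc
  have hc0 : 0 < c := by positivity
  set α := (2 - p) * β * (1 + β) with hα
  set q := p + s - 1 with hq
  have hq0 : 0 < q := by linarith
  set d : ℝ → ℝ := fun x => (p - 1) * β ^ 2 + (p - 2) * β * x ^ 2 with hd
  set C₁ := (|α| + c * exp (s * (r₀ + |α| / δ))) / δ with hC₁
  set Z₁ := c * exp (s * (r₀ - C₁)) * x₁ ^ (q + 1) with hZ₁
  have hZ₁0 : 0 < Z₁ := by positivity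
  set m := min 1 (p - 1) with hm
  have hm0 : 0 < m := lt_min one_pos hp1
  -- So small that at $D=\varepsilon$ the growth $Z_1s\beta^2m/\varepsilon$ of $Z$ exceeds
  -- $2|p-2|\beta$, a bound for $|d'|$ on $[0,1]$.
  set ε := min δ (Z₁ * (s * (β ^ 2 * m)) / (2 * |p - 2| * β + 1)) with hε
  have hε0 : 0 < ε := by positivity
  have hεδ : ε ≤ δ := min_le_left _ _
  have hεb : 2 * |p - 2| * β < Z₁ * (s * (β ^ 2 * m)) / ε := by
    rw [lt_div_iff₀ hε0]
    have h1 : ε ≤ _ := min_le_right _ _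
    rw [le_div_iff₀ (by positivity)] at h1
    nlinarith
  obtain ⟨r, hr0, hr⟩ := exists_truncated_solution (c := c) (s := s) (q := q)
    (R := r₀ + |α| / ε) (A := fun x => α * x) (d := d) hc0 hs hq0 hε0 (by fun_prop)
    (by fun_prop) r₀
  have hrc : ContinuousOn r (Icc 0 1) := fun x hx => (hr x hx).continuousWithinAt
  have hαx : ∀ x ∈ Icc (0 : ℝ) 1, α * x ≤ |α| := fun x hx =>
    (mul_le_mul_of_nonneg_right (le_abs_self α) hx.1).trans
      (mul_le_of_le_one_right (abs_nonneg _) hx.2)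
  have hαx' : ∀ x ∈ Icc (0 : ℝ) 1, -|α| ≤ α * x := fun x hx => by
    have h1 := mul_le_mul_of_nonneg_right (neg_abs_le α) hx.1
    have h2 := mul_le_of_le_one_right (abs_nonneg α) hx.2
    linarith
  have hrd0 : ∀ x ∈ Ioo (0 : ℝ) 1, HasDerivAt r _ x := fun x hx =>
    (hr x (Ioo_subset_Icc_self hx)).hasDerivAt (Icc_mem_nhds hx.1 hx.2)
  have hrR : ∀ x ∈ Icc (0 : ℝ) 1, r x ≤ r₀ + |α| / ε := by
    intro x hx
    have hanti : AntitoneOn (fun x => r x - |α| / ε * x) (Icc 0 1) := by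
      refine antitoneOn_Icc_of_hasDerivAt (by fun_prop)
        (fun x hx => (hrd0 x hx).sub ((hasDerivAt_id x).const_mul _)) fun x hx => ?_
      have hx' := Ioo_subset_Icc_self hx
      rw [mul_one, sub_nonpos]
      have hX0 : 0 ≤ x ^ q := rpow_nonneg hx.1.le q
      refine div_le_div₀ (abs_nonneg _) ?_ hε0 (le_max_right _ _)
      have : 0 ≤ c * exp (s * min (r x) (r₀ + |α| / ε)) * x ^ q := by positivity
      linarith [hαx x hx']
    have := hanti (left_mem_Icc.2 zero_le_one) hx hx.1
    simp only [hr0, mul_zero, sub_zero] at this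
    have h2 : |α| / ε * x ≤ |α| / ε := mul_le_of_le_one_right (by positivity) hx.2
    linarith
  have hr' : ∀ x ∈ Icc (0 : ℝ) 1, HasDerivWithinAt r ((α * x - c * exp (s * r x) * x ^ q) /
        max (d x + c * exp (s * r x) * x ^ (q + 1)) ε) (Icc 0 1) x := by
    intro x hx
    have := hr x hx
    rwa [min_eq_left (hrR x hx)] at this
  have hrd : ∀ x ∈ Ioo (0 : ℝ) 1, HasDerivAt r ((α * x - c * exp (s * r x) * x ^ q) /
        max (d x + c * exp (s * r x) * x ^ (q + 1)) ε) x := fun x hx =>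
    (hr' x (Ioo_subset_Icc_self hx)).hasDerivAt (Icc_mem_nhds hx.1 hx.2)
  set D : ℝ → ℝ := fun x => d x + c * exp (s * r x) * x ^ (q + 1) with hD
  have hZnn : ∀ x, 0 ≤ x → 0 ≤ c * exp (s * r x) * x ^ (q + 1) := fun x hx => by positivity
  have hDδ : ∀ x ∈ Icc 0 x₁, δ ≤ D x := fun x hx => by
    have := hdx x hx.1 hx.2
    have := hZnn x hx.1
    simp only [hD, hd]
    linarith
  have hrδ : ∀ x ∈ Icc 0 x₁, r x ≤ r₀ + |α| / δ := by
    intro x hx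
    have hanti : AntitoneOn (fun x => r x - |α| / δ * x) (Icc 0 x₁) := by
      refine antitoneOn_Icc_of_hasDerivAt
        ((hrc.mono (Icc_subset_Icc_right hx1)).sub (by fun_prop))
        (fun x hx => (hrd x ⟨hx.1, hx.2.trans_le hx1⟩).sub ((hasDerivAt_id x).const_mul _))
        fun x hx => ?_
      have hx' : x ∈ Icc (0 : ℝ) 1 := ⟨hx.1.le, hx.2.le.trans hx1⟩
      rw [mul_one, sub_nonpos]
      have hX0 : 0 ≤ x ^ q := rpow_nonneg hx.1.le q
      refine div_le_div₀ (abs_nonneg _) ?_ hδ0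
        ((hDδ x (Ioo_subset_Icc_self hx)).trans (le_max_left _ _))
      have : 0 ≤ c * exp (s * r x) * x ^ q := by positivity
      linarith [hαx x hx']
    have := hanti (left_mem_Icc.2 hx0.le) hx hx.1
    simp only [hr0, mul_zero, sub_zero] at this
    have h2 : |α| / δ * x ≤ |α| / δ := mul_le_of_le_one_right (by positivity) (hx.2.trans hx1)
    linarith
  have hrlow : r₀ - C₁ ≤ r x₁ := by
    have hmono : MonotoneOn (fun x => r x + C₁ * x) (Icc 0 x₁) := by
      refine monotoneOn_Icc_of_hasDerivAt
        ((hrc.mono (Icc_subset_Icc_right hx1)).add (by fun_prop))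
        (fun x hx => (hrd x ⟨hx.1, hx.2.trans_le hx1⟩).add ((hasDerivAt_id x).const_mul _))
        fun x hx => ?_
      have hx' : x ∈ Icc (0 : ℝ) 1 := ⟨hx.1.le, hx.2.le.trans hx1⟩
      have hB := (hDδ x (Ioo_subset_Icc_self hx)).trans (le_max_left _ ε)
      have hX0 : 0 ≤ x ^ q := rpow_nonneg hx.1.le q
      have hX : x ^ q ≤ 1 := rpow_le_one hx'.1 hx'.2 hq0.le
      have h1 : c * exp (s * r x) * x ^ q ≤ c * exp (s * (r₀ + |α| / δ)) := by
        refine (mul_le_of_le_one_right (by positivity) hX).trans ?_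
        have := hrδ x (Ioo_subset_Icc_self hx)
        gcongr
      have h2 : -C₁ ≤ (α * x - c * exp (s * r x) * x ^ q) / max (D x) ε := by
        rw [hC₁, ← neg_div, neg_add]
        rw [div_le_div_iff₀ hδ0 (hδ0.trans_le hB)]
        have h3 : -|α| + -(c * exp (s * (r₀ + |α| / δ))) ≤ α * x - c * exp (s * r x) * x ^ q := by
          linarith [hαx' x hx']
        have h4 : -|α| + -(c * exp (s * (r₀ + |α| / δ))) ≤ 0 := by
          have : 0 ≤ c * exp (s * (r₀ + |α| / δ)) := by positivity
          linarith [abs_nonneg α]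
        nlinarith
      simp only [hD] at h2
      linarith
    have := hmono (left_mem_Icc.2 hx0.le) (right_mem_Icc.2 hx0.le) hx0.le
    simp only [hr0, mul_zero, add_zero] at this
    have h2 : C₁ * x₁ ≤ C₁ := mul_le_of_le_one_right (by positivity) hx1
    linarith
  -- From $\beta^2\varphi=\alpha x^2+d$; the inequality becomes an equality once the truncation is
  -- known to be inactive.
  have hgrow : ∀ x ∈ Ioo (0 : ℝ) 1, β ^ 2 * phi p x / (x * max (D x) ε) ≤
      (α * x - c * exp (s * r x) * x ^ q) / max (D x) ε + x⁻¹ := by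
    intro x hx
    have hB : 0 < max (D x) ε := hε0.trans_le (le_max_right _ _)
    have h1 : D x ≤ max (D x) ε := le_max_left _ _
    have h2 : x ^ (q + 1) = x ^ q * x := rpow_add_one hx.1.ne' q
    have h3 : β ^ 2 * phi p x = α * x * x + d x := by
      simp only [hα, hd, phi]; ring
    have h4 : (α * x - c * exp (s * r x) * x ^ q) / max (D x) ε + x⁻¹ =
        ((α * x - c * exp (s * r x) * x ^ q) * x + max (D x) ε) / (x * max (D x) ε) := by
      have := hx.1
      field_simp
    rw [h4]
    refine div_le_div_of_nonneg_right ?_ (mul_pos hx.1 hB).le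
    have h5 : D x = d x + c * exp (s * r x) * (x ^ q * x) := by simp only [hD, h2]
    linarith
  have hZ : ∀ x ∈ Icc x₁ 1, Z₁ ≤ c * exp (s * r x) * x ^ (q + 1) := by
    intro x hx
    have hmono : MonotoneOn (fun x => r x + log x) (Icc x₁ 1) := by
      refine monotoneOn_Icc_of_hasDerivAt
        ((hrc.mono (Icc_subset_Icc_left hx0.le)).add
          (continuousOn_log.mono fun x hx => (hx0.trans_le hx.1).ne'))
        (fun x hx => (hrd x ⟨hx0.trans hx.1, hx.2⟩).add (hasDerivAt_log (hx0.trans hx.1).ne'))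
        fun x hx => ?_
      have hx' : x ∈ Ioo (0 : ℝ) 1 := ⟨hx0.trans hx.1, hx.2⟩
      refine le_trans ?_ (hgrow x hx')
      have := phi_pos (x := x) hp (pow_le_one₀ hx'.1.le hx'.2.le)
      have := hx'.1
      positivity
    have h1 := hmono (left_mem_Icc.2 hx1) hx hx.1
    have hxpos : 0 < x := hx0.trans_le hx.1
    have h2 : ∀ y, 0 < y → exp (s * r y) * y ^ (q + 1) = exp (s * (r y + log y)) * y ^ p := by
      intro y hy
      rw [mul_add, exp_add, mul_assoc, mul_comm s (log y), ← rpow_def_of_pos hy, ← rpow_add hy]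
      congr 2
      rw [hq]; ring
    have h3 : exp (s * (r₀ - C₁)) * x₁ ^ (q + 1) ≤ exp (s * r x₁) * x₁ ^ (q + 1) := by
      gcongr
    rw [hZ₁, mul_assoc, mul_assoc]
    refine mul_le_mul_of_nonneg_left (h3.trans ?_) hc0.le
    rw [h2 _ hx0, h2 _ hxpos]
    have h4 : x₁ ^ p ≤ x ^ p := rpow_le_rpow hx0.le hx.1 (by linarith)
    gcongr
  have hDε : ∀ x ∈ Icc x₁ 1, ε ≤ D x := by
    have hDd : ∀ x ∈ Ico x₁ 1, HasDerivAt D ((p - 2) * β * (2 * x) +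
        ((c * (exp (s * r x) * (s * ((α * x - c * exp (s * r x) * x ^ q) / max (D x) ε)))) *
          x ^ (q + 1) + c * exp (s * r x) * ((q + 1) * x ^ q))) x := by
      intro x hx
      have hx' : x ∈ Ioo (0 : ℝ) 1 := ⟨hx0.trans_le hx.1, hx.2⟩
      have h1 := (((hrd x hx').const_mul s).exp.const_mul c).mul
        (Real.hasDerivAt_rpow_const (p := q + 1) (Or.inl hx'.1.ne'))
      have h2 : HasDerivAt d ((p - 2) * β * (2 * x)) x := by
        exact (((hasDerivAt_pow 2 x).const_mul ((p - 2) * β)).const_add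
          ((p - 1) * β ^ 2)).congr_deriv (by simp)
      refine (h2.add h1).congr_deriv ?_
      rw [add_sub_cancel_right]
    have hDc : ContinuousOn D (Icc x₁ 1) := by
      have h1 : Continuous (fun x : ℝ => x ^ (q + 1)) := Real.continuous_rpow_const (by linarith)
      have h2 := hrc.mono (Icc_subset_Icc_left hx0.le)
      simp only [hD, hd]
      fun_prop
    -- The level $\varepsilon$ can only be crossed upwards by $D$.
    have hfence := image_le_of_deriv_right_lt_deriv_boundary (f := fun x => -D x)
      (B := fun _ => -ε) (B' := fun _ => 0) (a := x₁) (b := 1) hDc.neg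
      (fun x hx => (hDd x hx).neg.hasDerivWithinAt)
      (neg_le_neg (hεδ.trans (hDδ x₁ (right_mem_Icc.2 hx0.le)))) (fun x => hasDerivAt_const _ _)
      (fun x hx hxe => by
        have hx' : x ∈ Ioo (0 : ℝ) 1 := ⟨hx0.trans_le hx.1, hx.2⟩
        have hxe' : D x = ε := by linarith
        have h1 := hgrow x hx'
        have h2 := hZ x (Ico_subset_Icc_self hx)
        rw [hxe', max_self] at h1 ⊢
        set F := (α * x - c * exp (s * r x) * x ^ q) / ε
        have hxp := hx'.1
        have h3 : x ^ q = x ^ (q + 1) * x⁻¹ := by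
          rw [rpow_add_one hxp.ne']; field_simp
        set Z := c * exp (s * r x) * x ^ (q + 1) with hZdef
        have h4 : c * (exp (s * r x) * (s * F)) * x ^ (q + 1) +
            c * exp (s * r x) * ((q + 1) * x ^ q) = Z * (s * (F + x⁻¹) + p * x⁻¹) := by
          rw [h3, hZdef, hq]; ring
        rw [h4]
        have h5 : β ^ 2 * m / ε ≤ β ^ 2 * phi p x / (x * ε) := by
          refine div_le_div₀ ?_ ?_ (by positivity) (mul_le_of_le_one_left hε0.le hx'.2.le)
          · have := phi_pos (x := x) hp (pow_le_one₀ hx'.1.le hx'.2.le)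
            positivity
          · exact mul_le_mul_of_nonneg_left (phi_ge (pow_le_one₀ hx'.1.le hx'.2.le)) (by positivity)
        have h6 : s * (β ^ 2 * m / ε) ≤ s * (F + x⁻¹) + p * x⁻¹ := by
          have : 0 ≤ p * x⁻¹ := by positivity
          have := mul_le_mul_of_nonneg_left (h5.trans h1) hs.le
          linarith
        have h7 : Z₁ * (s * (β ^ 2 * m / ε)) ≤ Z * (s * (F + x⁻¹) + p * x⁻¹) :=
          mul_le_mul h2 h6 (by positivity) (hZ₁0.le.trans h2)
        have h8 : Z₁ * (s * (β ^ 2 * m / ε)) = Z₁ * (s * (β ^ 2 * m)) / ε := by ring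
        have h9 : -(2 * |p - 2| * β) ≤ (p - 2) * β * (2 * x) := by
          have e1 := mul_le_mul_of_nonneg_right (neg_abs_le (p - 2))
            (by positivity : 0 ≤ β * (2 * x))
          have e2 : |p - 2| * (β * (2 * x)) ≤ |p - 2| * (β * 2) := by
            have := hx'.2.le
            gcongr
            linarith
          linarith
        linarith)
    intro x hx
    linarith [hfence hx]
  have hDall : ∀ x ∈ Icc (0 : ℝ) 1, ε ≤ D x := by
    intro x hx
    rcases le_total x x₁ with h | h
    · exact hεδ.trans (hDδ x ⟨hx.1, h⟩)
    · exact hDε x ⟨h, hx.2⟩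
  have hDeq : ∀ x, polarSpeed p β s 1 x (r x) = D x := by
    intro x
    simp only [polarSpeed, hD, hd, hq, hc]
    rw [one_mul, sub_add_cancel]
  refine ⟨r, hr0, fun x hx => ?_, fun x hx => ?_⟩
  · have := hr' x hx
    change HasDerivWithinAt r ((α * x - c * exp (s * r x) * x ^ q) / max (D x) ε) _ _ at this
    rw [max_eq_left (hDall x hx)] at this
    rw [polarField, hDeq, one_mul]
    exact this
  · rw [hDeq]
    exact hε0.trans_le (hDall x hx)

end SectorODE

/-! ### Shooting: the travel time as a function of the initial radius -/

namespace SectorODE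
open Set Filter Topology Real MeasureTheory

/-- After cross-multiplication all that remains is the increment of the exponential term times
$\beta^2\varphi>0$. No sign of the numerator is needed. -/
theorem polarField_le_polarField {p β s x r r' : ℝ} (hp : 1 < p) (hβ : 0 < β)
    (hs : 0 < s) (hx : x ∈ Icc (0 : ℝ) 1) (h : 0 < polarSpeed p β s 1 x r)
    (h' : 0 < polarSpeed p β s 1 x r') (hr : r ≤ r') :
    polarField p β s 1 x r' ≤ polarField p β s 1 x r := by
  have hX : x ^ (p + s) = x ^ (p + s - 1) * x := by
    rw [← rpow_add_one' hx.1 (by linarith), sub_add_cancel]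
  have hX0 : 0 ≤ x ^ (p + s - 1) := rpow_nonneg hx.1 _
  have he : exp (s * r) ≤ exp (s * r') := by gcongr
  have hc : 0 < β ^ (2 - p) := by positivity
  have hφ := phi_pos (x := x) hp (pow_le_one₀ hx.1 hx.2)
  rw [polarField, polarField, div_le_div_iff₀ h' h]
  unfold polarSpeed
  rw [hX]
  have h1 : β ^ 2 * phi p x = (2 - p) * β * (1 + β) * x ^ 2 +
    ((p - 1) * β ^ 2 + (p - 2) * β * x ^ 2) := by unfold phi; ring
  have h2 : 0 ≤ β ^ (2 - p) * x ^ (p + s - 1) * (exp (s * r') - exp (s * r)) *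
      (β ^ 2 * phi p x) := by
    have := sub_nonneg.2 he
    positivity
  rw [h1] at h2
  linarith

theorem polarField_add_inv {p β s x r : ℝ} (hx : 0 < x) (h : 0 < polarSpeed p β s 1 x r) :
    polarField p β s 1 x r + x⁻¹ = β ^ 2 * phi p x / (x * polarSpeed p β s 1 x r) := by
  have hX : x ^ (p + s) = x ^ (p + s - 1) * x := by
    rw [← rpow_add_one hx.ne', sub_add_cancel]
  rw [polarField]
  have : polarSpeed p β s 1 x r = (p - 1) * β ^ 2 + (p - 2) * β * x ^ 2 +
    1 * (β ^ (2 - p) * exp (s * r) * (x ^ (p + s - 1) * x)) := by rw [polarSpeed, hX]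
  field_simp
  rw [this, phi]
  ring

/-- The time density of a trajectory in the angular variable. -/
noncomputable def polarDensity (p β s : ℝ) (r : ℝ → ℝ) (ψ : ℝ) : ℝ :=
  β * phi p |sin ψ| / polarSpeed p β s 1 |sin ψ| (r |sin ψ|)

/-- The time a trajectory needs to go from one boundary point to the other. -/
noncomputable def polarTime (p β s : ℝ) (r : ℝ → ℝ) : ℝ :=
  ∫ ψ in (0 : ℝ)..π, polarDensity p β s r ψ

theorem abs_sin_mem (ψ : ℝ) : |sin ψ| ∈ Icc (0 : ℝ) 1 := ⟨abs_nonneg _, abs_sin_le_one ψ⟩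

theorem phi_abs_sin_pos {p : ℝ} (hp : 1 < p) (ψ : ℝ) : 0 < phi p |sin ψ| :=
  phi_pos hp (by rw [sq_abs]; exact sin_sq_le_one ψ)

namespace PolarSolution
variable {p β s r₀ : ℝ} {r : ℝ → ℝ}

theorem continuousOn (h : PolarSolution p β s r₀ r) : ContinuousOn r (Icc 0 1) :=
  fun x hx => (h.deriv x hx).continuousWithinAt

theorem hasDerivAt (h : PolarSolution p β s r₀ r) {x : ℝ} (hx : x ∈ Ioo (0 : ℝ) 1) :
    HasDerivAt r (polarField p β s 1 x (r x)) x :=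
  (h.deriv x (Ioo_subset_Icc_self hx)).hasDerivAt (Icc_mem_nhds hx.1 hx.2)

theorem continuous_polarDensity (h : PolarSolution p β s r₀ r) (hp : 1 < p) (hs : 0 < s) :
    Continuous (polarDensity p β s r) := by
  have h1 : ContinuousOn (fun x => β * phi p x / polarSpeed p β s 1 x (r x)) (Icc 0 1) := by
    refine ContinuousOn.div ?_ (continuousOn_polarSpeed (by linarith) h.continuousOn)
      fun x hx => (h.pos x hx).ne'
    unfold phi
    fun_prop
  exact h1.comp_continuous (continuous_sin.abs) abs_sin_mem

theorem polarDensity_pos (h : PolarSolution p β s r₀ r) (hp : 1 < p) (hβ : 0 < β) (ψ : ℝ) :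
    0 < polarDensity p β s r ψ :=
  div_pos (mul_pos hβ (phi_abs_sin_pos hp ψ)) (h.pos _ (abs_sin_mem ψ))

/-- The field decreases in $r$, so the squared distance of two solutions decreases. This yields
uniqueness and nonexpansive dependence on the initial value. -/
theorem abs_sub_le (h : PolarSolution p β s r₀ r) {r₀' : ℝ} {r' : ℝ → ℝ}
    (h' : PolarSolution p β s r₀' r') (hp : 1 < p) (hβ : 0 < β) (hs : 0 < s) {x : ℝ}
    (hx : x ∈ Icc (0 : ℝ) 1) : |r x - r' x| ≤ |r₀ - r₀'| := by
  have hanti : AntitoneOn (fun x => (r x - r' x) ^ 2) (Icc 0 1) := by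
    refine antitoneOn_Icc_of_hasDerivAt ((h.continuousOn.sub h'.continuousOn).pow 2)
      (fun x hx => ((h.hasDerivAt hx).sub (h'.hasDerivAt hx)).pow 2) fun x hx => ?_
    have hx' := Ioo_subset_Icc_self hx
    simp only [Nat.cast_ofNat, Nat.add_one_sub_one, pow_one, Pi.sub_apply]
    rcases le_total (r x) (r' x) with hle | hle
    · have := polarField_le_polarField hp hβ hs hx' (h.pos x hx') (h'.pos x hx') hle
      nlinarith
    · have := polarField_le_polarField hp hβ hs hx' (h'.pos x hx') (h.pos x hx') hle
      nlinarith
  have := hanti (left_mem_Icc.2 zero_le_one) hx hx.1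
  simp only [h.init, h'.init] at this
  exact sq_le_sq.1 this

theorem le_of_initial (h : PolarSolution p β s r₀ r) (hβ : 0 < β) {δ x₁ : ℝ} (hδ : 0 < δ)
    (hx₁ : x₁ ≤ 1) (hd : ∀ x, 0 ≤ x → x ≤ x₁ → δ ≤ (p - 1) * β ^ 2 + (p - 2) * β * x ^ 2) {x : ℝ}
    (hx : x ∈ Icc 0 x₁) :
    δ ≤ polarSpeed p β s 1 x (r x) ∧ r x ≤ r₀ + |(2 - p) * β * (1 + β)| / δ := by
  set α := (2 - p) * β * (1 + β)
  have hD : ∀ x ∈ Icc 0 x₁, δ ≤ polarSpeed p β s 1 x (r x) := by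
    intro x hx
    have h1 := hd x hx.1 hx.2
    have hx0 := hx.1
    have h2 : 0 ≤ 1 * (β ^ (2 - p) * exp (s * r x) * x ^ (p + s)) := by positivity
    unfold polarSpeed
    linarith
  refine ⟨hD x hx, ?_⟩
  have hanti : AntitoneOn (fun x => r x - |α| / δ * x) (Icc 0 x₁) := by
    refine antitoneOn_Icc_of_hasDerivAt
      ((h.continuousOn.mono (Icc_subset_Icc_right hx₁)).sub (by fun_prop))
      (fun x hx => (h.hasDerivAt ⟨hx.1, hx.2.trans_le hx₁⟩).sub
        ((hasDerivAt_id x).const_mul _)) fun x hx => ?_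
    rw [mul_one, sub_nonpos]
    have hx0 := hx.1
    refine div_le_div₀ (abs_nonneg _) ?_ hδ (hD x (Ioo_subset_Icc_self hx))
    have h1 : 0 ≤ 1 * (β ^ (2 - p) * exp (s * r x) * x ^ (p + s - 1)) := by positivity
    have h2 : α * x ≤ |α| := (mul_le_mul_of_nonneg_right (le_abs_self α) hx0.le).trans
      (mul_le_of_le_one_right (abs_nonneg _) (hx.2.le.trans hx₁))
    linarith
  have := hanti (left_mem_Icc.2 (hx.1.trans hx.2)) hx hx.1
  simp only [h.init, mul_zero, sub_zero] at this
  have h2 : |α| / δ * x ≤ |α| / δ := mul_le_of_le_one_right (by positivity) (hx.2.trans hx₁)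
  linarith

theorem monotoneOn_log (h : PolarSolution p β s r₀ r) (hp : 1 < p) {x₀ : ℝ} (hx₀ : 0 < x₀) :
    MonotoneOn (fun x => r x + log x) (Icc x₀ 1) := by
  refine monotoneOn_Icc_of_hasDerivAt
    ((h.continuousOn.mono (Icc_subset_Icc_left hx₀.le)).add
      (continuousOn_log.mono fun x hx => (hx₀.trans_le hx.1).ne'))
    (fun x hx => (h.hasDerivAt ⟨hx₀.trans hx.1, hx.2⟩).add
      (hasDerivAt_log (hx₀.trans hx.1).ne')) fun x hx => ?_
  have hx' : x ∈ Ioo (0 : ℝ) 1 := ⟨hx₀.trans hx.1, hx.2⟩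
  have h1 := h.pos x (Ioo_subset_Icc_self hx')
  rw [polarField_add_inv hx'.1 h1]
  have := phi_pos (x := x) hp (pow_le_one₀ hx'.1.le hx'.2.le)
  have := hx'.1
  positivity

end PolarSolution

theorem exp_mul_rpow_eq {p s x r : ℝ} (hx : 0 < x) :
    exp (s * r) * x ^ (p + s) = exp (s * (r + log x)) * x ^ p := by
  rw [mul_add, exp_add, mul_assoc, mul_comm s (log x), ← rpow_def_of_pos hx, ← rpow_add hx,
    add_comm s]

/-- Dominated convergence; it needs a lower bound on the speed near $r_0$. A shift of the initial
value by $h$ reduces the exponential term at most by the factor $e^{-s|h|}$, so half of the minimal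
speed at $r_0$ survives for small $h$. -/
theorem continuous_polarTime {p β s : ℝ} {r : ℝ → ℝ → ℝ} (hp : 1 < p) (hβ : 0 < β) (hs : 0 < s)
    (hr : ∀ r₀, PolarSolution p β s r₀ (r r₀)) : Continuous (fun r₀ => polarTime p β s (r r₀)) := by
  refine continuous_iff_continuousAt.2 fun r₀ => ?_
  have hc0 : 0 < β ^ (2 - p) := by positivity
  have hDc := continuousOn_polarSpeed (p := p) (β := β) (s := s) (κ := 1) (by linarith)
    (hr r₀).continuousOn
  obtain ⟨x₀, hx₀, hmin⟩ := isCompact_Icc.exists_isMinOn (nonempty_Icc.2 zero_le_one) hDc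
  set ε := polarSpeed p β s 1 x₀ (r r₀ x₀) with hε
  have hε0 : 0 < ε := (hr r₀).pos x₀ hx₀
  have hZc : ContinuousOn (fun x => β ^ (2 - p) * exp (s * r r₀ x) * x ^ (p + s)) (Icc 0 1) := by
    have h1 : Continuous (fun x : ℝ => x ^ (p + s)) := Real.continuous_rpow_const (by linarith)
    have h2 := (hr r₀).continuousOn
    fun_prop
  obtain ⟨Z, hZ⟩ := isCompact_Icc.bddAbove_image hZc
  have hcont : ContinuousAt (fun y => Z * (1 - exp (-(s * |r₀ - y|)))) r₀ := by fun_prop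
  have hev : ∀ᶠ y in 𝓝 r₀, Z * (1 - exp (-(s * |r₀ - y|))) < ε / 2 := by
    refine hcont.eventually (eventually_lt_nhds ?_)
    simp only [sub_self, abs_zero, mul_zero, neg_zero, exp_zero]
    linarith
  have hlow : ∀ᶠ y in 𝓝 r₀, ∀ x ∈ Icc (0 : ℝ) 1, ε / 2 ≤ polarSpeed p β s 1 x (r y x) := by
    filter_upwards [hev] with y hy x hx
    have h1 := (hr r₀).abs_sub_le (hr y) hp hβ hs hx
    have h2 : ε ≤ polarSpeed p β s 1 x (r r₀ x) := hmin hx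
    have h3 := hZ (mem_image_of_mem _ hx)
    have h4 : exp (-(s * |r₀ - y|)) * exp (s * r r₀ x) ≤ exp (s * r y x) := by
      rw [← exp_add]
      refine exp_le_exp.2 ?_
      have := mul_le_mul_of_nonneg_left ((le_abs_self _).trans h1) hs.le
      linarith
    have h5 : exp (-(s * |r₀ - y|)) ≤ 1 := exp_le_one_iff.2 (by
      have : 0 ≤ s * |r₀ - y| := by positivity
      linarith)
    have hx0 := hx.1
    have h6 : exp (-(s * |r₀ - y|)) * (β ^ (2 - p) * exp (s * r r₀ x) * x ^ (p + s)) ≤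
        β ^ (2 - p) * exp (s * r y x) * x ^ (p + s) := by
      calc _ = β ^ (2 - p) * (exp (-(s * |r₀ - y|)) * exp (s * r r₀ x)) * x ^ (p + s) := by ring
        _ ≤ _ := by gcongr
    have h7 := mul_le_mul_of_nonneg_right h3 (sub_nonneg.2 h5)
    unfold polarSpeed at h2 ⊢
    linarith
  have hmem : ∀ ψ, |sin ψ| ∈ Icc (0 : ℝ) 1 := abs_sin_mem
  unfold polarTime
  refine intervalIntegral.continuousAt_of_dominated_interval (bound := fun _ => β * p / (ε / 2))
    (Eventually.of_forall fun y =>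
      ((hr y).continuous_polarDensity hp hs).aestronglyMeasurable) ?_ (by simp) ?_
  · filter_upwards [hlow] with y hy
    refine Eventually.of_forall fun ψ _ => ?_
    rw [Real.norm_eq_abs, abs_of_pos ((hr y).polarDensity_pos hp hβ ψ)]
    refine div_le_div₀ (by positivity) ?_ (by positivity) (hy _ (hmem ψ))
    exact mul_le_mul_of_nonneg_left (phi_le hp (by rw [sq_abs]; exact sin_sq_le_one ψ)) hβ.le
  · refine Eventually.of_forall fun ψ _ => ?_
    have h1 : ContinuousAt (fun y => r y |sin ψ|) r₀ := by
      refine Metric.continuousAt_iff.2 fun ε hε => ⟨ε, hε, fun {y} hy => ?_⟩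
      rw [Real.dist_eq] at hy ⊢
      exact ((hr y).abs_sub_le (hr r₀) hp hβ hs (hmem ψ)).trans_lt hy
    have h2 : ContinuousAt (fun y => polarSpeed p β s 1 |sin ψ| (r y |sin ψ|)) r₀ := by
      unfold polarSpeed
      fun_prop
    exact continuousAt_const.div h2 ((hr r₀).pos _ (hmem ψ)).ne'

/-- Were the time at most $L$, then $\log u$ could grow by at most $(\beta/x_1)|L|$ from
$\sin\psi=x_1$ to the midpoint, because $\ell'=\beta\cot\psi\le\beta/x_1$ there. With $r_0$ negative
enough the nonlinear term stays below $\eta$, so the flow is no faster than the spectral flow of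
exponent $\beta'$ and the time is at least `opening p β'`, a contradiction. -/
theorem exists_polarTime_gt {p β β' s L : ℝ} (hp : 1 < p) (hβ : 0 < β) (hs : 0 < s)
    (hββ' : β < β') (hβ' : Admissible p β') (hL : L < opening p β') :
    ∃ r₀, ∀ r, PolarSolution p β s r₀ r → L < polarTime p β s r := by
  have hp1 := sub_pos.2 hp
  obtain ⟨x₁, hx0, hx1, hdx⟩ := exists_initial_interval hp hβ
  set δ := (p - 1) * β ^ 2 / 2 with hδ
  have hδ0 : 0 < δ := by positivity
  set α := (2 - p) * β * (1 + β) with hα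
  have hc0 : 0 < β ^ (2 - p) := by positivity
  -- Exactly the room between the speeds for $\beta$ and $\beta'$.
  set η := β * (p - 1) * (β' - β) with hη
  have hη0 : 0 < η := by
    have := sub_pos.2 hββ'
    positivity
  set C := |α| / δ + β / x₁ * |L| with hC
  refine ⟨log (η / β ^ (2 - p)) / s - C, fun r hr => ?_⟩
  by_contra! hT
  have hGc := hr.continuous_polarDensity hp hs
  have hG0 := hr.polarDensity_pos hp hβ
  set I : ℝ → ℝ := fun y => ∫ ψ in (0 : ℝ)..y, polarDensity p β s r ψ with hI
  have hId : ∀ y, HasDerivAt I (polarDensity p β s r y) y := fun y =>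
    (hGc.integral_hasStrictDerivAt 0 y).hasDerivAt
  have hImono : Monotone I := monotone_of_hasDerivAt_nonneg hId fun y => (hG0 y).le
  have hI0 : I 0 = 0 := by simp [hI]
  have hIπ : I π ≤ L := hT
  have hrC : ∀ x ∈ Icc (0 : ℝ) 1, r x ≤ log (η / β ^ (2 - p)) / s := by
    have hinit := fun x hx => (hr.le_of_initial hβ hδ0 hx1 hdx (x := x) hx).2
    intro x hx
    rcases le_total x x₁ with h | h
    · have := hinit x ⟨hx.1, h⟩
      have : 0 ≤ β / x₁ * |L| := by positivity
      linarith
    · have hψ1 : sin (arcsin x₁) = x₁ := sin_arcsin (by linarith) hx1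
      have hψ : sin (arcsin x) = x := sin_arcsin (by linarith [hx.1]) hx.2
      have hψ1pos : 0 < arcsin x₁ := arcsin_pos.2 hx0
      have hsin : ∀ ψ ∈ Icc (arcsin x₁) (π / 2), x₁ ≤ sin ψ := by
        intro ψ hψ
        rw [← hψ1]
        exact sin_le_sin_of_le_of_le_pi_div_two (by linarith [pi_pos]) hψ.2 hψ.1
      have hanti : AntitoneOn (fun ψ => r (sin ψ) + log (sin ψ) - β / x₁ * I ψ)
          (Icc (arcsin x₁) (π / 2)) := by
        have hder : ∀ ψ ∈ Ioo (arcsin x₁) (π / 2), sin ψ ∈ Ioo 0 1 := by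
          intro ψ hψ
          refine ⟨hx0.trans_le (hsin ψ (Ioo_subset_Icc_self hψ)), ?_⟩
          rw [← sin_pi_div_two]
          exact sin_lt_sin_of_lt_of_le_pi_div_two (by linarith [hψ.1, pi_pos]) le_rfl hψ.2
        refine antitoneOn_Icc_of_hasDerivAt ?_ (fun ψ hψ =>
          (((hr.hasDerivAt (hder ψ hψ)).comp ψ (Real.hasDerivAt_sin ψ)).add
            ((Real.hasDerivAt_sin ψ).log (hder ψ hψ).1.ne')).sub ((hId ψ).const_mul (β / x₁)))
          fun ψ hψ => ?_
        · refine ContinuousOn.sub (ContinuousOn.add ?_ ?_) ?_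
          · exact hr.continuousOn.comp continuous_sin.continuousOn fun ψ hψ =>
              ⟨hx0.le.trans (hsin ψ hψ), sin_le_one ψ⟩
          · exact continuous_sin.continuousOn.log fun ψ hψ => (hx0.trans_le (hsin ψ hψ)).ne'
          · exact fun ψ _ => ((hId ψ).const_mul _).continuousAt.continuousWithinAt
        · have hx := hder ψ hψ
          have hpos := hr.pos _ (Ioo_subset_Icc_self hx)
          have e1 : polarField p β s 1 (sin ψ) (r (sin ψ)) * cos ψ + cos ψ / sin ψ =
              (polarField p β s 1 (sin ψ) (r (sin ψ)) + (sin ψ)⁻¹) * cos ψ := by ring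
          have e2 : polarDensity p β s r ψ =
              β * phi p (sin ψ) / polarSpeed p β s 1 (sin ψ) (r (sin ψ)) := by
            rw [polarDensity, abs_of_pos hx.1]
          have e3 : β ^ 2 * phi p (sin ψ) / (sin ψ * polarSpeed p β s 1 (sin ψ) (r (sin ψ))) *
              cos ψ = β * polarDensity p β s r ψ * (cos ψ / sin ψ) := by
            rw [e2]
            have := hx.1
            field_simp
          rw [e1, polarField_add_inv hx.1 hpos, e3]
          have h3 : cos ψ / sin ψ ≤ 1 / x₁ :=
            div_le_div₀ zero_le_one (cos_le_one ψ) hx0 (hsin ψ (Ioo_subset_Icc_self hψ))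
          have h4 : 0 ≤ β * polarDensity p β s r ψ := by have := hG0 ψ; positivity
          have h5 := mul_le_mul_of_nonneg_left h3 h4
          have h6 : β * polarDensity p β s r ψ * (1 / x₁) = β / x₁ * polarDensity p β s r ψ := by
            ring
          linarith
      have hle : arcsin x₁ ≤ arcsin x := monotone_arcsin h
      have hx2 : arcsin x ≤ π / 2 := arcsin_le_pi_div_two x
      have h7 := hanti (left_mem_Icc.2 (hle.trans hx2)) ⟨hle, hx2⟩ hle
      simp only [hψ, hψ1] at h7
      have h8 : 0 ≤ I (arcsin x₁) := hI0 ▸ hImono hψ1pos.le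
      have h9 : I (arcsin x) ≤ |L| :=
        (hImono (hx2.trans (by linarith [pi_pos]))).trans (hIπ.trans (le_abs_self L))
      have h10 : log x₁ ≤ log x := log_le_log hx0 h
      have h11 := hinit x₁ (right_mem_Icc.2 hx0.le)
      have h12 : 0 ≤ β / x₁ := by positivity
      have h13 := mul_le_mul_of_nonneg_left h9 h12
      have h14 := mul_nonneg h12 h8
      linarith
  have hD : ∀ x ∈ Icc (0 : ℝ) 1, polarSpeed p β s 1 x (r x) ≤
      β * ((p - 1) * β' + (p - 2) * x ^ 2) := by
    intro x hx
    have h1 : exp (s * r x) ≤ η / β ^ (2 - p) := by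
      rw [← exp_log (div_pos hη0 hc0)]
      refine exp_le_exp.2 ?_
      have := mul_le_mul_of_nonneg_left (hrC x hx) hs.le
      rwa [mul_div_cancel₀ _ hs.ne'] at this
    rw [le_div_iff₀ hc0] at h1
    have h2 : x ^ (p + s) ≤ 1 := rpow_le_one hx.1 hx.2 (by linarith)
    have h3 : β ^ (2 - p) * exp (s * r x) * x ^ (p + s) ≤ η :=
      (mul_le_of_le_one_right (by positivity) h2).trans (by linarith)
    unfold polarSpeed
    have : η = β * (p - 1) * (β' - β) := hη
    linarith
  have hle : opening p β' ≤ polarTime p β s r := by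
    refine intervalIntegral.integral_mono_on pi_pos.le
      ((hβ'.continuous_timeDensity hp).intervalIntegrable _ _) (hGc.intervalIntegrable _ _)
      fun ψ _ => ?_
    have h1 := hD _ (abs_sin_mem ψ)
    have h2 := hr.pos _ (abs_sin_mem ψ)
    have h3 : timeDensity p β' ψ = β * phi p |sin ψ| /
        (β * ((p - 1) * β' + (p - 2) * |sin ψ| ^ 2)) := by
      rw [mul_div_mul_left _ _ hβ.ne', timeDensity]
      simp only [phi, sq_abs]
    rw [h3]
    exact div_le_div_of_nonneg_left (mul_pos hβ (phi_abs_sin_pos hp ψ)).le h2 h1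
  linarith

/-- A large initial radius must leave the nonlinear term large although $r$ falls quickly. The
quantity $P=e^{-sr}$ satisfies the linear inequality $P'\le kP+k'x^{p+s-1}$ near $0$. Hence
$P(0)=y^{p+s}$ forces $P(y)\le Cy^{p+s}$, and monotonicity of $r+\log x$ carries the bound on to
$[x_0,1]$, gaining the factor $(x_0/y)^p$. -/
theorem exists_polarTime_lt {p β s L : ℝ} (hp : 1 < p) (hβ : 0 < β) (hs : 0 < s) (hL : 0 < L) :
    ∃ r₀, ∀ r, PolarSolution p β s r₀ r → polarTime p β s r < L := by
  have hp1 := sub_pos.2 hp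
  obtain ⟨x₁, hx0, hx1, hdx⟩ := exists_initial_interval hp hβ
  set δ := (p - 1) * β ^ 2 / 2 with hδ
  have hδ0 : 0 < δ := by positivity
  set α := (2 - p) * β * (1 + β) with hα
  set c := β ^ (2 - p) with hc
  have hc0 : 0 < c := by positivity
  have hπ := pi_pos
  set ψ₀ := min x₁ (L * δ / (8 * (β * p))) with hψ₀
  have hψ₀0 : 0 < ψ₀ := by positivity
  have hψ₀x : ψ₀ ≤ x₁ := min_le_left _ _
  have hψ₀π : ψ₀ < π / 2 := by linarith [pi_gt_three]
  set x₀ := sin ψ₀ with hx₀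
  have hx₀0 : 0 < x₀ := sin_pos_of_pos_of_lt_pi hψ₀0 (by linarith)
  have hx₀x : x₀ ≤ x₁ := (sin_le hψ₀0.le).trans hψ₀x
  -- A nonlinear term of at least $K$ makes the density at most $L/(4\pi)$; the two pieces near the
  -- ends take at most $L/8$ each, so the total is at most $L/2$.
  set K := |p - 2| * β + 4 * π * (β * p) / L with hK
  have hK0 : 0 < K := by positivity
  set k := s * |α| / δ with hk
  set k' := s * c / δ with hk'
  have hk0 : 0 ≤ k := by positivity
  have hk'0 : 0 < k' := by positivity
  set C := exp k * (1 + k') with hC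
  have hC0 : 0 < C := by positivity
  set y := min x₀ ((c * x₀ ^ p / (C * K)) ^ (1 / p)) with hy
  have hy0 : 0 < y := by positivity
  have hyx : y ≤ x₁ := (min_le_left _ _).trans hx₀x
  have hyp : y ^ p ≤ c * x₀ ^ p / (C * K) := by
    have h1 : y ≤ (c * x₀ ^ p / (C * K)) ^ (1 / p) := min_le_right _ _
    have h2 := rpow_le_rpow hy0.le h1 (by linarith : 0 ≤ p)
    rwa [← rpow_mul (by positivity), one_div_mul_cancel (by linarith), rpow_one] at h2
  -- This is the initial value with $e^{-sr_0}=y^{p+s}$.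
  refine ⟨-((p + s) / s * log y), fun r hr => ?_⟩
  have hinit := fun x hx => (hr.le_of_initial hβ hδ0 hx1 hdx (x := x) hx).1
  have hP : exp (-(s * r y)) ≤ C * y ^ (p + s) := by
    have hanti : AntitoneOn (fun x => exp (-(s * r x)) * exp (-(k * x)) - k' * x ^ (p + s))
        (Icc 0 x₁) := by
      have hsub : ∀ x ∈ Ioo 0 x₁, x ∈ Ioo (0 : ℝ) 1 := fun x hx => ⟨hx.1, hx.2.trans_le hx1⟩
      refine antitoneOn_Icc_of_hasDerivAt ?_ (fun x hx =>
        ((((hr.hasDerivAt (hsub x hx)).const_mul s).neg.exp.mul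
          ((hasDerivAt_id x).const_mul k).neg.exp).sub
          ((Real.hasDerivAt_rpow_const (p := p + s) (Or.inl hx.1.ne')).const_mul k')))
        fun x hx => ?_
      · have h1 : Continuous (fun x : ℝ => x ^ (p + s)) := Real.continuous_rpow_const (by linarith)
        have h2 := hr.continuousOn.mono (Icc_subset_Icc_right hx1)
        fun_prop
      · have hx' := hsub x hx
        have hD := hinit x (Ioo_subset_Icc_self hx)
        have hD0 := hδ0.trans_le hD
        have hX0 : 0 ≤ x ^ (p + s - 1) := rpow_nonneg hx.1.le _
        have hP0 : 0 < exp (-(s * r x)) := exp_pos _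
        have hmul : exp (-(s * r x)) * exp (s * r x) = 1 := by rw [← exp_add]; simp
        have h1 : exp (-(s * r x)) * -(s * polarField p β s 1 x (r x)) ≤
            k * exp (-(s * r x)) + k' * x ^ (p + s - 1) := by
          have e : exp (-(s * r x)) * -(s * polarField p β s 1 x (r x)) =
              (s * (-(α * x) * exp (-(s * r x)) + c * x ^ (p + s - 1))) /
                polarSpeed p β s 1 x (r x) := by
            rw [polarField]
            field_simp
            linear_combination (c * x ^ (p + s - 1)) * hmul
          have h2 : -(α * x) ≤ |α| := by
            have h3 := mul_le_mul_of_nonneg_right (neg_abs_le α) hx.1.le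
            have h4 := mul_le_of_le_one_right (abs_nonneg α) hx'.2.le
            linarith
          rw [e, show k * exp (-(s * r x)) + k' * x ^ (p + s - 1) =
            s * (|α| * exp (-(s * r x)) + c * x ^ (p + s - 1)) / δ by rw [hk, hk']; ring]
          refine div_le_div₀ (by positivity) ?_ hδ0 hD
          gcongr
        have h5 : exp (-(k * x)) ≤ 1 := exp_le_one_iff.2 (by
          have := mul_nonneg hk0 hx.1.le; linarith)
        have h6 := exp_pos (-(k * x))
        have h7 := mul_le_mul_of_nonneg_right h1 h6.le
        have h8 : k' * x ^ (p + s - 1) * exp (-(k * x)) ≤ k' * x ^ (p + s - 1) :=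
          mul_le_of_le_one_right (by positivity) h5
        have h9 : k' * x ^ (p + s - 1) ≤ k' * ((p + s) * x ^ (p + s - 1)) := by
          refine mul_le_mul_of_nonneg_left ?_ hk'0.le
          exact le_mul_of_one_le_left hX0 (by linarith)
        simp only [Pi.neg_apply, id_eq, mul_one]
        linarith
    have h1 := hanti (left_mem_Icc.2 hx0.le) ⟨hy0.le, hyx⟩ hy0.le
    have h2 : exp (-(s * r 0)) = y ^ (p + s) := by
      rw [hr.init, rpow_def_of_pos hy0]
      congr 1
      field_simp
    simp only [h2, mul_zero, neg_zero, exp_zero, mul_one,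
      zero_rpow (by linarith : p + s ≠ 0), sub_zero] at h1
    have h3 : exp (-(s * r y)) = exp (-(s * r y)) * exp (-(k * y)) * exp (k * y) := by
      rw [mul_assoc, ← exp_add]; simp
    have h4 : exp (k * y) ≤ exp k :=
      exp_le_exp.2 (mul_le_of_le_one_right hk0 (hyx.trans hx1))
    have h5 : exp (-(s * r y)) * exp (-(k * y)) ≤ (1 + k') * y ^ (p + s) := by linarith
    rw [h3]
    calc _ ≤ (1 + k') * y ^ (p + s) * exp k := by gcongr
      _ = _ := by rw [hC]; ring
  have hZ : ∀ x ∈ Icc x₀ 1, K ≤ c * exp (s * r x) * x ^ (p + s) := by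
    intro x hx
    have hyx0 : y ≤ x₀ := min_le_left _ _
    have h1 := hr.monotoneOn_log hp hy0 (left_mem_Icc.2 (hyx.trans hx1)) ⟨hyx0.trans hx.1, hx.2⟩
      (hyx0.trans hx.1)
    simp only at h1
    have hxpos := hx₀0.trans_le hx.1
    have h2 : exp (s * r y) * y ^ (p + s) = exp (s * (r y + log y)) * y ^ p := exp_mul_rpow_eq hy0
    have h3 : 1 ≤ C * (exp (s * r y) * y ^ (p + s)) := by
      have := mul_le_mul_of_nonneg_right hP (exp_pos (s * r y)).le
      rw [← exp_add, neg_add_cancel, exp_zero] at this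
      linarith
    rw [h2] at h3
    have h4 : K * (C * (exp (s * (r y + log y)) * y ^ p)) ≤
        c * (exp (s * (r y + log y)) * x₀ ^ p) := by
      rw [le_div_iff₀ (by positivity)] at hyp
      have := mul_le_mul_of_nonneg_left hyp (exp_pos (s * (r y + log y))).le
      linarith
    have h5 : exp (s * (r y + log y)) * x₀ ^ p ≤ exp (s * (r x + log x)) * x ^ p := by
      have := rpow_le_rpow hx₀0.le hx.1 (by linarith : 0 ≤ p)
      gcongr
    rw [mul_assoc, exp_mul_rpow_eq hxpos]
    have h6 := mul_le_mul_of_nonneg_left h3 hK0.le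
    have h7 := mul_le_mul_of_nonneg_left h5 hc0.le
    linarith
  have hGc := hr.continuous_polarDensity hp hs
  have hG0 := hr.polarDensity_pos hp hβ
  have hint : ∀ u v, IntervalIntegrable (polarDensity p β s r) volume u v := fun u v =>
    hGc.intervalIntegrable u v
  have hφ : ∀ ψ, β * phi p |sin ψ| ≤ β * p := fun ψ =>
    mul_le_mul_of_nonneg_left (phi_le hp (by rw [sq_abs]; exact sin_sq_le_one ψ)) hβ.le
  have hsmall : ∀ ψ, |sin ψ| ≤ x₁ → polarDensity p β s r ψ ≤ β * p / δ := fun ψ hψ =>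
    div_le_div₀ (by positivity) (hφ ψ) hδ0 (hinit _ ⟨abs_nonneg _, hψ⟩)
  have hlarge : ∀ ψ, x₀ ≤ |sin ψ| → polarDensity p β s r ψ ≤ L / (4 * π) := by
    intro ψ hψ
    have h1 := hZ _ ⟨hψ, abs_sin_le_one ψ⟩
    have h2 : 4 * π * (β * p) / L ≤ polarSpeed p β s 1 |sin ψ| (r |sin ψ|) := by
      have h3 : -(|p - 2| * β) ≤ (p - 2) * β * |sin ψ| ^ 2 := by
        have e1 := mul_le_mul_of_nonneg_right (neg_abs_le (p - 2))
          (by positivity : 0 ≤ β * |sin ψ| ^ 2)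
        have e2 : |sin ψ| ^ 2 ≤ 1 := by rw [sq_abs]; exact sin_sq_le_one ψ
        have e3 : |p - 2| * β * |sin ψ| ^ 2 ≤ |p - 2| * β :=
          mul_le_of_le_one_right (by positivity) e2
        linarith
      have h4 : 0 ≤ (p - 1) * β ^ 2 := by positivity
      unfold polarSpeed
      linarith
    have h5 : 0 < 4 * π * (β * p) / L := by positivity
    refine (div_le_div₀ (by positivity) (hφ ψ) h5 h2).trans (le_of_eq ?_)
    field_simp
  have hI1 : ∫ ψ in (0 : ℝ)..ψ₀, polarDensity p β s r ψ ≤ L / 8 := by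
    have h1 : ∫ ψ in (0 : ℝ)..ψ₀, polarDensity p β s r ψ ≤ ∫ ψ in (0 : ℝ)..ψ₀, β * p / δ :=
      intervalIntegral.integral_mono_on hψ₀0.le (hint _ _) (by simp) fun ψ hψ => by
        refine hsmall ψ ?_
        rw [abs_of_nonneg (sin_nonneg_of_nonneg_of_le_pi hψ.1 (by linarith [hψ.2]))]
        exact (sin_le hψ.1).trans (hψ.2.trans hψ₀x)
    rw [intervalIntegral.integral_const, smul_eq_mul, sub_zero] at h1
    have h2 : ψ₀ * (β * p / δ) ≤ L * δ / (8 * (β * p)) * (β * p / δ) :=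
      mul_le_mul_of_nonneg_right (min_le_right _ _) (by positivity)
    have h3 : L * δ / (8 * (β * p)) * (β * p / δ) = L / 8 := by field_simp
    linarith
  have hI3 : ∫ ψ in (π - ψ₀)..π, polarDensity p β s r ψ ≤ L / 8 := by
    have : ∫ ψ in (π - ψ₀)..π, polarDensity p β s r ψ =
        ∫ ψ in (0 : ℝ)..ψ₀, polarDensity p β s r ψ := by
      have h1 := intervalIntegral.integral_comp_sub_left (a := 0) (b := ψ₀)
        (polarDensity p β s r) π
      rw [sub_zero] at h1
      rw [← h1]
      refine intervalIntegral.integral_congr fun ψ _ => ?_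
      simp only [polarDensity, sin_pi_sub]
    rw [this]
    exact hI1
  have hI2 : ∫ ψ in ψ₀..(π - ψ₀), polarDensity p β s r ψ ≤ L / 4 := by
    have h1 : ∫ ψ in ψ₀..(π - ψ₀), polarDensity p β s r ψ ≤ ∫ ψ in ψ₀..(π - ψ₀), L / (4 * π) :=
      intervalIntegral.integral_mono_on (by linarith) (hint _ _) (by simp) fun ψ hψ => by
        refine hlarge ψ (le_trans ?_ (le_abs_self _))
        rcases le_total ψ (π / 2) with h | h
        · exact sin_le_sin_of_le_of_le_pi_div_two (by linarith) h hψ.1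
        · rw [← sin_pi_sub ψ]
          exact sin_le_sin_of_le_of_le_pi_div_two (by linarith) (by linarith) (by linarith [hψ.2])
    rw [intervalIntegral.integral_const, smul_eq_mul] at h1
    have h2 : (π - ψ₀ - ψ₀) * (L / (4 * π)) ≤ π * (L / (4 * π)) :=
      mul_le_mul_of_nonneg_right (by linarith) (by positivity)
    have h3 : π * (L / (4 * π)) = L / 4 := by field_simp
    linarith
  have hsum : polarTime p β s r = (∫ ψ in (0 : ℝ)..ψ₀, polarDensity p β s r ψ) +
      (∫ ψ in ψ₀..(π - ψ₀), polarDensity p β s r ψ) +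
      ∫ ψ in (π - ψ₀)..π, polarDensity p β s r ψ := by
    rw [intervalIntegral.integral_add_adjacent_intervals (hint _ _) (hint _ _),
      intervalIntegral.integral_add_adjacent_intervals (hint _ _) (hint _ _), polarTime]
  linarith

theorem exists_nonlinear_intervalSolution {p β β' s a b : ℝ} (hp : 1 < p) (hβ : 0 < β) (hs : 0 < s)
    (hab : a < b) (hββ' : β < β') (hβ' : Admissible p β') (hL : b - a < opening p β') :
    ∃ u : ℝ → ℝ, IntervalSolution p β s 1 a b u := by
  choose r hr using exists_polarSolution hp hβ hs
  obtain ⟨r₁, h1⟩ := exists_polarTime_gt hp hβ hs hββ' hβ' hL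
  obtain ⟨r₂, h2⟩ := exists_polarTime_lt hp hβ hs (sub_pos.2 hab)
  obtain ⟨r₀, hr₀⟩ := mem_range_of_exists_le_of_exists_ge
    (continuous_polarTime hp hβ hs hr) ⟨r₂, (h2 _ (hr r₂)).le⟩ ⟨r₁, (h1 _ (hr r₁)).le⟩
  refine exists_intervalSolution hp hβ hs hab (hr r₀).deriv (hr r₀).pos ?_
  refine Eq.trans ?_ hr₀
  simp only [polarTime]
  refine intervalIntegral.integral_congr fun ψ hψ => ?_
  rw [uIcc_of_le pi_pos.le] at hψ
  simp only [polarDensity, abs_of_nonneg (sin_nonneg_of_nonneg_of_le_pi hψ.1 hψ.2)]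

end SectorODE

/-! ### Assembly -/

namespace SectorODE
open Set

theorem isSpectralExponent_iff {p β a b : ℝ} (hp : 1 < p) (hab : a < b)
    (hb : b < a + 2 * Real.pi) :
    IsSpectralExponent p (Circle.exp '' Ioo a b) β ↔ Admissible p β ∧ opening p β = b - a := by
  constructor
  · rintro ⟨hβ, φ, hφ⟩
    exact (((isSpectralSolution_iff 1 hab hb φ).1 hφ).orbit hp hβ hab).spectral hp hβ hab
  · rintro ⟨hβ, hL⟩
    obtain ⟨u, hu⟩ := exists_spectral_intervalSolution (s := 1) hp one_pos hab hβ hL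
    obtain ⟨φ, hφ⟩ := exists_circle_lift hb u
    exact ⟨hβ.1, φ, (isSpectralSolution_iff 1 hab hb φ).2 (hu.congr hab hφ)⟩

theorem exists_isPositiveSolution_iff {p q a b βS : ℝ} (hp : 1 < p) (hq : p - 1 < q) (hab : a < b)
    (hb : b < a + 2 * Real.pi) (hS : Admissible p βS) (hL : opening p βS = b - a) :
    (∃ ω : Circle → ℝ, IsPositiveSolution p q (Circle.exp '' Ioo a b) ω) ↔ betaQ p q < βS := by
  have hs : 0 < q + 1 - p := by linarith
  have hβ : 0 < betaQ p q := div_pos (by linarith) hs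
  constructor
  · rintro ⟨ω, hω⟩
    by_contra! hle
    have h1 := ((isPositiveSolution_iff hq hab hb ω).1 hω).orbit hp hβ hab
    have h2 := h1.lt_opening hp one_pos hab (hS.mono hp hle)
    rcases hle.eq_or_lt with h | h
    · rw [← h] at h2; linarith
    · have := opening_lt_opening hp hS h
      linarith
  · intro hlt
    have hp1 := sub_pos.2 hp
    have h1 : (2 - p) / (p - 1) < βS := by
      rw [div_lt_iff₀ hp1]; linarith [hS.2]
    -- $\beta_q$ itself may fail to be admissible, so the comparison uses an admissible exponent
    -- strictly between $\beta_q$ and $\beta_S$.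
    obtain ⟨β', h2, h3⟩ := exists_between (max_lt hlt h1)
    have h4 : betaQ p q < β' := (le_max_left _ _).trans_lt h2
    have h5 : (2 - p) / (p - 1) < β' := (le_max_right _ _).trans_lt h2
    have hβ' : Admissible p β' := by
      refine ⟨hβ.trans h4, ?_⟩
      rw [div_lt_iff₀ hp1] at h5; linarith
    obtain ⟨u, hu⟩ := exists_nonlinear_intervalSolution hp hβ hs hab h4 hβ'
      (hL ▸ opening_lt_opening hp hβ' h3)
    obtain ⟨ω, hω⟩ := exists_circle_lift hb u
    exact ⟨ω, (isPositiveSolution_iff hq hab hb ω).2 (hu.congr hab hω)⟩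

end SectorODE

theorem corollary1 (p q : ℝ) (hp : 1 < p) (hq : p - 1 < q) (S : Set Circle) (hS : IsSector S) :
    (∃! βS : ℝ, IsSpectralExponent p S βS) ∧
    (∀ βS : ℝ, IsSpectralExponent p S βS →
      ((∃ ω : Circle → ℝ, IsPositiveSolution p q S ω) ↔ betaQ p q < βS)) ∧
    (∀ ω₁ ω₂ : Circle → ℝ, IsPositiveSolution p q S ω₁ → IsPositiveSolution p q S ω₂ →
      Set.EqOn ω₁ ω₂ (closure S)) ∧
    (p < 2 → 2 * (p - 1) / (2 - p) ≤ q → ∃ ω : Circle → ℝ, IsPositiveSolution p q S ω) := by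
  obtain ⟨a, b, hab, hb, rfl⟩ := hS
  have hp1 := sub_pos.2 hp
  have hs : 0 < q + 1 - p := by linarith
  have hβ : 0 < betaQ p q := div_pos (by linarith) hs
  obtain ⟨β₀, hβ₀, hL⟩ := SectorODE.exists_opening_eq hp (sub_pos.2 hab)
  refine ⟨⟨β₀, (SectorODE.isSpectralExponent_iff hp hab hb).2 ⟨hβ₀, hL⟩, fun β h => ?_⟩,
    fun βS h => ?_, fun ω₁ ω₂ h₁ h₂ => ?_, fun hp2 hpq => ?_⟩
  · obtain ⟨h1, h2⟩ := (SectorODE.isSpectralExponent_iff hp hab hb).1 h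
    rcases lt_trichotomy β β₀ with hlt | heq | hgt
    · linarith [SectorODE.opening_lt_opening hp h1 hlt]
    · exact heq
    · linarith [SectorODE.opening_lt_opening hp hβ₀ hgt]
  · obtain ⟨h1, h2⟩ := (SectorODE.isSpectralExponent_iff hp hab hb).1 h
    exact SectorODE.exists_isPositiveSolution_iff hp hq hab hb h1 h2
  · rw [SectorODE.closure_circleExp_Ioo hab]
    rintro _ ⟨t, ht, rfl⟩
    exact ((SectorODE.isPositiveSolution_iff hq hab hb ω₁).1 h₁).eqOn hp hβ hs one_pos hab
      ((SectorODE.isPositiveSolution_iff hq hab hb ω₂).1 h₂) ht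
  · refine (SectorODE.exists_isPositiveSolution_iff hp hq hab hb hβ₀ hL).2 ?_
    have h1 : (2 - p) / (p - 1) < β₀ := by
      rw [div_lt_iff₀ hp1]; linarith [hβ₀.2]
    -- The threshold on $q$ is equivalent to $\beta_q\le(2-p)/(p-1)$, the lower limit of
    -- admissibility.
    refine lt_of_le_of_lt ?_ h1
    have h2 := (div_le_iff₀ (sub_pos.2 hp2)).1 hpq
    rw [betaQ, div_le_div_iff₀ hs hp1]
    nlinarith
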